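/- **Conventions.** A standard Young tableau of shape $3\times n$ is a filling of three rows of $n$ boxes by $1,\dots,3n$ without repetition, increasing from left to right along rows and from bottom to top along columns. Its *jeu-de-taquin promotion* $\partial T$ is obtained by erasing $1$, performing jeu-de-taquin slides (if $a$ is above and $b$ to the right of the empty box, then $a$ slides down if $a<b$ and $b$ slides left if $b<a$, missing numbers counting as $\infty$) until the empty box has no neighbour above or to the right, lowering all remaining numbers by one, and putting $3n$ into the empty box. The *$\mathsf m$-diagram* of $T$ consists of a horizontal boundary line with the points $1,\dots,3n$ and of semicircular arcs above it: for $i=1,2,\dots,3n$ not on the bottom row, $i$ is joined to the largest $j<i$ on the row immediately below $i$ that is not already on an arc with a number on the row of $i$. Arcs between the bottom and the middle row are directed from left to right, arcs between the middle and the top row from right to left. The *web* $W(T)$ is the resolution of this diagram: each boundary vertex on two arcs is replaced by a $Y$ whose stem is directed from the boundary to the trivalent vertex, and each crossing of two arcs is replaced by two trivalent vertices, a sink taking the two incoming edges and a source taking the two outgoing edges, joined by an edge from the source to the sink. A *web for $\mathfrak{sl}_3$* with $N$ boundary vertices is a finite planar directed graph above a boundary line (equivalently, in a disk), whose $N$ boundary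 vertices lie on the line, are numbered from left to right and have degree one, whose internal vertices are trivalent, and each of whose vertices is a source or a sink. Two such graphs are the same web if there is an isomorphism between them that preserves the directed edges, the cyclic order of the edges around each vertex, and the numbering of the boundary vertices. *Rotation* moves the first boundary vertex to the last position and every other boundary vertex one position to the left. **Proposition.** For every $n$ and every standard Young tableau $T$ of shape $3\times n$, the graph $W(T)$ is a web for $\mathfrak{sl}_3$, and the web $W(\partial T)$ of the promotion of $T$ is the rotation of the web $W(T)$. -/

import Mathlib

/-! ### Standard tableaux of shape `3 × n` and jeu-de-taquin promotion -/

/-- A standard Young tableau of shape `3 × n`, with rows numbered `0, 1, 2` from bottom to top: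
a filling by `1, …, 3n` without repetition, increasing from left to right along rows and
from bottom to top along columns. -/
@[ext]
structure StdTableau (n : ℕ) where
  entry : Fin 3 → Fin n → ℕ
  bijOn : Set.BijOn (fun p : Fin 3 × Fin n => entry p.1 p.2) Set.univ (Set.Icc 1 (3 * n))
  row_lt : ∀ r, StrictMono (entry r)
  col_lt : ∀ c, StrictMono (fun r => entry r c)

namespace JeuDeTaquin

/-- A partially emptied tableau: the number in each box `(row, column)`, with `⊤ = ∞` in the empty
box and outside the shape, together with the position of the empty box. -/
abbrev State := (ℕ × ℕ → ℕ∞) × (ℕ × ℕ)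

/-- Move the number in box `p` into the empty box, so that `p` becomes the empty box. -/
def move (s : State) (p : ℕ × ℕ) : State :=
  (Function.update (Function.update s.1 s.2 (s.1 p)) p ⊤, p)

/-- One jeu-de-taquin slide. With `a` above the empty box and `b` to the right of it, `a` slides
down if `a < b` and `b` slides left if `b < a`; nothing moves if neither of them exists. -/
noncomputable def slide (s : State) : State :=
  if s.1 (s.2.1 + 1, s.2.2) < s.1 (s.2.1, s.2.2 + 1) then move s (s.2.1 + 1, s.2.2)
  else if s.1 (s.2.1, s.2.2 + 1) < s.1 (s.2.1 + 1, s.2.2) then move s (s.2.1, s.2.2 + 1)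
  else s

/-- The numbers of a tableau, and `∞` outside the shape. -/
noncomputable def filling {n : ℕ} (T : StdTableau n) (p : ℕ × ℕ) : ℕ∞ :=
  if h : p.1 < 3 ∧ p.2 < n then (T.entry ⟨p.1, h.1⟩ ⟨p.2, h.2⟩ : ℕ∞) else ⊤

/-- The tableau with the number `1` (which is in the bottom left box) erased. -/
noncomputable def start {n : ℕ} (T : StdTableau n) : State :=
  (Function.update (filling T) (0, 0) ⊤, (0, 0))

/-- The result of all the slides; more than `3 * n` slides are never needed. -/
noncomputable def final {n : ℕ} (T : StdTableau n) : State :=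
  slide^[3 * n] (start T)

/-- The numbers of the promoted tableau: after the slides the remaining numbers are lowered
by one and `3n` is put in the empty box. -/
noncomputable def promotedEntry {n : ℕ} (T : StdTableau n) (r : Fin 3) (c : Fin n) : ℕ :=
  if ((r : ℕ), (c : ℕ)) = (final T).2 then 3 * n
  else ((final T).1 ((r : ℕ), (c : ℕ))).toNat - 1

/-- The properties of a partially emptied tableau that slides preserve. -/
structure Good (n : ℕ) (s : State) : Prop where
  hole : s.2.1 < 3 ∧ s.2.2 < n
  hole_top : s.1 s.2 = ⊤
  outside : ∀ p : ℕ × ℕ, ¬ (p.1 < 3 ∧ p.2 < n) → s.1 p = ⊤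
  val : ∀ p : ℕ × ℕ, p.1 < 3 → p.2 < n → p ≠ s.2 → ∃ k : ℕ, s.1 p = k ∧ 2 ≤ k ∧ k ≤ 3 * n
  surj : ∀ k : ℕ, 2 ≤ k → k ≤ 3 * n → ∃ p : ℕ × ℕ, p.1 < 3 ∧ p.2 < n ∧ p ≠ s.2 ∧ s.1 p = k
  inj : ∀ p q : ℕ × ℕ, s.1 p = s.1 q → s.1 p ≠ ⊤ → p = q
  mono : ∀ p q : ℕ × ℕ, p < q → p ≠ s.2 → q ≠ s.2 → p.1 < 3 → p.2 < n → q.1 < 3 → q.2 < n →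
    s.1 p < s.1 q

theorem good_start {n : ℕ} (hn : 0 < n) (T : StdTableau n) : Good n (start T) := by
  have hval : ∀ p : ℕ × ℕ, ∀ h : p.1 < 3 ∧ p.2 < n,
      filling T p = (T.entry ⟨p.1, h.1⟩ ⟨p.2, h.2⟩ : ℕ∞) := fun p h => by simp [filling, h]
  have hle : ∀ r r' : Fin 3, ∀ c c' : Fin n, r ≤ r' → c ≤ c' → T.entry r c ≤ T.entry r' c' :=
    fun r r' c c' h1 h2 => ((T.col_lt c).monotone h1).trans ((T.row_lt r').monotone h2)
  have hinj : ∀ r r' : Fin 3, ∀ c c' : Fin n, T.entry r c = T.entry r' c' → r = r' ∧ c = c' := by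
    intro r r' c c' h
    have := T.bijOn.injOn (Set.mem_univ (r, c)) (Set.mem_univ (r', c')) h
    simpa using this
  have hrange : ∀ r c, 1 ≤ T.entry r c ∧ T.entry r c ≤ 3 * n :=
    fun r c => T.bijOn.mapsTo (Set.mem_univ (r, c))
  have h00 : T.entry 0 ⟨0, hn⟩ = 1 := by
    obtain ⟨⟨r, c⟩, -, h⟩ := T.bijOn.surjOn (show 1 ∈ Set.Icc 1 (3 * n) by simp; omega)
    have h1 := hle 0 r ⟨0, hn⟩ c (Fin.zero_le _) (Fin.mk_le_of_le_val (Nat.zero_le _))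
    have h2 := (hrange 0 ⟨0, hn⟩).1
    simp only at h
    omega
  have hs : ∀ p : ℕ × ℕ, p ≠ (0, 0) → (start T).1 p = filling T p := fun p hp => by
    simp [start, hp]
  have htop : (start T).1 (0, 0) = ⊤ := by simp [start]
  refine ⟨⟨by simp [start], by simpa [start] using hn⟩, by simp [start], ?_, ?_, ?_, ?_, ?_⟩
  · intro p hp
    by_cases h : p = (0, 0)
    · rw [h, htop]
    · rw [hs p h, filling, dif_neg hp]
  · intro p h1 h2 hp
    have hp' : p ≠ (0, 0) := hp
    rw [hs p hp', hval p ⟨h1, h2⟩]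
    refine ⟨_, rfl, ?_, (hrange _ _).2⟩
    have h3 := (hrange ⟨p.1, h1⟩ ⟨p.2, h2⟩).1
    rcases h3.lt_or_eq with h | h
    · exact h
    · exfalso
      obtain ⟨h4, h5⟩ := hinj _ _ _ _ (h00.trans h)
      apply hp'
      have h4' := congrArg Fin.val h4
      have h5' := congrArg Fin.val h5
      simp only [Fin.val_zero] at h4' h5'
      exact Prod.ext h4'.symm h5'.symm
  · intro k hk1 hk2
    obtain ⟨⟨r, c⟩, -, h⟩ := T.bijOn.surjOn (show k ∈ Set.Icc 1 (3 * n) from ⟨by omega, hk2⟩)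
    have hne : ((r : ℕ), (c : ℕ)) ≠ (0, 0) := by
      intro h0
      have hr : r = 0 := Fin.ext (by simpa using congrArg Prod.fst h0)
      have hc : c = ⟨0, hn⟩ := Fin.ext (by simpa using congrArg Prod.snd h0)
      subst hr hc
      simp only at h
      omega
    refine ⟨((r : ℕ), (c : ℕ)), r.2, c.2, hne, ?_⟩
    rw [hs _ hne, hval _ ⟨r.2, c.2⟩]
    exact congrArg Nat.cast h
  · intro p q h htp
    have hp : p ≠ (0, 0) := by rintro rfl; exact htp htop
    have hq : q ≠ (0, 0) := by rintro rfl; exact htp (h.trans htop)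
    rw [hs p hp, hs q hq] at h
    rw [hs p hp] at htp
    have hp3 : p.1 < 3 ∧ p.2 < n := by
      by_contra hc; exact htp (by rw [filling, dif_neg hc])
    have hq3 : q.1 < 3 ∧ q.2 < n := by
      by_contra hc; exact htp (by rw [h, filling, dif_neg hc])
    rw [hval p hp3, hval q hq3] at h
    obtain ⟨h4, h5⟩ := hinj _ _ _ _ (Nat.cast_injective h)
    exact Prod.ext (congrArg Fin.val h4) (congrArg Fin.val h5)
  · intro p q hpq hp hq hp1 hp2 hq1 hq2
    rw [hs p hp, hs q hq, hval p ⟨hp1, hp2⟩, hval q ⟨hq1, hq2⟩]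
    have h1 := hle ⟨p.1, hp1⟩ ⟨q.1, hq1⟩ ⟨p.2, hp2⟩ ⟨q.2, hq2⟩ hpq.le.1 hpq.le.2
    rcases h1.lt_or_eq with h | h
    · exact_mod_cast h
    · obtain ⟨h4, h5⟩ := hinj _ _ _ _ h
      exact absurd (Prod.ext (congrArg Fin.val h4) (congrArg Fin.val h5)) hpq.ne

/-- Moving the smaller neighbour of the empty box into it preserves the invariant. -/
theorem Good.move {n : ℕ} {s : State} (hs : Good n s) (p u : ℕ × ℕ)
    (hp : p.1 < 3 ∧ p.2 < n) (hlt : s.2 < p) (hpu : s.1 p < s.1 u)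
    (hcov : ∀ q, s.2 < q → p ≤ q ∨ u ≤ q) (hu : s.2 < u) : Good n (move s p) := by
  obtain ⟨f, h⟩ := s
  have hph : p ≠ h := hlt.ne'
  simp only at *
  have e1 : (JeuDeTaquin.move (f, h) p).2 = p := rfl
  have e2 : (JeuDeTaquin.move (f, h) p).1 p = ⊤ := by simp [JeuDeTaquin.move]
  have e3 : (JeuDeTaquin.move (f, h) p).1 h = f p := by
    simp [JeuDeTaquin.move, Function.update_of_ne hph.symm]
  have e4 : ∀ q, q ≠ p → q ≠ h → (JeuDeTaquin.move (f, h) p).1 q = f q := fun q h1 h2 => by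
    simp [JeuDeTaquin.move, Function.update_of_ne h1, Function.update_of_ne h2]
  refine ⟨hp, e2, ?_, ?_, ?_, ?_, ?_⟩
  · intro q hq
    have h1 : q ≠ p := by rintro rfl; exact hq hp
    have h2 : q ≠ h := by rintro rfl; exact hq hs.hole
    rw [e4 q h1 h2]
    exact hs.outside q hq
  · intro q h1 h2 hq
    rw [e1] at hq
    by_cases hqh : q = h
    · rw [hqh, e3]; exact hs.val p hp.1 hp.2 hph
    · rw [e4 q hq hqh]; exact hs.val q h1 h2 hqh
  · intro k h1 h2
    obtain ⟨q, q1, q2, q3, q4⟩ := hs.surj k h1 h2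
    by_cases hqp : q = p
    · exact ⟨h, hs.hole.1, hs.hole.2, hph.symm, by rw [e3, ← hqp]; exact q4⟩
    · exact ⟨q, q1, q2, hqp, by rw [e4 q hqp q3]; exact q4⟩
  · intro q r hqr htop
    have hq : q ≠ p := by rintro rfl; exact htop e2
    have hr : r ≠ p := by rintro rfl; exact htop (hqr.trans e2)
    by_cases hqh : q = h
    · by_cases hrh : r = h
      · rw [hqh, hrh]
      · rw [hqh, e3] at htop
        rw [hqh, e3, e4 r hr hrh] at hqr
        exact absurd (hs.inj p r hqr htop).symm hr
    · rw [e4 q hq hqh] at hqr htop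
      by_cases hrh : r = h
      · rw [hrh, e3] at hqr
        exact absurd (hs.inj q p hqr htop) hq
      · rw [e4 r hr hrh] at hqr
        exact hs.inj q r hqr htop
  · intro q r hqr hq hr q1 q2 r1 r2
    rw [e1] at hq hr
    by_cases hqh : q = h
    · subst hqh
      rw [e3, e4 r hr hqr.ne']
      rcases hcov r hqr with h1 | h1
      · exact hs.mono p r (lt_of_le_of_ne h1 hr.symm) hph hqr.ne' hp.1 hp.2 r1 r2
      · rcases eq_or_ne u r with rfl | h2
        · exact hpu
        · exact hpu.trans (hs.mono u r (lt_of_le_of_ne h1 h2) hu.ne' hqr.ne'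
            (lt_of_le_of_lt h1.1 r1) (lt_of_le_of_lt h1.2 r2) r1 r2)
    · by_cases hrh : r = h
      · subst hrh
        rw [e3, e4 q hq hqh]
        exact hs.mono q p (hqr.trans hlt) hqh hph q1 q2 hp.1 hp.2
      · rw [e4 q hq hqh, e4 r hr hrh]
        exact hs.mono q r hqr hqh hrh q1 q2 r1 r2

theorem good_slide {n : ℕ} {s : State} (hs : Good n s) :
    Good n (slide s) ∧ ((s.2 = (2, n - 1) ∧ slide s = s) ∨
      (slide s).2.1 + (slide s).2.2 = s.2.1 + s.2.2 + 1) := by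
  have ha : s.2 < (s.2.1 + 1, s.2.2) := Prod.lt_iff.2 (Or.inl ⟨Nat.lt_succ_self _, le_rfl⟩)
  have hb : s.2 < (s.2.1, s.2.2 + 1) := Prod.lt_iff.2 (Or.inr ⟨le_rfl, Nat.lt_succ_self _⟩)
  have hcov : ∀ q, s.2 < q → (s.2.1 + 1, s.2.2) ≤ q ∨ (s.2.1, s.2.2 + 1) ≤ q := by
    intro q hq
    rcases Prod.lt_iff.1 hq with h | h
    · exact Or.inl ⟨h.1, h.2⟩
    · exact Or.inr ⟨h.1, h.2⟩
  have hin : ∀ p, s.1 p ≠ ⊤ → p.1 < 3 ∧ p.2 < n := fun p hp => by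
    by_contra hc; exact hp (hs.outside p hc)
  unfold slide
  split_ifs with h1 h2
  · refine ⟨hs.move _ _ (hin _ h1.ne_top) ha h1 hcov hb, Or.inr ?_⟩
    simp only [move]; omega
  · refine ⟨hs.move _ _ (hin _ h2.ne_top) hb h2 (fun q hq => (hcov q hq).symm) ha, Or.inr ?_⟩
    simp only [move]; omega
  · refine ⟨hs, Or.inl ⟨?_, rfl⟩⟩
    have heq : s.1 (s.2.1 + 1, s.2.2) = s.1 (s.2.1, s.2.2 + 1) :=
      le_antisymm (not_lt.1 h2) (not_lt.1 h1)
    have htop : s.1 (s.2.1 + 1, s.2.2) = ⊤ := by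
      by_contra hc
      have := congrArg Prod.fst (hs.inj _ _ heq hc)
      simp at this
    have hout : ∀ p, s.1 p = ⊤ → p ≠ s.2 → ¬ (p.1 < 3 ∧ p.2 < n) := by
      intro p hp hne hc
      obtain ⟨k, hk, -⟩ := hs.val p hc.1 hc.2 hne
      rw [hp] at hk
      exact ENat.top_ne_natCast k hk
    have o1 := hout _ htop ha.ne'
    have o2 := hout _ (heq ▸ htop) hb.ne'
    have := hs.hole
    simp only at o1 o2
    exact Prod.ext (by simp only; omega) (by simp only; omega)

theorem good_final {n : ℕ} (hn : 0 < n) (T : StdTableau n) :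
    Good n (final T) ∧ (final T).2 = (2, n - 1) := by
  have key : ∀ m, Good n (slide^[m] (start T)) ∧ ((slide^[m] (start T)).2 = (2, n - 1) ∨
      (slide^[m] (start T)).2.1 + (slide^[m] (start T)).2.2 = m) := by
    intro m
    induction m with
    | zero => exact ⟨good_start hn T, Or.inr (by simp [start])⟩
    | succ m ih =>
      rw [Function.iterate_succ_apply']
      obtain ⟨h1, h2⟩ := good_slide ih.1
      refine ⟨h1, ?_⟩
      rcases h2 with h2 | h2
      · left; rw [h2.2, h2.1]
      · rcases ih.2 with h3 | h3
        · exfalso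
          have := h1.hole
          rw [h3] at h2
          simp only at h2
          omega
        · right; omega
  obtain ⟨h1, h2⟩ := key (3 * n)
  refine ⟨h1, ?_⟩
  rcases h2 with h2 | h2
  · exact h2
  · have := h1.hole
    omega

end JeuDeTaquin

open JeuDeTaquin in
/-- Jeu-de-taquin promotion of a standard tableau of shape `3 × n`. -/
noncomputable def StdTableau.promotion {n : ℕ} (T : StdTableau n) : StdTableau n where
  entry := promotedEntry T
  bijOn := by
    rcases Nat.eq_zero_or_pos n with rfl | hn
    · refine ⟨fun p => p.2.elim0, fun p => p.2.elim0, fun k hk => ?_⟩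
      simp at hk
    obtain ⟨hg, hh⟩ := good_final hn T
    have hv : ∀ (r : Fin 3) (c : Fin n), ((r : ℕ), (c : ℕ)) ≠ (final T).2 → ∃ k : ℕ,
        (final T).1 ((r : ℕ), (c : ℕ)) = k ∧ 2 ≤ k ∧ k ≤ 3 * n ∧ promotedEntry T r c = k - 1 := by
      intro r c h
      obtain ⟨k, h1, h2, h3⟩ := hg.val _ r.2 c.2 h
      exact ⟨k, h1, h2, h3, by simp [promotedEntry, h, h1]⟩
    have hw : ∀ (r : Fin 3) (c : Fin n), ((r : ℕ), (c : ℕ)) = (final T).2 → promotedEntry T r c = 3 * n := by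
      intro r c h
      simp [promotedEntry, h]
    refine ⟨?_, ?_, ?_⟩
    · rintro ⟨r, c⟩ -
      by_cases h : ((r : ℕ), (c : ℕ)) = (final T).2
      · simp only [hw r c h, Set.mem_Icc]; omega
      · obtain ⟨k, -, h2, h3, h4⟩ := hv r c h
        simp only [h4, Set.mem_Icc]; omega
    · rintro ⟨r, c⟩ - ⟨r', c'⟩ - he
      simp only at he
      have hfin : ((r : ℕ), (c : ℕ)) = ((r' : ℕ), (c' : ℕ)) → (r, c) = (r', c') := by
        intro h
        exact Prod.ext (Fin.ext (congrArg Prod.fst h)) (Fin.ext (congrArg Prod.snd h))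
      by_cases h : ((r : ℕ), (c : ℕ)) = (final T).2 <;>
        by_cases h' : ((r' : ℕ), (c' : ℕ)) = (final T).2
      · exact hfin (h.trans h'.symm)
      · obtain ⟨k, -, h2, h3, h4⟩ := hv r' c' h'
        rw [hw r c h] at he; omega
      · obtain ⟨k, -, h2, h3, h4⟩ := hv r c h
        rw [hw r' c' h'] at he; omega
      · obtain ⟨k, h1, h2, h3, h4⟩ := hv r c h
        obtain ⟨k', h1', h2', h3', h4'⟩ := hv r' c' h'
        have hk : k = k' := by omega
        subst hk
        exact hfin (hg.inj _ _ (h1.trans h1'.symm) (by rw [h1]; exact ENat.natCast_ne_top k))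
    · intro k hk
      rcases hk.2.lt_or_eq with h | h
      · obtain ⟨p, p1, p2, p3, p4⟩ := hg.surj (k + 1) (by have := hk.1; omega) (by omega)
        obtain ⟨k', h1', -, -, h4'⟩ := hv ⟨p.1, p1⟩ ⟨p.2, p2⟩ p3
        refine ⟨(⟨p.1, p1⟩, ⟨p.2, p2⟩), Set.mem_univ _, ?_⟩
        have : ((k + 1 : ℕ) : ℕ∞) = k' := p4.symm.trans h1'
        have : k + 1 = k' := Nat.cast_injective this
        simp only [h4']; omega
      · refine ⟨(⟨2, by omega⟩, ⟨n - 1, by omega⟩), Set.mem_univ _, ?_⟩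
        simp only [h]
        exact hw _ _ hh.symm
  row_lt := by
    intro r c c' hc
    have hn : 0 < n := by have := c.2; omega
    obtain ⟨hg, hh⟩ := good_final hn T
    have hc' : (c : ℕ) < c' := hc
    have h1 : ((r : ℕ), (c : ℕ)) ≠ (final T).2 := by
      rw [hh]; intro h; have := congrArg Prod.snd h; simp only at this; have := c'.2; omega
    obtain ⟨k, k1, k2, k3⟩ := hg.val _ r.2 c.2 h1
    by_cases h2 : ((r : ℕ), (c' : ℕ)) = (final T).2
    · simp [promotedEntry, h1, h2, k1]; omega
    · obtain ⟨l, l1, l2, l3⟩ := hg.val _ r.2 c'.2 h2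
      have := hg.mono ((r : ℕ), (c : ℕ)) ((r : ℕ), (c' : ℕ)) (Prod.lt_iff.2 (Or.inr ⟨le_rfl, hc'⟩))
        h1 h2 r.2 c.2 r.2 c'.2
      rw [k1, l1] at this
      have : k < l := by exact_mod_cast this
      simp [promotedEntry, h1, h2, k1, l1]; omega
  col_lt := by
    intro c r r' hr
    have hn : 0 < n := by have := c.2; omega
    obtain ⟨hg, hh⟩ := good_final hn T
    have hr' : (r : ℕ) < r' := hr
    have h1 : ((r : ℕ), (c : ℕ)) ≠ (final T).2 := by
      rw [hh]; intro h; have := congrArg Prod.fst h; simp only at this; have := r'.2; omega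
    obtain ⟨k, k1, k2, k3⟩ := hg.val _ r.2 c.2 h1
    by_cases h2 : ((r' : ℕ), (c : ℕ)) = (final T).2
    · simp [promotedEntry, h1, h2, k1]; omega
    · obtain ⟨l, l1, l2, l3⟩ := hg.val _ r'.2 c.2 h2
      have := hg.mono ((r : ℕ), (c : ℕ)) ((r' : ℕ), (c : ℕ)) (Prod.lt_iff.2 (Or.inl ⟨hr', le_rfl⟩))
        h1 h2 r.2 c.2 r'.2 c.2
      rw [k1, l1] at this
      have : k < l := by exact_mod_cast this
      simp [promotedEntry, h1, h2, k1, l1]; omega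

/-! ### Webs -/

/-- A directed graph drawn above a boundary line (equivalently, in a disk), given up to isotopy by
its half-edges, the cyclic order of the half-edges around each vertex, the directed edges, and the
boundary vertices, of degree one, numbered from left to right. A vertex is an orbit of `ccw`. -/
structure BoundaryGraph (N : ℕ) where
  HalfEdge : Type
  /-- The next half-edge counterclockwise around the same vertex. -/
  ccw : Equiv.Perm HalfEdge
  /-- `edge d e`: there is a directed edge with tail half-edge `d` and head half-edge `e`. -/
  edge : HalfEdge → HalfEdge → Prop
  /-- The half-edge at the `i`-th boundary vertex. -/
  bdry : Fin N → HalfEdge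

namespace BoundaryGraph

variable {N : ℕ}

/-- `d` and `e` are the two halves of an edge. -/
def Opp (G : BoundaryGraph N) (d e : G.HalfEdge) : Prop := G.edge d e ∨ G.edge e d

/-- `d` is directed out of its vertex. -/
def IsOut (G : BoundaryGraph N) (d : G.HalfEdge) : Prop := ∃ e, G.edge d e

/-- `d` is directed into its vertex. -/
def IsIn (G : BoundaryGraph N) (d : G.HalfEdge) : Prop := ∃ e, G.edge e d

/-- The counterclockwise order in the graph on the sphere that arises when the boundary line and
everything below it is shrunk to one vertex: around that vertex the half-edges at the boundary
vertices follow each other from right to left. -/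
def Next (G : BoundaryGraph N) (d e : G.HalfEdge) : Prop :=
  (d ∉ Set.range G.bdry ∧ e = G.ccw d) ∨ ∃ i, d = G.bdry (finRotate N i) ∧ e = G.bdry i

/-- Consecutive half-edges along a face of that graph on the sphere. -/
def FaceNext (G : BoundaryGraph N) (d e : G.HalfEdge) : Prop := ∃ d', G.Opp d d' ∧ G.Next d' e

/-- Planarity, by Euler's formula `V + F = E + 2 C` for the graph on the sphere. -/
def IsPlanar (G : BoundaryGraph N) : Prop :=
  Nat.card (Quot G.Next) + Nat.card (Quot G.FaceNext) =
    Nat.card (Quot G.Opp) + 2 * Nat.card (Quot fun d e => G.Next d e ∨ G.Opp d e)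

/-- Webs for `sl₃`: finite planar directed graphs with boundary, whose boundary vertices have degree
one, whose internal vertices are trivalent, and all of whose vertices are sources or sinks. -/
structure IsWeb (G : BoundaryGraph N) : Prop where
  finite : Finite G.HalfEdge
  exists_unique_opp : ∀ d, ∃! e, G.Opp d e
  bdry_injective : Function.Injective G.bdry
  bdry_degree_one : ∀ i, G.ccw (G.bdry i) = G.bdry i
  internal_trivalent : ∀ d, d ∉ Set.range G.bdry → G.ccw d ≠ d ∧ G.ccw (G.ccw (G.ccw d)) = d
  not_out_and_in : ∀ d, ¬ (G.IsOut d ∧ G.IsIn d)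
  source_or_sink : ∀ d, G.IsOut (G.ccw d) ↔ G.IsOut d
  planar : G.IsPlanar

/-- Two graphs with boundary are the same web: there is an isomorphism that preserves directed edges,
the cyclic orders and the numbering of the boundary vertices. -/
def Equivalent (G H : BoundaryGraph N) : Prop :=
  ∃ φ : G.HalfEdge ≃ H.HalfEdge,
    (∀ d, φ (G.ccw d) = H.ccw (φ d)) ∧
    (∀ d e, G.edge d e ↔ H.edge (φ d) (φ e)) ∧
    ∀ i, φ (G.bdry i) = H.bdry i

/-- Rotation: the first boundary vertex becomes the last one, and every other one moves one
position to the left. -/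
def rotate (G : BoundaryGraph N) : BoundaryGraph N where
  HalfEdge := G.HalfEdge
  ccw := G.ccw
  edge := G.edge
  bdry := fun i => G.bdry (finRotate N i)

end BoundaryGraph

/-! ### The `m`-diagram of a tableau and its resolution -/

namespace StdTableau

variable {n : ℕ}

/-- The number `k` lies on row `r` of `T`, where row `0` is the bottom row. -/
def OnRow (T : StdTableau n) (r k : ℕ) : Prop := ∃ (hr : r < 3) (c : Fin n), T.entry ⟨r, hr⟩ c = k

/-- The arcs (left endpoint, right endpoint) that exist once the numbers `1, …, i` have been treated.
The number `i` is joined to the largest smaller number on the row below that is not already on an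
arc with a number from the row of `i`. -/
def arcsUpTo (T : StdTableau n) : ℕ → Set (ℕ × ℕ)
  | 0 => ∅
  | i + 1 => arcsUpTo T i ∪ {p | p.2 = i + 1 ∧ ∃ r, T.OnRow (r + 1) (i + 1) ∧
      IsGreatest {k | T.OnRow r k ∧ k < i + 1 ∧
        ∀ i', T.OnRow (r + 1) i' → (k, i') ∉ arcsUpTo T i} p.1}

/-- The arcs of the `m`-diagram of `T`. The arc `(i, j)` is the semicircle above the boundary line
with endpoints `i` and `j`. -/
def arcs (T : StdTableau n) : Set (ℕ × ℕ) := T.arcsUpTo (3 * n)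

/-- First arcs (those that start on the bottom row) are directed from left to right, and second arcs
from right to left, that is, towards the middle vertex of their `m`. -/
def Rightward (T : StdTableau n) (A : ℕ × ℕ) : Prop := T.OnRow 0 A.1

/-- A boundary vertex that lies on two arcs, which is to be replaced by a `Y`. -/
def IsFork (T : StdTableau n) (a : ℕ) : Prop := (∃ i, (i, a) ∈ T.arcs) ∧ ∃ k, (a, k) ∈ T.arcs

/-- A crossing of two arcs, the first of which starts further left. -/
structure Crossing (T : StdTableau n) where
  left : ℕ × ℕ
  right : ℕ × ℕ
  left_mem : left ∈ T.arcs
  right_mem : right ∈ T.arcs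
  h₁ : left.1 < right.1
  h₂ : right.1 < left.2
  h₃ : left.2 < right.2

/-- The abscissa of the intersection point of the semicircles on the diameters `[a, b]`, `[c, d]`,
that is, the solution `x` of `(x - a) * (x - b) = (x - c) * (x - d)`. -/
def Crossing.abscissa {T : StdTableau n} (x : T.Crossing) : ℚ :=
  ((x.right.1 : ℚ) * x.right.2 - (x.left.1 : ℚ) * x.left.2) /
    (((x.right.1 : ℚ) + x.right.2) - ((x.left.1 : ℚ) + x.left.2))

/-- Four half-edges meet at a crossing. Counterclockwise they are: corner `0` (upper right) on the arc
`right`, corner `1` (upper left) on the arc `left`, corner `2` (lower left) on the arc `right`,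
corner `3` (lower right) on the arc `left`. -/
def Crossing.arcAt {T : StdTableau n} (x : T.Crossing) (e : Fin 4) : ℕ × ℕ :=
  if e = 0 ∨ e = 2 then x.right else x.left

open Classical in
/-- The first, counterclockwise, of the two adjacent corners at which the directed arcs come in.
An arc that is directed to the right comes in at its corner on the left (`1` or `2`), the others
come in on the right (`0` or `3`). -/
noncomputable def Crossing.firstIn {T : StdTableau n} (x : T.Crossing) : Fin 4 :=
  if T.Rightward x.left then (if T.Rightward x.right then 1 else 0)
  else (if T.Rightward x.right then 2 else 3)

/-- The internal vertices of the resolved `m`-diagram: the centre of the `Y` at each boundary vertex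
on two arcs, and the two vertices that replace each crossing, namely a sink, which takes the two
incoming half-edges, and a source, which takes the two outgoing ones. -/
inductive InternalVertex (T : StdTableau n) : Type
  | fork (a : ℕ) (ha : T.IsFork a) : InternalVertex T
  | sink (x : T.Crossing) : InternalVertex T
  | source (x : T.Crossing) : InternalVertex T

/-- The half-edges of the resolved `m`-diagram: one at each boundary vertex (`Sum.inl i` belongs to
the number `i + 1`), and at each internal vertex three, numbered counterclockwise:
* at a fork: `0` on the arc to the right, `1` on the arc to the left, `2` on the stem of the `Y`;
* at the sink of a crossing: `0`, `1` incoming at the corners `firstIn` and `firstIn + 1`, and `2` on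
  the new edge from source to sink;
* at the source of a crossing: `0`, `1` outgoing at the corners `firstIn + 2` and `firstIn + 3`, and
  `2` on the new edge. -/
abbrev WebHalfEdge (T : StdTableau n) : Type := Fin (3 * n) ⊕ (T.InternalVertex × Fin 3)

/-- `T.OutOn A d t`: the half-edge `d` lies on the arc `A`, at the point with abscissa `t`, and is
directed out of its vertex. -/
inductive OutOn (T : StdTableau n) (A : ℕ × ℕ) : T.WebHalfEdge → ℚ → Prop
  | boundary (i : Fin (3 * n)) (hi : (i : ℕ) + 1 = A.1 ∨ (i : ℕ) + 1 = A.2)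
      (hf : ¬ T.IsFork (i + 1)) : OutOn T A (Sum.inl i) ((i : ℚ) + 1)
  | crossing₀ (x : T.Crossing) (hx : x.arcAt (x.firstIn + 2) = A) :
      OutOn T A (Sum.inr (.source x, 0)) x.abscissa
  | crossing₁ (x : T.Crossing) (hx : x.arcAt (x.firstIn + 3) = A) :
      OutOn T A (Sum.inr (.source x, 1)) x.abscissa

/-- `T.InOn A d t`: the half-edge `d` lies on the arc `A`, at the point with abscissa `t`, and is
directed into its vertex. -/
inductive InOn (T : StdTableau n) (A : ℕ × ℕ) : T.WebHalfEdge → ℚ → Prop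
  | crossing₀ (x : T.Crossing) (hx : x.arcAt x.firstIn = A) :
      InOn T A (Sum.inr (.sink x, 0)) x.abscissa
  | crossing₁ (x : T.Crossing) (hx : x.arcAt (x.firstIn + 1) = A) :
      InOn T A (Sum.inr (.sink x, 1)) x.abscissa
  | forkRight (a : ℕ) (ha : T.IsFork a) (h : a = A.1) : InOn T A (Sum.inr (.fork a ha, 0)) (a : ℚ)
  | forkLeft (a : ℕ) (ha : T.IsFork a) (h : a = A.2) : InOn T A (Sum.inr (.fork a ha, 1)) (a : ℚ)

/-- The directed edges of the resolved `m`-diagram: the stems of the `Y`s, the new edges at the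
crossings, and the pieces into which the crossings divide the arcs. -/
inductive WebEdge (T : StdTableau n) : T.WebHalfEdge → T.WebHalfEdge → Prop
  | stem (i : Fin (3 * n)) (hi : T.IsFork (i + 1)) :
      WebEdge T (Sum.inl i) (Sum.inr (.fork (i + 1) hi, 2))
  | new (x : T.Crossing) : WebEdge T (Sum.inr (.source x, 2)) (Sum.inr (.sink x, 2))
  | rightward (A : ℕ × ℕ) (hA : A ∈ T.arcs) (hr : T.Rightward A) (d e : T.WebHalfEdge) (s t : ℚ)
      (hd : T.OutOn A d s) (he : T.InOn A e t) (hst : s < t)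
      (hcons : ∀ e' t', T.InOn A e' t' → s < t' → t ≤ t') : WebEdge T d e
  | leftward (A : ℕ × ℕ) (hA : A ∈ T.arcs) (hr : ¬ T.Rightward A) (d e : T.WebHalfEdge) (s t : ℚ)
      (hd : T.OutOn A d s) (he : T.InOn A e t) (hst : t < s)
      (hcons : ∀ e' t', T.InOn A e' t' → t' < s → t' ≤ t) : WebEdge T d e

/-- The resolved `m`-diagram of `T`. -/
def web (T : StdTableau n) : BoundaryGraph (3 * n) where
  HalfEdge := T.WebHalfEdge
  ccw := Equiv.sumCongr (Equiv.refl _) (Equiv.prodCongr (Equiv.refl _) (finRotate 3))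
  edge := T.WebEdge
  bdry := Sum.inl

end StdTableau

/-! ### Height functions of lattice words -/

/-! Everything is read off from the ballot word whose letter at `k` is the row of `k`. With `H`
counting letters `0` minus letters `1`, and `K` letters `1` minus letters `2`, the greedy rule for
the arcs produces the noncrossing matchings of up-steps with down-steps of `H` (first arcs) and of
`K` (second arcs). A crossing is determined by its two inner endpoints `u < v`, and a fork is the
degenerate case `u = v`. A point on an arc is recorded by the level of the arc and by a position,
the inner endpoint of the other arc. Arcs of one level are disjoint, so the arc itself need not be
named. Along a semicircle these positions come in the same order as the abscissas, and
`Model.web_equivalent` identifies `T.web` with the diagram `LatticeWord.graph` of the word.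

Web axioms. Along the strands of one level, outgoing and incoming points alternate
(`Strands.next_iff`), so every half-edge has exactly one partner. Planarity is Euler's formula for a
connected graph, and the count that needs an idea is that of the faces: it is the dimension of the
space of `ZMod 2`-valued functions that are constant on faces. Such a function is determined by one
value, its jumps at the outer ends of the arcs and its sums over the four corners of each crossing.
Conversely, the constant `1`, the indicators of the regions under single arcs, and the products of
two such indicators at each crossing are independent (`card_faces`).

Promotion. The empty box moves up twice, at the entries `p` and `q`. Here `p` is the first return of
`H` to `0` and `q` the first zero of `K` after `p`. Promotion deletes the letter at `1`, lowers the
letters at `p` and `q` by one and appends a `2` (`exists_promotes`). If positions are not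
renumbered, the old and new heights differ by constants on each of the blocks into which `1`, `p`,
`q` divide the word, so crossings inside a block persist and pieces of strands there only change
level. What disappears is the first arc from `1` to `p` and the part between `p` and `q` of the
second arc that ends at `q`. What appears is a first strand of level one from `p` to `q` and a
second strand of level one from `N + 1` back to `q`.

After resolution these changes are only a change of names. Along a disappearing strand the pieces
between consecutive crossings become the source-to-sink edges of the new crossings, while the old
source-to-sink edges become the pieces of an appearing strand. At the sink where the two
disappearing strands meet, the three kinds of edges are permuted cyclically. Thus sinks and sources
correspond (`SnkRel`, `SrcRel`) with a permutation of the edge colours at each vertex. This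
correspondence respects the cyclic orders (`HERel.ccw`) and the edges (`edge_map`), and it shifts
the boundary by one. -/

/-- A function with steps `-1`, `0`, `1`. -/
def SmallSteps (f : ℕ → ℤ) : Prop := ∀ k, f (k + 1) ≤ f k + 1 ∧ f k ≤ f (k + 1) + 1

/-- The positions `a < b` are joined in the noncrossing matching of the up-steps of `f` with the
down-steps of `f`. -/
def IsArc (f : ℕ → ℤ) (a b : ℕ) : Prop :=
  1 ≤ a ∧ f a = f (a - 1) + 1 ∧ a < b ∧ f b + 1 = f a ∧ ∀ j, a ≤ j → j < b → f a ≤ f j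

namespace SmallSteps

variable {f : ℕ → ℤ} {a b : ℕ} {h : ℤ}

/-- Discrete intermediate value theorem: as steps have size at most one, the first position below
`h` is reached from height exactly `h`. -/
theorem exists_drop (hf : SmallSteps f) (hab : a ≤ b) (ha : h ≤ f a) (hb : f b < h) :
    ∃ k, a ≤ k ∧ k < b ∧ f k = h ∧ f (k + 1) + 1 = h ∧ ∀ j, a ≤ j → j ≤ k → h ≤ f j := by
  classical
  have hw : ∃ n, a ≤ n ∧ f n < h := ⟨b, hab, hb⟩
  have s1 := Nat.find_spec hw
  have s2 : ∀ m < Nat.find hw, ¬ (a ≤ m ∧ f m < h) := fun m hm => Nat.find_min hw hm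
  have s3 := Nat.find_min' hw ⟨hab, hb⟩
  have hne : Nat.find hw ≠ a := by intro he; rw [he] at s1; omega
  obtain ⟨m, hm⟩ : ∃ m, Nat.find hw = m + 1 := ⟨Nat.find hw - 1, by omega⟩
  rw [hm] at s1 s2 s3
  have := hf m
  have h4 := s2 m (by omega)
  refine ⟨m, by omega, by omega, by omega, by omega, fun j h5 h6 => ?_⟩
  have := s2 j (by omega)
  omega

/-- The mirror image: the last rise to `h` before `b`, after which the height never falls below `h`
again. -/
theorem exists_rise (hf : SmallSteps f) (hab : a ≤ b) (ha : f a < h) (hb : h ≤ f b) :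
    ∃ k, a ≤ k ∧ k < b ∧ f k + 1 = h ∧ f (k + 1) = h ∧ ∀ j, k < j → j ≤ b → h ≤ f j := by
  induction b, hab using Nat.le_induction with
  | base => omega
  | succ b hab ih =>
    have := hf b
    by_cases hb' : f b < h
    · exact ⟨b, by omega, by omega, by omega, by omega, fun j h1 h2 => by
        obtain rfl : j = b + 1 := by omega
        exact hb⟩
    · obtain ⟨k, h1, h2, h3, h4, h5⟩ := ih (by omega)
      refine ⟨k, h1, by omega, h3, h4, fun j h6 h7 => ?_⟩
      rcases Nat.lt_or_ge b j with h8 | h8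
      · obtain rfl : j = b + 1 := by omega
        exact hb
      · exact h5 j h6 h8

end SmallSteps

namespace IsArc

variable {f : ℕ → ℤ} {a b c d : ℕ}

theorem lt (h : IsArc f a b) : a < b := h.2.2.1

theorem prev (h : IsArc f a b) : f (a - 1) + 1 = f a := h.2.1.symm

/-- The step at `c` starts from height at least `f a`, so its level exceeds `f a`. At `b` the height
is below `f a`, hence the arc from `c` must have closed earlier. -/
theorem not_cross (h1 : IsArc f a b) (h2 : IsArc f c d) (hac : a < c) (hcb : c < b) : d < b := by
  by_contra hbd
  obtain ⟨-, -, -, h5, h6⟩ := h1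
  obtain ⟨c1, c2, -, c5, c6⟩ := h2
  have := h6 (c - 1) (by omega) (by omega)
  rcases Nat.lt_or_ge b d with h | h
  · have := c6 b hcb.le h
    omega
  · obtain rfl : b = d := by omega
    omega

theorem right_unique (h1 : IsArc f a b) (h2 : IsArc f a c) : b = c := by
  obtain ⟨-, -, l1, h5, h6⟩ := h1
  obtain ⟨-, -, l2, c5, c6⟩ := h2
  rcases lt_trichotomy b c with h | h | h
  · have := c6 b l1.le h; omega
  · exact h
  · have := h6 c l2.le h; omega

theorem left_unique (h1 : IsArc f a b) (h2 : IsArc f c b) : a = c := by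
  obtain ⟨q1, q2, l1, h5, h6⟩ := h1
  obtain ⟨r1, r2, l2, c5, c6⟩ := h2
  rcases lt_trichotomy a c with h | h | h
  · have := h6 (c - 1) (by omega) (by omega); omega
  · exact h
  · have := c6 (a - 1) (by omega) (by omega); omega

end IsArc

/-- A ballot word in the letters `0`, `1`, `2` written on the positions `s + 1, …, s + N`, with its
height functions: `H` counts the letters `0` minus the letters `1`, and `K` counts the letters `1`
minus the letters `2`. -/
structure LatticeWord (s N : ℕ) where
  letter : ℕ → ℕ
  H : ℕ → ℤ
  K : ℕ → ℤ
  letter_le : ∀ k, letter k ≤ 2 ↔ s < k ∧ k ≤ s + N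
  H_start : H s = 0
  K_start : K s = 0
  H_end : H (s + N) = 0
  K_end : K (s + N) = 0
  H_nonneg : ∀ k, 0 ≤ H k
  K_nonneg : ∀ k, 0 ≤ K k
  bot : ∀ k, letter (k + 1) = 0 → H (k + 1) = H k + 1 ∧ K (k + 1) = K k
  mid : ∀ k, letter (k + 1) = 1 → H (k + 1) + 1 = H k ∧ K (k + 1) = K k + 1
  top : ∀ k, letter (k + 1) = 2 → H (k + 1) = H k ∧ K (k + 1) + 1 = K k
  out : ∀ k, 2 < letter (k + 1) → H (k + 1) = H k ∧ K (k + 1) = K k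

namespace LatticeWord

variable {s N : ℕ} (D : LatticeWord s N)

theorem step_cases (k : ℕ) :
    (D.letter (k + 1) = 0 ∧ H D (k + 1) = H D k + 1 ∧ K D (k + 1) = K D k) ∨
    (D.letter (k + 1) = 1 ∧ H D (k + 1) + 1 = H D k ∧ K D (k + 1) = K D k + 1) ∨
    (D.letter (k + 1) = 2 ∧ H D (k + 1) = H D k ∧ K D (k + 1) + 1 = K D k) ∨
    (2 < D.letter (k + 1) ∧ H D (k + 1) = H D k ∧ K D (k + 1) = K D k) := by
  have h0 := D.bot k
  have h1 := D.mid k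
  have h2 := D.top k
  have h3 := D.out k
  by_cases a0 : D.letter (k + 1) = 0
  · exact Or.inl ⟨a0, h0 a0⟩
  by_cases a1 : D.letter (k + 1) = 1
  · exact Or.inr (Or.inl ⟨a1, h1 a1⟩)
  by_cases a2 : D.letter (k + 1) = 2
  · exact Or.inr (Or.inr (Or.inl ⟨a2, h2 a2⟩))
  · have a3 : 2 < D.letter (k + 1) := by omega
    exact Or.inr (Or.inr (Or.inr ⟨a3, h3 a3⟩))

theorem smallSteps_H : SmallSteps D.H := fun k => by
  have := D.step_cases k
  omega

theorem smallSteps_K : SmallSteps D.K := fun k => by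
  have := D.step_cases k
  omega

theorem pos_of_letter {k : ℕ} (h : D.letter k ≤ 2) : ∃ j, k = j + 1 := by
  have := (D.letter_le k).1 h
  exact ⟨k - 1, by omega⟩

/-- The step before a position with a given letter. -/
theorem letter_zero {k : ℕ} (h : D.letter k = 0) :
    1 ≤ k ∧ D.H k = D.H (k - 1) + 1 ∧ D.K k = D.K (k - 1) := by
  obtain ⟨j, rfl⟩ := D.pos_of_letter (k := k) (by omega)
  exact ⟨by omega, D.bot j h⟩

theorem letter_one {k : ℕ} (h : D.letter k = 1) :
    1 ≤ k ∧ D.H k + 1 = D.H (k - 1) ∧ D.K k = D.K (k - 1) + 1 := by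
  obtain ⟨j, rfl⟩ := D.pos_of_letter (k := k) (by omega)
  exact ⟨by omega, D.mid j h⟩

theorem letter_two {k : ℕ} (h : D.letter k = 2) :
    1 ≤ k ∧ D.H k = D.H (k - 1) ∧ D.K k + 1 = D.K (k - 1) := by
  obtain ⟨j, rfl⟩ := D.pos_of_letter (k := k) (by omega)
  exact ⟨by omega, D.top j h⟩

theorem eq_zero_of_le {k : ℕ} (hk : k ≤ s) : D.H k = 0 ∧ D.K k = 0 := by
  induction hk using Nat.decreasingInduction with
  | self => exact ⟨D.H_start, D.K_start⟩
  | of_succ k hk ih =>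
    have h1 := D.letter_le (k + 1)
    have h2 := D.step_cases k
    have h3 : 2 < D.letter (k + 1) := by
      by_contra h
      have := h1.1 (by omega)
      omega
    omega

theorem eq_zero_of_ge {k : ℕ} (hk : s + N ≤ k) : D.H k = 0 ∧ D.K k = 0 := by
  induction k, hk using Nat.le_induction with
  | base => exact ⟨D.H_end, D.K_end⟩
  | succ k hk ih =>
    have h1 := D.letter_le (k + 1)
    have h2 := D.step_cases k
    have h3 : 2 < D.letter (k + 1) := by
      by_contra h
      have := h1.1 (by omega)
      omega
    omega

/-- A crossing, given by its two inner endpoints, or a fork (when these are equal). -/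
def Cr (u v : ℕ) : Prop :=
  u ≤ v ∧ ((D.letter u = 1 ∧ D.letter v = 1 ∧ (∀ j, u ≤ j → j ≤ v → D.K u ≤ D.K j) ∧
      ∀ j, u ≤ j → j < v → D.H v < D.H j) ∨
    (D.letter u = 0 ∧ D.letter v = 2 ∧ (∀ j, u ≤ j → j ≤ v → D.H u ≤ D.H j) ∧
      ∀ j, u ≤ j → j < v → D.K v < D.K j))

/-- The sinks of the resolved diagram. -/
abbrev Snk : Type := {p : ℕ × ℕ // D.Cr p.1 p.2}

/-- The internal sources of the resolved diagram. -/
abbrev Src : Type := {p : ℕ × ℕ // D.Cr p.1 p.2 ∧ p.1 < p.2}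

theorem cr_self {m : ℕ} (h : D.letter m = 1) : D.Cr m m :=
  ⟨le_rfl, Or.inl ⟨h, h, fun j h1 h2 => by rw [le_antisymm h1 h2], fun j h1 h2 => by omega⟩⟩

/-- Level of a crossing among the first arcs. -/
def lev1 (p : ℕ × ℕ) : ℤ := if D.letter p.1 = 1 then D.H p.2 + 1 else D.H p.1
/-- Position of a crossing on its first arc. -/
def key1 (p : ℕ × ℕ) : ℕ := if D.letter p.1 = 1 then p.1 else p.2
/-- Level of a crossing among the second arcs. -/
def lev2 (p : ℕ × ℕ) : ℤ := if D.letter p.1 = 1 then D.K p.1 else D.K p.2 + 1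
/-- Position of a crossing on its second arc. -/
def key2 (p : ℕ × ℕ) : ℕ := if D.letter p.1 = 1 then p.2 else p.1

/-- Half-edges: boundary vertices, and three at each sink and source, on the first arc, on the
second arc, and on the new edge or stem, respectively. -/
abbrev HE : Type := Fin N ⊕ ((D.Snk ⊕ D.Src) × Fin 3)

variable {D}

/-- Half-edges directed out of their vertex along a first arc. -/
inductive Out1 : D.HE → ℤ → ℕ → Prop
  | bdry (i : Fin N) (h : D.letter (s + i + 1) = 0) : Out1 (Sum.inl i) (D.H (s + i + 1)) (s + i + 1)
  | src (p : D.Src) : Out1 (Sum.inr (Sum.inr p, 0)) (D.lev1 p.1) (D.key1 p.1)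

inductive In1 : D.HE → ℤ → ℕ → Prop
  | snk (p : D.Snk) : In1 (Sum.inr (Sum.inl p, 0)) (D.lev1 p.1) (D.key1 p.1)

/-- A letter `2` lowers `K`, so an arc that ends there has level one more than the height after the
step. -/
inductive Out2 : D.HE → ℤ → ℕ → Prop
  | bdry (i : Fin N) (h : D.letter (s + i + 1) = 2) :
      Out2 (Sum.inl i) (D.K (s + i + 1) + 1) (s + i + 1)
  | src (p : D.Src) : Out2 (Sum.inr (Sum.inr p, 1)) (D.lev2 p.1) (D.key2 p.1)

inductive In2 : D.HE → ℤ → ℕ → Prop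
  | snk (p : D.Snk) : In2 (Sum.inr (Sum.inl p, 1)) (D.lev2 p.1) (D.key2 p.1)

/-- Only levels and positions are compared, never arcs. This is enough because a first arc ends on
the right, and a second arc on the left, in a fork, which is a sink of its level: the nearest sink
of that level in the direction of travel lies on the same arc. -/
inductive Edge : D.HE → D.HE → Prop
  | stem (i : Fin N) (h : D.letter (s + i + 1) = 1) :
      Edge (Sum.inl i) (Sum.inr (Sum.inl ⟨(s + i + 1, s + i + 1), D.cr_self h⟩, 2))
  | new (p : D.Src) : Edge (Sum.inr (Sum.inr p, 2)) (Sum.inr (Sum.inl ⟨p.1, p.2.1⟩, 2))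
  | first (d e : D.HE) (h : ℤ) (k k' : ℕ) (hd : Out1 d h k) (he : In1 e h k') (hk : k < k')
      (hc : ∀ (e' : D.HE) (j : ℕ), In1 e' h j → k < j → k' ≤ j) : Edge d e
  | second (d e : D.HE) (h : ℤ) (k k' : ℕ) (hd : Out2 d h k) (he : In2 e h k') (hk : k' < k)
      (hc : ∀ (e' : D.HE) (j : ℕ), In2 e' h j → j < k → j ≤ k') : Edge d e

variable (D)

/-- The cyclic order at a vertex. -/
noncomputable def ccwAt (x : D.Snk ⊕ D.Src) : Equiv.Perm (Fin 3) :=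
  if D.letter (Sum.elim (fun p => p.1.1) (fun p => p.1.1) x) = 1 then (Equiv.addRight 2)
  else (Equiv.addRight 1)

/-- The resolved diagram of a ballot word. -/
noncomputable def graph : BoundaryGraph N where
  HalfEdge := D.HE
  ccw := Equiv.sumCongr (Equiv.refl _) (Equiv.prodShear (Equiv.refl _) D.ccwAt)
  edge := Edge
  bdry := Sum.inl

end LatticeWord

/-! ### Consecutive points on the strands of one level -/

/-- The points at which a strand of level `h` of `f` starts or continues (`O`), and at which it
continues or ends (`I`). -/
structure Strands (f : ℕ → ℤ) (h : ℤ) (I O : ℕ → Prop) (a b : ℕ) : Prop where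
  small : SmallSteps f
  lt_left : ∀ k ≤ a, f k < h
  lt_right : ∀ k, b ≤ k → f k < h
  of_in : ∀ k, I k → 1 ≤ k ∧ h ≤ f (k - 1) ∧ (O k ∨ f k < h)
  of_out : ∀ k, O k → h ≤ f k ∧ (I k ∨ 1 ≤ k ∧ f (k - 1) < h)
  drop : ∀ k, h ≤ f k → f (k + 1) < h → I (k + 1)
  rise : ∀ k, f k < h → h ≤ f (k + 1) → O (k + 1)

namespace Strands

variable {f : ℕ → ℤ} {h : ℤ} {I O : ℕ → Prop} {a b : ℕ} (S : Strands f h I O a b)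
include S

theorem in_of_drop {k j : ℕ} (hk : h ≤ f k) (hj : f j < h) (hkj : k ≤ j) :
    ∃ i, I i ∧ k < i ∧ i ≤ j := by
  obtain ⟨i, h1, h2, h3, h4, -⟩ := S.small.exists_drop hkj hk hj
  exact ⟨i + 1, S.drop i (by omega) (by omega), by omega, by omega⟩

theorem out_of_rise {k j : ℕ} (hk : f k < h) (hj : h ≤ f j) (hkj : k ≤ j) :
    ∃ i, O i ∧ k < i ∧ i ≤ j := by
  obtain ⟨i, h1, h2, h3, h4, -⟩ := S.small.exists_rise hkj hk hj
  exact ⟨i + 1, S.rise i (by omega) (by omega), by omega, by omega⟩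

theorem exists_next {k : ℕ} (hk : O k) :
    ∃ k', I k' ∧ k < k' ∧ ∀ j, I j → k < j → k' ≤ j := by
  classical
  have h1 := (S.of_out k hk).1
  have hkb : k < b := by
    by_contra hc
    have := S.lt_right k (by omega)
    omega
  have hex : ∃ i, I i ∧ k < i := by
    obtain ⟨i, i1, i2, -⟩ := S.in_of_drop h1 (S.lt_right b le_rfl) hkb.le
    exact ⟨i, i1, i2⟩
  exact ⟨Nat.find hex, (Nat.find_spec hex).1, (Nat.find_spec hex).2,
    fun j j1 j2 => Nat.find_min' hex ⟨j1, j2⟩⟩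

theorem exists_prev {k : ℕ} (hk : I k) :
    ∃ k', O k' ∧ k' < k ∧ ∀ j, O j → j < k → j ≤ k' := by
  classical
  obtain ⟨h1, h2, -⟩ := S.of_in k hk
  have hka : a < k - 1 := by
    by_contra hc
    have := S.lt_left (k - 1) (by omega)
    omega
  obtain ⟨i, i1, i2, i3⟩ := S.out_of_rise (S.lt_left a le_rfl) h2 hka.le
  have hP := Nat.findGreatest_spec (P := fun i => O i ∧ i < k) (m := i) (n := k) (by omega)
    ⟨i1, by omega⟩
  exact ⟨_, hP.1, hP.2, fun j j1 j2 => Nat.le_findGreatest j2.le ⟨j1, j2⟩⟩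

/-- Starts and ends alternate along a level. A point between `k` and `k'` that is only a start must
be preceded by a drop below `h`, hence by an end, and dually. A point at which a strand continues is
both. -/
theorem next_iff {k k' : ℕ} (hk : O k) (hk' : I k') :
    (∀ j, I j → k < j → k' ≤ j) ↔ ∀ j, O j → j < k' → j ≤ k := by
  obtain ⟨o1, o2⟩ := S.of_out k hk
  obtain ⟨i1, i2, i3⟩ := S.of_in k' hk'
  constructor
  · intro hmin j hj hjk
    by_contra hc
    obtain ⟨j1, j2⟩ := S.of_out j hj
    rcases j2 with j2 | ⟨j2, j3⟩
    · have := hmin j j2 (by omega)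
      omega
    · obtain ⟨i, h1, h2, h3⟩ := S.in_of_drop o1 j3 (by omega)
      have := hmin i h1 h2
      omega
  · intro hmax j hj hjk
    by_contra hc
    obtain ⟨j1, j2, j3⟩ := S.of_in j hj
    rcases j3 with j3 | j3
    · have := hmax j j3 (by omega)
      omega
    · obtain ⟨i, h1, h2, h3⟩ := S.out_of_rise j3 i2 (by omega)
      have := hmax i h1 (by omega)
      omega

end Strands

/-! ### The strands of a word, and its edges as a perfect matching of half-edges -/

namespace LatticeWord

variable {s N : ℕ} {D : LatticeWord s N}

theorem out1_iff {d : D.HE} {h : ℤ} {k : ℕ} : Out1 d h k ↔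
    (∃ i : Fin N, d = Sum.inl i ∧ D.letter (s + i + 1) = 0 ∧ h = D.H (s + i + 1) ∧ k = s + i + 1) ∨
    ∃ p : D.Src, d = Sum.inr (Sum.inr p, 0) ∧ h = D.lev1 p.1 ∧ k = D.key1 p.1 := by
  constructor
  · rintro (⟨i, hi⟩ | p)
    · exact Or.inl ⟨i, rfl, hi, rfl, rfl⟩
    · exact Or.inr ⟨p, rfl, rfl, rfl⟩
  · rintro (⟨i, rfl, hi, rfl, rfl⟩ | ⟨p, rfl, rfl, rfl⟩)
    · exact .bdry i hi
    · exact .src p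

theorem out2_iff {d : D.HE} {h : ℤ} {k : ℕ} : Out2 d h k ↔
    (∃ i : Fin N, d = Sum.inl i ∧ D.letter (s + i + 1) = 2 ∧ h = D.K (s + i + 1) + 1 ∧
      k = s + i + 1) ∨
    ∃ p : D.Src, d = Sum.inr (Sum.inr p, 1) ∧ h = D.lev2 p.1 ∧ k = D.key2 p.1 := by
  constructor
  · rintro (⟨i, hi⟩ | p)
    · exact Or.inl ⟨i, rfl, hi, rfl, rfl⟩
    · exact Or.inr ⟨p, rfl, rfl, rfl⟩
  · rintro (⟨i, rfl, hi, rfl, rfl⟩ | ⟨p, rfl, rfl, rfl⟩)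
    · exact .bdry i hi
    · exact .src p

theorem in1_iff {d : D.HE} {h : ℤ} {k : ℕ} : In1 d h k ↔
    ∃ p : D.Snk, d = Sum.inr (Sum.inl p, 0) ∧ h = D.lev1 p.1 ∧ k = D.key1 p.1 := by
  constructor
  · rintro ⟨p⟩
    exact ⟨p, rfl, rfl, rfl⟩
  · rintro ⟨p, rfl, rfl, rfl⟩
    exact .snk p

theorem in2_iff {d : D.HE} {h : ℤ} {k : ℕ} : In2 d h k ↔
    ∃ p : D.Snk, d = Sum.inr (Sum.inl p, 1) ∧ h = D.lev2 p.1 ∧ k = D.key2 p.1 := by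
  constructor
  · rintro ⟨p⟩
    exact ⟨p, rfl, rfl, rfl⟩
  · rintro ⟨p, rfl, rfl, rfl⟩
    exact .snk p

/-- The two types of crossings with their levels and positions. -/
theorem Cr.cases {u v : ℕ} (h : D.Cr u v) : u ≤ v ∧
    ((D.letter u = 1 ∧ D.letter v = 1 ∧ D.lev1 (u, v) = D.H v + 1 ∧ D.key1 (u, v) = u ∧
      D.lev2 (u, v) = D.K u ∧ D.key2 (u, v) = v ∧ (∀ j, u ≤ j → j ≤ v → D.K u ≤ D.K j) ∧
      ∀ j, u ≤ j → j < v → D.H v < D.H j) ∨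
    (D.letter u = 0 ∧ D.letter v = 2 ∧ D.lev1 (u, v) = D.H u ∧ D.key1 (u, v) = v ∧
      D.lev2 (u, v) = D.K v + 1 ∧ D.key2 (u, v) = u ∧ u < v ∧
      (∀ j, u ≤ j → j ≤ v → D.H u ≤ D.H j) ∧ ∀ j, u ≤ j → j < v → D.K v < D.K j)) := by
  obtain ⟨h0, ⟨h1, h2, h3, h4⟩ | ⟨h1, h2, h3, h4⟩⟩ := h
  · exact ⟨h0, Or.inl ⟨h1, h2, by simp [lev1, h1], by simp [key1, h1], by simp [lev2, h1],
      by simp [key2, h1], h3, h4⟩⟩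
  · refine ⟨h0, Or.inr ⟨h1, h2, by simp [lev1, h1], by simp [key1, h1], by simp [lev2, h1],
      by simp [key2, h1], ?_, h3, h4⟩⟩
    rcases h0.lt_or_eq with h | h
    · exact h
    · rw [h] at h1; omega

/-- The position is one inner endpoint, and its letter fixes the type of crossing. The level then
fixes the other inner endpoint, through the extremality conditions in `Cr`. -/
theorem Cr.eq_of_first {u v u' v' : ℕ} (h : D.Cr u v) (h' : D.Cr u' v')
    (hl : D.lev1 (u, v) = D.lev1 (u', v')) (hk : D.key1 (u, v) = D.key1 (u', v')) :
    u = u' ∧ v = v' := by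
  obtain ⟨h0, ⟨a1, a2, a3, a4, a5, a6, a7, a8⟩ | ⟨a1, a2, a3, a4, a5, a6, a7, a8, a9⟩⟩ := h.cases <;>
  obtain ⟨h0', ⟨b1, b2, b3, b4, b5, b6, b7, b8⟩ | ⟨b1, b2, b3, b4, b5, b6, b7, b8, b9⟩⟩ := h'.cases
  · have he : u = u' := by omega
    subst he
    refine ⟨rfl, ?_⟩
    rcases lt_trichotomy v v' with h | h | h
    · have := b8 v h0 h; omega
    · exact h
    · have := a8 v' h0' h; omega
  · have : u = v' := by omega
    subst this; omega
  · have : v = u' := by omega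
    subst this; omega
  · have he : v = v' := by omega
    subst he
    refine ⟨?_, rfl⟩
    obtain ⟨c1, c2, -⟩ := D.letter_zero a1
    obtain ⟨d1, d2, -⟩ := D.letter_zero b1
    rcases lt_trichotomy u u' with h | h | h
    · have := a8 (u' - 1) (by omega) (by omega); omega
    · exact h
    · have := b8 (u - 1) (by omega) (by omega); omega

theorem Cr.eq_of_second {u v u' v' : ℕ} (h : D.Cr u v) (h' : D.Cr u' v')
    (hl : D.lev2 (u, v) = D.lev2 (u', v')) (hk : D.key2 (u, v) = D.key2 (u', v')) :
    u = u' ∧ v = v' := by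
  obtain ⟨h0, ⟨a1, a2, a3, a4, a5, a6, a7, a8⟩ | ⟨a1, a2, a3, a4, a5, a6, a7, a8, a9⟩⟩ := h.cases <;>
  obtain ⟨h0', ⟨b1, b2, b3, b4, b5, b6, b7, b8⟩ | ⟨b1, b2, b3, b4, b5, b6, b7, b8, b9⟩⟩ := h'.cases
  · have he : v = v' := by omega
    subst he
    refine ⟨?_, rfl⟩
    obtain ⟨c1, -, c2⟩ := D.letter_one a1
    obtain ⟨d1, -, d2⟩ := D.letter_one b1
    rcases lt_trichotomy u u' with h | h | h
    · have := a7 (u' - 1) (by omega) (by omega); omega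
    · exact h
    · have := b7 (u - 1) (by omega) (by omega); omega
  · have : v = u' := by omega
    subst this; omega
  · have : u = v' := by omega
    subst this; omega
  · have he : u = u' := by omega
    subst he
    refine ⟨rfl, ?_⟩
    rcases lt_trichotomy v v' with h | h | h
    · have := b9 v h0 h; omega
    · exact h
    · have := a9 v' h0' h; omega

theorem in1_unique {e e' : D.HE} {h : ℤ} {k : ℕ} (he : In1 e h k) (he' : In1 e' h k) : e = e' := by
  obtain ⟨p, rfl, h1, h2⟩ := in1_iff.1 he
  obtain ⟨p', rfl, h1', h2'⟩ := in1_iff.1 he'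
  obtain ⟨h3, h4⟩ := p.2.eq_of_first p'.2 (h1.symm.trans h1') (h2.symm.trans h2')
  rw [Subtype.ext (Prod.ext h3 h4)]

theorem in2_unique {e e' : D.HE} {h : ℤ} {k : ℕ} (he : In2 e h k) (he' : In2 e' h k) : e = e' := by
  obtain ⟨p, rfl, h1, h2⟩ := in2_iff.1 he
  obtain ⟨p', rfl, h1', h2'⟩ := in2_iff.1 he'
  obtain ⟨h3, h4⟩ := p.2.eq_of_second p'.2 (h1.symm.trans h1') (h2.symm.trans h2')
  rw [Subtype.ext (Prod.ext h3 h4)]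

/-- A first strand of level `h` starts where `H` rises to `h`, at a letter `0`, and ends where `H`
drops below `h`, at a fork. At a crossing the sink and the source share level and position, so the
strand continues. -/
theorem strands1 (D : LatticeWord s N) {h : ℤ} (hh : 0 < h) : Strands D.H h
    (fun k => ∃ e : D.HE, In1 e h k) (fun k => ∃ d : D.HE, Out1 d h k) s (s + N) where
  small := D.smallSteps_H
  lt_left k hk := by have := D.eq_zero_of_le hk; omega
  lt_right k hk := by have := D.eq_zero_of_ge hk; omega
  of_in := by
    rintro k ⟨e, he⟩
    obtain ⟨⟨⟨u, v⟩, hp⟩, rfl, h1, h2⟩ := in1_iff.1 he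
    simp only at hp h1 h2
    obtain ⟨h0, ⟨a1, a2, a3, a4, a5, a6, a7, a8⟩ | ⟨a1, a2, a3, a4, a5, a6, a7, a8, a9⟩⟩ := hp.cases
    · obtain ⟨c1, c2, -⟩ := D.letter_one a1
      rw [a4] at h2; subst h2
      rcases h0.lt_or_eq with h0 | h0
      · have := a8 k le_rfl h0
        exact ⟨c1, by omega, Or.inl ⟨_, out1_iff.2 (Or.inr ⟨⟨(k, v), hp, h0⟩, rfl, h1, a4.symm⟩)⟩⟩
      · subst h0
        exact ⟨c1, by omega, Or.inr (by omega)⟩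
    · rw [a4] at h2; subst h2
      have := a8 (k - 1) (by omega) (by omega)
      exact ⟨by omega, by omega, Or.inl ⟨_, out1_iff.2 (Or.inr ⟨⟨(u, k), hp, a7⟩, rfl, h1, a4.symm⟩)⟩⟩
  of_out := by
    rintro k ⟨e, he⟩
    obtain ⟨i, rfl, hi, rfl, rfl⟩ | ⟨⟨⟨u, v⟩, hp, hlt⟩, rfl, h1, h2⟩ := out1_iff.1 he
    · have := D.letter_zero hi
      exact ⟨le_rfl, Or.inr ⟨by omega, by omega⟩⟩
    simp only at hp h1 h2 hlt
    have hin : ∃ e : D.HE, In1 e h k := ⟨_, in1_iff.2 ⟨⟨(u, v), hp⟩, rfl, h1, h2⟩⟩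
    refine ⟨?_, Or.inl hin⟩
    obtain ⟨h0, ⟨a1, a2, a3, a4, a5, a6, a7, a8⟩ | ⟨a1, a2, a3, a4, a5, a6, a7, a8, a9⟩⟩ := hp.cases
    · have := a8 u le_rfl hlt
      rw [h2, h1, a3, a4]; omega
    · have := a8 v h0 le_rfl
      rw [h2, h1, a3, a4]; omega
  drop k h1 h2 := by
    have h3 : D.letter (k + 1) = 1 := by have := D.step_cases k; omega
    have h4 : D.H (k + 1) + 1 = h := by have := D.mid k h3; omega
    exact ⟨_, in1_iff.2 ⟨⟨(k + 1, k + 1), D.cr_self h3⟩, rfl, by simp [lev1, h3, h4], by simp [key1]⟩⟩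
  rise k h1 h2 := by
    have h3 : D.letter (k + 1) = 0 := by have := D.step_cases k; omega
    have h4 : D.H (k + 1) = h := by have := D.bot k h3; omega
    have h5 := (D.letter_le (k + 1)).1 (by omega)
    have h6 : s + (k - s) + 1 = k + 1 := by omega
    exact ⟨_, out1_iff.2 (Or.inl ⟨⟨k - s, by omega⟩, rfl, by simp only [h6, h3],
      by simp only [h6, h4], h6.symm⟩)⟩

/-- Second arcs are directed from right to left, so outgoing and incoming half-edges exchange their
roles in `Strands`. -/
theorem strands2 (D : LatticeWord s N) {h : ℤ} (hh : 0 < h) : Strands D.K h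
    (fun k => ∃ d : D.HE, Out2 d h k) (fun k => ∃ e : D.HE, In2 e h k) s (s + N) where
  small := D.smallSteps_K
  lt_left k hk := by have := D.eq_zero_of_le hk; omega
  lt_right k hk := by have := D.eq_zero_of_ge hk; omega
  of_out := by
    rintro k ⟨e, he⟩
    obtain ⟨⟨⟨u, v⟩, hp⟩, rfl, h1, h2⟩ := in2_iff.1 he
    simp only at hp h1 h2
    obtain ⟨h0, ⟨a1, a2, a3, a4, a5, a6, a7, a8⟩ | ⟨a1, a2, a3, a4, a5, a6, a7, a8, a9⟩⟩ := hp.cases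
    · obtain ⟨c1, -, c2⟩ := D.letter_one a1
      rw [a6] at h2; subst h2
      have := a7 k h0 le_rfl
      refine ⟨by omega, ?_⟩
      rcases h0.lt_or_eq with h0 | h0
      · exact Or.inl ⟨_, out2_iff.2 (Or.inr ⟨⟨(u, k), hp, h0⟩, rfl, h1, a6.symm⟩)⟩
      · subst h0
        exact Or.inr (by omega)
    · rw [a6] at h2; subst h2
      have := a9 k le_rfl a7
      exact ⟨by omega, Or.inl ⟨_, out2_iff.2 (Or.inr ⟨⟨(k, v), hp, a7⟩, rfl, h1, a6.symm⟩)⟩⟩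
  of_in := by
    rintro k ⟨e, he⟩
    obtain ⟨i, rfl, hi, rfl, rfl⟩ | ⟨⟨⟨u, v⟩, hp, hlt⟩, rfl, h1, h2⟩ := out2_iff.1 he
    · have := D.letter_two hi
      exact ⟨by omega, by omega, Or.inr (by omega)⟩
    simp only at hp h1 h2 hlt
    have hin : ∃ e : D.HE, In2 e h k := ⟨_, in2_iff.2 ⟨⟨(u, v), hp⟩, rfl, h1, h2⟩⟩
    rw [← and_assoc]
    refine ⟨?_, Or.inl hin⟩
    obtain ⟨h0, ⟨a1, a2, a3, a4, a5, a6, a7, a8⟩ | ⟨a1, a2, a3, a4, a5, a6, a7, a8, a9⟩⟩ := hp.cases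
    · have := a7 (v - 1) (by omega) (by omega)
      rw [h2, h1, a5, a6]; omega
    · obtain ⟨c1, -, c2⟩ := D.letter_zero a1
      have := a9 u le_rfl hlt
      rw [h2, h1, a5, a6]; omega
  drop k h1 h2 := by
    have h3 : D.letter (k + 1) = 2 := by have := D.step_cases k; omega
    have h4 : D.K (k + 1) + 1 = h := by have := D.top k h3; omega
    have h5 := (D.letter_le (k + 1)).1 (by omega)
    have h6 : s + (k - s) + 1 = k + 1 := by omega
    exact ⟨_, out2_iff.2 (Or.inl ⟨⟨k - s, by omega⟩, rfl, by simp only [h6, h3],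
      by simp only [h6, h4], h6.symm⟩)⟩
  rise k h1 h2 := by
    have h3 : D.letter (k + 1) = 1 := by have := D.step_cases k; omega
    have h4 : D.K (k + 1) = h := by have := D.mid k h3; omega
    exact ⟨_, in2_iff.2 ⟨⟨(k + 1, k + 1), D.cr_self h3⟩, rfl, by simp [lev2, h3, h4], by simp [key2]⟩⟩

end LatticeWord

namespace LatticeWord

variable {s N : ℕ} {D : LatticeWord s N}

theorem In1.pos {e : D.HE} {h : ℤ} {k : ℕ} (he : In1 e h k) : 0 < h := by
  obtain ⟨⟨⟨u, v⟩, hp⟩, rfl, h1, h2⟩ := in1_iff.1 he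
  simp only at hp h1 h2
  obtain ⟨h0, ⟨a1, a2, a3, a4, -⟩ | ⟨a1, a2, a3, a4, -⟩⟩ := hp.cases
  · have := D.H_nonneg v; omega
  · have := D.letter_zero a1
    have := D.H_nonneg (u - 1); omega

theorem In2.pos {e : D.HE} {h : ℤ} {k : ℕ} (he : In2 e h k) : 0 < h := by
  obtain ⟨⟨⟨u, v⟩, hp⟩, rfl, h1, h2⟩ := in2_iff.1 he
  simp only at hp h1 h2
  obtain ⟨h0, ⟨a1, a2, a3, a4, a5, -⟩ | ⟨a1, a2, a3, a4, a5, -⟩⟩ := hp.cases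
  · have := D.letter_one a1
    have := D.K_nonneg (u - 1); omega
  · have := D.K_nonneg v; omega

theorem Out1.pos {d : D.HE} {h : ℤ} {k : ℕ} (he : Out1 d h k) : 0 < h := by
  obtain ⟨i, rfl, hi, rfl, rfl⟩ | ⟨⟨p, hp, hlt⟩, rfl, h1, h2⟩ := out1_iff.1 he
  · have := D.letter_zero hi
    have := D.H_nonneg (s + i + 1 - 1); omega
  · exact In1.pos (in1_iff.2 ⟨⟨p, hp⟩, rfl, h1, h2⟩)

theorem Out2.pos {d : D.HE} {h : ℤ} {k : ℕ} (he : Out2 d h k) : 0 < h := by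
  obtain ⟨i, rfl, hi, rfl, rfl⟩ | ⟨⟨p, hp, hlt⟩, rfl, h1, h2⟩ := out2_iff.1 he
  · have := D.K_nonneg (s + i + 1); omega
  · exact In2.pos (in2_iff.2 ⟨⟨p, hp⟩, rfl, h1, h2⟩)

/-- A boundary vertex and an internal source do not lie at the same point. -/
theorem out1_unique {d d' : D.HE} {h : ℤ} {k : ℕ} (hd : Out1 d h k) (hd' : Out1 d' h k) :
    d = d' := by
  have key : ∀ (i : Fin N) (p : D.Src), D.letter (s + i + 1) = 0 → D.key1 p.1 = s + i + 1 → False := by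
    rintro i ⟨⟨u, v⟩, hp, hlt⟩ hi hk
    simp only at hk hp
    obtain ⟨h0, ⟨a1, a2, a3, a4, -⟩ | ⟨a1, a2, a3, a4, -⟩⟩ := hp.cases
    · rw [← hk, a4] at hi; omega
    · rw [← hk, a4] at hi; omega
  obtain ⟨i, rfl, hi, h1, h2⟩ | ⟨p, rfl, h1, h2⟩ := out1_iff.1 hd <;>
    obtain ⟨i', rfl, hi', h1', h2'⟩ | ⟨p', rfl, h1', h2'⟩ := out1_iff.1 hd'
  · rw [show i = i' from Fin.ext (by omega)]
  · exact (key i p' hi (by omega)).elim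
  · exact (key i' p hi' (by omega)).elim
  · obtain ⟨h3, h4⟩ := p.2.1.eq_of_first p'.2.1 (h1.symm.trans h1') (h2.symm.trans h2')
    rw [Subtype.ext (Prod.ext h3 h4)]

theorem out2_unique {d d' : D.HE} {h : ℤ} {k : ℕ} (hd : Out2 d h k) (hd' : Out2 d' h k) :
    d = d' := by
  have key : ∀ (i : Fin N) (p : D.Src), D.letter (s + i + 1) = 2 → D.key2 p.1 = s + i + 1 → False := by
    rintro i ⟨⟨u, v⟩, hp, hlt⟩ hi hk
    simp only at hk hp
    obtain ⟨h0, ⟨a1, a2, a3, a4, a5, a6, -⟩ | ⟨a1, a2, a3, a4, a5, a6, -⟩⟩ := hp.cases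
    · rw [← hk, a6] at hi; omega
    · rw [← hk, a6] at hi; omega
  obtain ⟨i, rfl, hi, h1, h2⟩ | ⟨p, rfl, h1, h2⟩ := out2_iff.1 hd <;>
    obtain ⟨i', rfl, hi', h1', h2'⟩ | ⟨p', rfl, h1', h2'⟩ := out2_iff.1 hd'
  · rw [show i = i' from Fin.ext (by omega)]
  · exact (key i p' hi (by omega)).elim
  · exact (key i' p hi' (by omega)).elim
  · obtain ⟨h3, h4⟩ := p.2.1.eq_of_second p'.2.1 (h1.symm.trans h1') (h2.symm.trans h2')
    rw [Subtype.ext (Prod.ext h3 h4)]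

theorem Out1.inj {d : D.HE} {h h' : ℤ} {k k' : ℕ} (hd : Out1 d h k) (hd' : Out1 d h' k') :
    h = h' ∧ k = k' := by
  obtain ⟨i, rfl, hi, h1, h2⟩ | ⟨p, rfl, h1, h2⟩ := out1_iff.1 hd <;>
    obtain ⟨i', he, hi', h1', h2'⟩ | ⟨p', he, h1', h2'⟩ := out1_iff.1 hd' <;> cases he <;>
    exact ⟨h1.trans h1'.symm, h2.trans h2'.symm⟩

theorem Out2.inj {d : D.HE} {h h' : ℤ} {k k' : ℕ} (hd : Out2 d h k) (hd' : Out2 d h' k') :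
    h = h' ∧ k = k' := by
  obtain ⟨i, rfl, hi, h1, h2⟩ | ⟨p, rfl, h1, h2⟩ := out2_iff.1 hd <;>
    obtain ⟨i', he, hi', h1', h2'⟩ | ⟨p', he, h1', h2'⟩ := out2_iff.1 hd' <;> cases he <;>
    exact ⟨h1.trans h1'.symm, h2.trans h2'.symm⟩

theorem In1.inj {d : D.HE} {h h' : ℤ} {k k' : ℕ} (hd : In1 d h k) (hd' : In1 d h' k') :
    h = h' ∧ k = k' := by
  obtain ⟨p, rfl, h1, h2⟩ := in1_iff.1 hd
  obtain ⟨p', he, h1', h2'⟩ := in1_iff.1 hd'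
  cases he
  exact ⟨h1.trans h1'.symm, h2.trans h2'.symm⟩

theorem In2.inj {d : D.HE} {h h' : ℤ} {k k' : ℕ} (hd : In2 d h k) (hd' : In2 d h' k') :
    h = h' ∧ k = k' := by
  obtain ⟨p, rfl, h1, h2⟩ := in2_iff.1 hd
  obtain ⟨p', he, h1', h2'⟩ := in2_iff.1 hd'
  cases he
  exact ⟨h1.trans h1'.symm, h2.trans h2'.symm⟩

theorem Out1.exists_edge {d : D.HE} {h : ℤ} {k : ℕ} (hd : Out1 d h k) :
    ∃ e k', In1 e h k' ∧ k < k' ∧ Edge d e := by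
  obtain ⟨k', ⟨e, he⟩, h2, h3⟩ := (D.strands1 hd.pos).exists_next ⟨d, hd⟩
  exact ⟨e, k', he, h2, .first d e h k k' hd he h2 fun e' j h4 h5 => h3 j ⟨e', h4⟩ h5⟩

theorem In1.exists_edge {e : D.HE} {h : ℤ} {k' : ℕ} (he : In1 e h k') :
    ∃ d k, Out1 d h k ∧ k < k' ∧ Edge d e := by
  have S := D.strands1 he.pos
  obtain ⟨k, ⟨d, hd⟩, h2, h3⟩ := S.exists_prev ⟨e, he⟩
  -- `Edge` is defined by the next sink after `k`, whereas `exists_prev` provides the last source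
  -- before `k'`.
  rw [← S.next_iff ⟨d, hd⟩ ⟨e, he⟩] at h3
  exact ⟨d, k, hd, h2, .first d e h k k' hd he h2 fun e' j h4 h5 => h3 j ⟨e', h4⟩ h5⟩

theorem In2.exists_edge {e : D.HE} {h : ℤ} {k' : ℕ} (he : In2 e h k') :
    ∃ d k, Out2 d h k ∧ k' < k ∧ Edge d e := by
  have S := D.strands2 he.pos
  obtain ⟨k, ⟨d, hd⟩, h2, h3⟩ := S.exists_next ⟨e, he⟩
  rw [S.next_iff ⟨e, he⟩ ⟨d, hd⟩] at h3
  exact ⟨d, k, hd, h2, .second d e h k k' hd he h2 fun e' j h4 h5 => h3 j ⟨e', h4⟩ h5⟩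

theorem Out2.exists_edge {d : D.HE} {h : ℤ} {k : ℕ} (hd : Out2 d h k) :
    ∃ e k', In2 e h k' ∧ k' < k ∧ Edge d e := by
  obtain ⟨k', ⟨e, he⟩, h2, h3⟩ := (D.strands2 hd.pos).exists_prev ⟨d, hd⟩
  exact ⟨e, k', he, h2, .second d e h k k' hd he h2 fun e' j h4 h5 => h3 j ⟨e', h4⟩ h5⟩

theorem edge_iff {d e : D.HE} : Edge d e ↔
    (∃ (i : Fin N) (h : D.letter (s + i + 1) = 1), d = Sum.inl i ∧
      e = Sum.inr (Sum.inl ⟨(s + i + 1, s + i + 1), D.cr_self h⟩, 2)) ∨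
    (∃ p : D.Src, d = Sum.inr (Sum.inr p, 2) ∧ e = Sum.inr (Sum.inl ⟨p.1, p.2.1⟩, 2)) ∨
    (∃ h k k', Out1 d h k ∧ In1 e h k' ∧ k < k' ∧ ∀ (e' : D.HE) (j : ℕ), In1 e' h j → k < j → k' ≤ j) ∨
    (∃ h k k', Out2 d h k ∧ In2 e h k' ∧ k' < k ∧
      ∀ (e' : D.HE) (j : ℕ), In2 e' h j → j < k → j ≤ k') := by
  constructor
  · rintro (⟨i, h⟩ | p | ⟨_, _, h, k, k', h1, h2, h3, h4⟩ | ⟨_, _, h, k, k', h1, h2, h3, h4⟩)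
    · exact Or.inl ⟨i, h, rfl, rfl⟩
    · exact Or.inr (Or.inl ⟨p, rfl, rfl⟩)
    · exact Or.inr (Or.inr (Or.inl ⟨h, k, k', h1, h2, h3, h4⟩))
    · exact Or.inr (Or.inr (Or.inr ⟨h, k, k', h1, h2, h3, h4⟩))
  · rintro (⟨i, h, rfl, rfl⟩ | ⟨p, rfl, rfl⟩ | ⟨h, k, k', h1, h2, h3, h4⟩ | ⟨h, k, k', h1, h2, h3, h4⟩)
    · exact .stem i h
    · exact .new p
    · exact .first _ _ h k k' h1 h2 h3 h4
    · exact .second _ _ h k k' h1 h2 h3 h4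

/-- The half-edges directed out of their vertex. -/
def IsOutHE : D.HE → Prop
  | Sum.inl _ => True
  | Sum.inr (Sum.inl _, _) => False
  | Sum.inr (Sum.inr _, _) => True

/-- The colour of the edge at a half-edge. -/
def color : D.HE → Fin 3
  | Sum.inl i => if D.letter (s + i + 1) = 0 then 0 else if D.letter (s + i + 1) = 2 then 1 else 2
  | Sum.inr (_, c) => c

theorem Out1.isOut {d : D.HE} {h : ℤ} {k : ℕ} (hd : Out1 d h k) : IsOutHE d ∧ color d = 0 := by
  cases hd <;> simp_all [IsOutHE, color]

theorem Out2.isOut {d : D.HE} {h : ℤ} {k : ℕ} (hd : Out2 d h k) : IsOutHE d ∧ color d = 1 := by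
  cases hd <;> simp_all [IsOutHE, color]

theorem In1.isIn {d : D.HE} {h : ℤ} {k : ℕ} (hd : In1 d h k) : ¬ IsOutHE d ∧ color d = 0 := by
  cases hd; simp [IsOutHE, color]

theorem In2.isIn {d : D.HE} {h : ℤ} {k : ℕ} (hd : In2 d h k) : ¬ IsOutHE d ∧ color d = 1 := by
  cases hd; simp [IsOutHE, color]

theorem Edge.isOut_isIn {d e : D.HE} (hE : Edge d e) : IsOutHE d ∧ ¬ IsOutHE e ∧ color d = color e := by
  obtain ⟨i, h, rfl, rfl⟩ | ⟨p, rfl, rfl⟩ | ⟨h, k, k', h1, h2, h3, h4⟩ |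
    ⟨h, k, k', h1, h2, h3, h4⟩ := edge_iff.1 hE
  · simp [IsOutHE, color, h]
  · simp [IsOutHE, color]
  · exact ⟨h1.isOut.1, h2.isIn.1, h1.isOut.2.trans h2.isIn.2.symm⟩
  · exact ⟨h1.isOut.1, h2.isIn.1, h1.isOut.2.trans h2.isIn.2.symm⟩

theorem edge_cases {d e : D.HE} (hE : Edge d e) :
    (color d = 2 ∧ ((∃ (i : Fin N) (h : D.letter (s + i + 1) = 1), d = Sum.inl i ∧
      e = Sum.inr (Sum.inl ⟨(s + i + 1, s + i + 1), D.cr_self h⟩, 2)) ∨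
    (∃ p : D.Src, d = Sum.inr (Sum.inr p, 2) ∧ e = Sum.inr (Sum.inl ⟨p.1, p.2.1⟩, 2)))) ∨
    (color d = 0 ∧ ∃ h k k', Out1 d h k ∧ In1 e h k' ∧ k < k' ∧
      ∀ (e' : D.HE) (j : ℕ), In1 e' h j → k < j → k' ≤ j) ∨
    (color d = 1 ∧ ∃ h k k', Out2 d h k ∧ In2 e h k' ∧ k' < k ∧
      ∀ (e' : D.HE) (j : ℕ), In2 e' h j → j < k → j ≤ k') := by
  obtain ⟨i, h, rfl, rfl⟩ | ⟨p, rfl, rfl⟩ | h1 | h1 := edge_iff.1 hE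
  · exact Or.inl ⟨by simp [color, h], Or.inl ⟨i, h, rfl, rfl⟩⟩
  · exact Or.inl ⟨by simp [color], Or.inr ⟨p, rfl, rfl⟩⟩
  · obtain ⟨h, k, k', h2, h3⟩ := id h1
    exact Or.inr (Or.inl ⟨h2.isOut.2, h1⟩)
  · obtain ⟨h, k, k', h2, h3⟩ := id h1
    exact Or.inr (Or.inr ⟨h2.isOut.2, h1⟩)

/-- The colour of `d` decides which kind of edge starts there. On a strand, both ends are the
nearest sink, and a sink is determined by level and position. -/
theorem Edge.right_unique {d e e' : D.HE} (h : Edge d e) (h' : Edge d e') : e = e' := by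
  obtain ⟨c1, h1⟩ | ⟨c1, h, k, k', h1, h2, h3, h4⟩ | ⟨c1, h, k, k', h1, h2, h3, h4⟩ := edge_cases h <;>
  obtain ⟨c1', h1'⟩ | ⟨c1', h', l, l', h1', h2', h3', h4'⟩ | ⟨c1', h', l, l', h1', h2', h3', h4'⟩ :=
    edge_cases h' <;> (try exact absurd (c1.symm.trans c1') (by decide))
  · obtain ⟨i, h, rfl, rfl⟩ | ⟨p, rfl, rfl⟩ := h1 <;>
      obtain ⟨i', h', e1, rfl⟩ | ⟨p', e1, rfl⟩ := h1' <;> cases e1 <;> rfl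
  · obtain ⟨rfl, rfl⟩ := h1.inj h1'
    have := h4 _ _ h2' h3'
    have := h4' _ _ h2 h3
    obtain rfl : k' = l' := by omega
    exact in1_unique h2 h2'
  · obtain ⟨rfl, rfl⟩ := h1.inj h1'
    have := h4 _ _ h2' h3'
    have := h4' _ _ h2 h3
    obtain rfl : k' = l' := by omega
    exact in2_unique h2 h2'

theorem Edge.left_unique {d d' e : D.HE} (h : Edge d e) (h' : Edge d' e) : d = d' := by
  have hcol := h.isOut_isIn.2.2.trans h'.isOut_isIn.2.2.symm
  obtain ⟨c1, h1⟩ | ⟨c1, h, k, k', h1, h2, h3, h4⟩ | ⟨c1, h, k, k', h1, h2, h3, h4⟩ := edge_cases h <;>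
  obtain ⟨c1', h1'⟩ | ⟨c1', h', l, l', h1', h2', h3', h4'⟩ | ⟨c1', h', l, l', h1', h2', h3', h4'⟩ :=
    edge_cases h' <;> (try exact absurd (c1.symm.trans (hcol.trans c1')) (by decide))
  · obtain ⟨i, h, rfl, rfl⟩ | ⟨p, rfl, rfl⟩ := h1 <;>
      obtain ⟨i', h', rfl, e1⟩ | ⟨p', rfl, e1⟩ := h1'
    · simp only [Sum.inr.injEq, Prod.mk.injEq, Sum.inl.injEq, Subtype.mk.injEq, and_true] at e1
      rw [show i = i' from Fin.ext (by omega)]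
    · simp only [Sum.inr.injEq, Prod.mk.injEq, Sum.inl.injEq, Subtype.mk.injEq, and_true] at e1
      have := p'.2.2
      rw [← e1] at this
      simp at this
    · simp only [Sum.inr.injEq, Prod.mk.injEq, Sum.inl.injEq, Subtype.mk.injEq, and_true] at e1
      have := p.2.2
      rw [e1] at this
      simp at this
    · simp only [Sum.inr.injEq, Prod.mk.injEq, Sum.inl.injEq, Subtype.mk.injEq, and_true] at e1
      rw [Subtype.ext e1]
  · obtain ⟨rfl, rfl⟩ := h2.inj h2'
    have S := D.strands1 h1.pos
    have g1 := (S.next_iff ⟨_, h1⟩ ⟨_, h2⟩).1 (fun j ⟨e, he⟩ hj => h4 e j he hj)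
    have g2 := (S.next_iff ⟨_, h1'⟩ ⟨_, h2'⟩).1 (fun j ⟨e, he⟩ hj => h4' e j he hj)
    have := g1 _ ⟨_, h1'⟩ h3'
    have := g2 _ ⟨_, h1⟩ h3
    obtain rfl : k = l := by omega
    exact out1_unique h1 h1'
  · obtain ⟨rfl, rfl⟩ := h2.inj h2'
    have S := D.strands2 h1.pos
    have g1 := (S.next_iff ⟨_, h2⟩ ⟨_, h1⟩).2 (fun j ⟨e, he⟩ hj => h4 e j he hj)
    have g2 := (S.next_iff ⟨_, h2'⟩ ⟨_, h1'⟩).2 (fun j ⟨e, he⟩ hj => h4' e j he hj)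
    have := g1 _ ⟨_, h1'⟩ h3'
    have := g2 _ ⟨_, h1⟩ h3
    obtain rfl : k = l := by omega
    exact out2_unique h1 h1'

theorem exists_edge_out {d : D.HE} (hd : IsOutHE d) : ∃ e, Edge d e := by
  match d, hd with
  | Sum.inl i, _ =>
    have hi := (D.letter_le (s + i + 1)).2 (by omega)
    have h3 : D.letter (s + i + 1) = 0 ∨ D.letter (s + i + 1) = 1 ∨ D.letter (s + i + 1) = 2 := by omega
    rcases h3 with h | h | h
    · obtain ⟨e, -, -, -, he⟩ := (Out1.bdry i h).exists_edge
      exact ⟨e, he⟩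
    · exact ⟨_, .stem i h⟩
    · obtain ⟨e, -, -, -, he⟩ := (Out2.bdry i h).exists_edge
      exact ⟨e, he⟩
  | Sum.inr (Sum.inr p, 0), _ =>
    obtain ⟨e, -, -, -, he⟩ := (Out1.src p).exists_edge
    exact ⟨e, he⟩
  | Sum.inr (Sum.inr p, 1), _ =>
    obtain ⟨e, -, -, -, he⟩ := (Out2.src p).exists_edge
    exact ⟨e, he⟩
  | Sum.inr (Sum.inr p, 2), _ => exact ⟨_, .new p⟩

theorem exists_edge_in {e : D.HE} (he : ¬ IsOutHE e) : ∃ d, Edge d e := by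
  match e, he with
  | Sum.inl _, h => exact (h trivial).elim
  | Sum.inr (Sum.inr _, _), h => exact (h trivial).elim
  | Sum.inr (Sum.inl p, 0), _ =>
    obtain ⟨d, -, -, -, hd⟩ := (In1.snk p).exists_edge
    exact ⟨d, hd⟩
  | Sum.inr (Sum.inl p, 1), _ =>
    obtain ⟨d, -, -, -, hd⟩ := (In2.snk p).exists_edge
    exact ⟨d, hd⟩
  -- The third half-edge at a sink: at a proper crossing it is joined to the source of that
  -- crossing, at a fork to the boundary.
  | Sum.inr (Sum.inl ⟨(u, v), hp⟩, 2), _ =>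
    rcases hp.1.lt_or_eq with h | h
    · exact ⟨_, .new ⟨(u, v), hp, h⟩⟩
    · simp only at h
      subst h
      have h1 : D.letter u = 1 := by
        rcases hp.2 with h | h
        · exact h.1
        · have h1 := h.1
          have h2 := h.2.1
          simp only at h1 h2
          omega
      have h2 := (D.letter_le u).1 (by omega)
      obtain ⟨i, rfl⟩ : ∃ i : Fin N, u = s + i + 1 := ⟨⟨u - s - 1, by omega⟩, by simp only; omega⟩
      exact ⟨_, .stem i h1⟩

end LatticeWord

/-! ### Arcs of the two matchings and the crossings between them -/

theorem SmallSteps.exists_arc_of_drop {f : ℕ → ℤ} (hf : SmallSteps f) {s m : ℕ} (hs : f s ≤ f m)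
    (hsm : s ≤ m - 1) (hm : 1 ≤ m) (hd : f m + 1 = f (m - 1)) : ∃ a, IsArc f a m := by
  obtain ⟨k, h1, h2, h3, h4, h5⟩ := hf.exists_rise (h := f m + 1) hsm (by omega) (by omega)
  exact ⟨k + 1, by omega, by rw [Nat.add_sub_cancel]; omega, by omega, by omega,
    fun j j1 j2 => by have := h5 j (by omega) (by omega); omega⟩

theorem SmallSteps.exists_arc_of_rise {f : ℕ → ℤ} (hf : SmallSteps f) {a e : ℕ} (he : f e < f a)
    (hae : a ≤ e) (ha : 1 ≤ a) (hd : f a = f (a - 1) + 1) : ∃ b, IsArc f a b := by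
  obtain ⟨k, h1, h2, h3, h4, h5⟩ := hf.exists_drop (h := f a) hae (by omega) (by omega)
  exact ⟨k + 1, ha, hd, by omega, h4, fun j j1 j2 => h5 j j1 (by omega)⟩

/-- Arcs of one matching have distinct endpoints and do not cross. -/
theorem IsArc.compat {f : ℕ → ℤ} {a b c d : ℕ} (h1 : IsArc f a b) (h2 : IsArc f c d) :
    a < b ∧ c < d ∧ (a = c ↔ b = d) ∧ ¬ (a < c ∧ c < b ∧ b < d) ∧ ¬ (c < a ∧ a < d ∧ d < b) ∧
      b ≠ c ∧ a ≠ d := by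
  have key : ∀ {a b c d : ℕ}, IsArc f a b → IsArc f c d → b ≠ c := by
    rintro a b c d ⟨a1, a2, a3, a4, a5⟩ ⟨c1, c2, c3, c4, c5⟩ rfl
    have := a5 (b - 1) (by omega) (by omega)
    omega
  refine ⟨h1.lt, h2.lt, ⟨?_, ?_⟩, ?_, ?_, key h1 h2, (key h2 h1).symm⟩
  · rintro rfl; exact h1.right_unique h2
  · rintro rfl; exact h1.left_unique h2
  · rintro ⟨h3, h4, h5⟩
    have := h1.not_cross h2 h3 h4
    omega
  · rintro ⟨h3, h4, h5⟩
    have := h2.not_cross h1 h3 h4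
    omega

namespace LatticeWord

variable {s N : ℕ} {D : LatticeWord s N}

theorem letter_of_arc_H {a b : ℕ} (h : IsArc D.H a b) : D.letter a = 0 ∧ D.letter b = 1 := by
  obtain ⟨h1, h2, h3, h4, h5⟩ := h
  obtain ⟨a, rfl⟩ : ∃ a', a = a' + 1 := ⟨a - 1, by omega⟩
  obtain ⟨b, rfl⟩ : ∃ b', b = b' + 1 := ⟨b - 1, by omega⟩
  have := D.step_cases a
  have := D.step_cases b
  have := h5 b (by omega) (by omega)
  rw [Nat.add_sub_cancel] at h2
  omega

theorem letter_of_arc_K {a b : ℕ} (h : IsArc D.K a b) : D.letter a = 1 ∧ D.letter b = 2 := by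
  obtain ⟨h1, h2, h3, h4, h5⟩ := h
  obtain ⟨a, rfl⟩ : ∃ a', a = a' + 1 := ⟨a - 1, by omega⟩
  obtain ⟨b, rfl⟩ : ∃ b', b = b' + 1 := ⟨b - 1, by omega⟩
  have := D.step_cases a
  have := D.step_cases b
  have := h5 b (by omega) (by omega)
  rw [Nat.add_sub_cancel] at h2
  omega

theorem arc_compat {a b c d : ℕ} (h1 : IsArc D.H a b) (h2 : IsArc D.K c d) :
    a < b ∧ c < d ∧ a ≠ c ∧ a ≠ d ∧ b ≠ d := by
  have l1 := letter_of_arc_H h1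
  have l2 := letter_of_arc_K h2
  refine ⟨h1.lt, h2.lt, ?_, ?_, ?_⟩ <;> rintro rfl <;> omega

theorem arc_range {c d : ℕ} (h : IsArc D.H c d ∨ IsArc D.K c d) : s < c ∧ c < d ∧ d ≤ s + N := by
  have h3 : D.letter c ≤ 2 ∧ D.letter d ≤ 2 ∧ c < d := by
    rcases h with h | h
    · have := letter_of_arc_H h; have := h.lt; omega
    · have := letter_of_arc_K h; have := h.lt; omega
  have := (D.letter_le c).1 h3.1
  have := (D.letter_le d).1 h3.2.1
  omega

theorem exists_arc_H_to {m : ℕ} (h : D.letter m = 1) : ∃ a, IsArc D.H a m := by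
  have h1 := (D.letter_le m).1 (by omega)
  have h2 := D.letter_one h
  have h3 := D.H_nonneg m
  have h4 := D.H_start
  exact D.smallSteps_H.exists_arc_of_drop (s := s) (by omega) (by omega) h2.1 h2.2.1

theorem exists_arc_H_from {a : ℕ} (h : D.letter a = 0) : ∃ b, IsArc D.H a b := by
  have h1 := (D.letter_le a).1 (by omega)
  have h2 := D.letter_zero h
  have h3 := D.H_nonneg (a - 1)
  have h4 := D.H_end
  exact D.smallSteps_H.exists_arc_of_rise (e := s + N) (by omega) (by omega) h2.1 h2.2.1

theorem exists_arc_K_to {m : ℕ} (h : D.letter m = 2) : ∃ a, IsArc D.K a m := by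
  have h1 := (D.letter_le m).1 (by omega)
  have h2 := D.letter_two h
  have h3 := D.K_nonneg m
  have h4 := D.K_start
  exact D.smallSteps_K.exists_arc_of_drop (s := s) (by omega) (by omega) h2.1 h2.2.2

theorem exists_arc_K_from {a : ℕ} (h : D.letter a = 1) : ∃ b, IsArc D.K a b := by
  have h1 := (D.letter_le a).1 (by omega)
  have h2 := D.letter_one h
  have h3 := D.K_nonneg (a - 1)
  have h4 := D.K_end
  exact D.smallSteps_K.exists_arc_of_rise (e := s + N) (by omega) (by omega) h2.1 h2.2.2

/-- A second arc that starts under a first arc and ends to the right of it. -/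
theorem cr_of_arcs {a b c d : ℕ} (h1 : IsArc D.H a b) (h2 : IsArc D.K c d) (hac : a < c)
    (hcb : c ≤ b) (hbd : b < d) : D.Cr c b ∧ D.letter c = 1 := by
  obtain ⟨-, -, -, h5, h6⟩ := id h1
  obtain ⟨-, -, -, -, c6⟩ := id h2
  have l1 := letter_of_arc_H h1
  have l2 := letter_of_arc_K h2
  exact ⟨⟨hcb, Or.inl ⟨l2.1, l1.2, fun j j1 j2 => c6 j j1 (by omega), fun j j1 j2 => by
    have := h6 j (by omega) j2; omega⟩⟩, l2.1⟩

/-- A first arc that starts under a second arc and ends to the right of it. -/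
theorem cr_of_arcs' {a b c d : ℕ} (h1 : IsArc D.H a b) (h2 : IsArc D.K c d) (hca : c < a)
    (had : a < d) (hdb : d < b) : D.Cr a d ∧ D.letter a = 0 := by
  obtain ⟨-, -, -, -, h6⟩ := id h1
  obtain ⟨-, -, -, c5, c6⟩ := id h2
  have l1 := letter_of_arc_H h1
  have l2 := letter_of_arc_K h2
  exact ⟨⟨had.le, Or.inr ⟨l1.1, l2.2, fun j j1 j2 => h6 j j1 (by omega), fun j j1 j2 => by
    have := c6 j (by omega) j2; omega⟩⟩, l1.1⟩

/-- The two arcs of a crossing or fork. -/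
theorem Cr.exists_arcs {u v : ℕ} (h : D.Cr u v) : ∃ a b c d, IsArc D.H a b ∧ IsArc D.K c d ∧
    D.lev1 (u, v) = D.H a ∧ D.lev2 (u, v) = D.K c ∧
    ((D.letter u = 1 ∧ D.key1 (u, v) = u ∧ D.key2 (u, v) = v ∧ a < u ∧ b = v ∧ c = u ∧ v < d ∧ u ≤ v) ∨
      (D.letter u = 0 ∧ D.key1 (u, v) = v ∧ D.key2 (u, v) = u ∧ a = u ∧ v < b ∧ c < u ∧ d = v ∧ u < v)) := by
  obtain ⟨h0, ⟨a1, a2, a3, a4, a5, a6, a7, a8⟩ | ⟨a1, a2, a3, a4, a5, a6, a7, a8, a9⟩⟩ := h.cases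
  · obtain ⟨a, ha⟩ := exists_arc_H_to a2
    obtain ⟨d, hd⟩ := exists_arc_K_from a1
    refine ⟨a, v, u, d, ha, hd, by rw [a3, ha.2.2.2.1], a5, Or.inl ⟨a1, a4, a6, ?_, rfl, rfl, ?_, h0⟩⟩
    · by_contra hc
      have hne : a ≠ u := by have := letter_of_arc_H ha; rintro rfl; omega
      have h1 := ha.2.1
      have h2 := ha.2.2.2.1
      have h3 := ha.2.2.1
      have := a8 (a - 1) (by omega) (by omega)
      omega
    · by_contra hc
      have h2 := hd.2.2.2.1
      have h3 := hd.2.2.1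
      have := a7 d (by omega) (by omega)
      omega
  · obtain ⟨b, hb⟩ := exists_arc_H_from a1
    obtain ⟨c, hc⟩ := exists_arc_K_to a2
    refine ⟨u, b, c, v, hb, hc, a3, by rw [a5, hc.2.2.2.1], Or.inr ⟨a1, a4, a6, rfl, ?_, ?_, rfl, a7⟩⟩
    · by_contra hcc
      have h2 := hb.2.2.2.1
      have h3 := hb.2.2.1
      have := a8 b (by omega) (by omega)
      omega
    · by_contra hcc
      have hne : c ≠ u := by have := letter_of_arc_K hc; rintro rfl; omega
      have h1 := hc.2.1
      have h2 := hc.2.2.2.1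
      have h3 := hc.2.2.1
      have := a9 (c - 1) (by omega) (by omega)
      omega

/-! ### The two sides of an edge, seen from the arcs -/

/-- The corner of the resolved diagram clockwise of a half-edge lies below the arc `(c, d)`. -/
def Under (c d : ℕ) : D.HE → Prop
  | Sum.inl i => c ≤ s + i + 1 ∧ s + i + 1 < d
  | Sum.inr (Sum.inl p, t) =>
    if D.letter p.1.1 = 1 then
      (if t = 0 then c < p.1.1 ∧ p.1.2 < d else if t = 1 then c ≤ p.1.1 ∧ p.1.2 < d
        else c < p.1.1 ∧ p.1.2 ≤ d)
    else
      (if t = 0 then c < p.1.1 ∧ p.1.2 ≤ d else if t = 1 then c ≤ p.1.1 ∧ p.1.2 ≤ d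
        else c ≤ p.1.1 ∧ p.1.2 < d)
  | Sum.inr (Sum.inr p, t) =>
    if D.letter p.1.1 = 1 then
      (if t = 0 then c ≤ p.1.1 ∧ p.1.2 ≤ d else if t = 1 then c < p.1.1 ∧ p.1.2 ≤ d
        else c ≤ p.1.1 ∧ p.1.2 < d)
    else
      (if t = 0 then c ≤ p.1.1 ∧ p.1.2 < d else if t = 1 then c < p.1.1 ∧ p.1.2 < d
        else c < p.1.1 ∧ p.1.2 ≤ d)

/-- The next half-edge around the same vertex, all boundary vertices being identified. -/
noncomputable def nxt : D.HE → D.HE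
  | Sum.inl i => Sum.inl ((finRotate N).symm i)
  | Sum.inr (x, t) => Sum.inr (x, D.ccwAt x t)

/-- Just after the position `k`, the arc `(a, b)` runs below the arc `(c, d)` or is equal to it. -/
def Seg (a b c d k : ℕ) : Prop := c ≤ k ∧ k < d ∧ ¬ (a < c ∧ d < b)

theorem nxt_snk_one (p : D.Snk) (h : D.letter p.1.1 = 1) (t : Fin 3) :
    nxt (D := D) (Sum.inr (Sum.inl p, t)) = Sum.inr (Sum.inl p, t + 2) := by
  simp [nxt, ccwAt, h]

theorem nxt_snk_zero (p : D.Snk) (h : D.letter p.1.1 = 0) (t : Fin 3) :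
    nxt (D := D) (Sum.inr (Sum.inl p, t)) = Sum.inr (Sum.inl p, t + 1) := by
  simp [nxt, ccwAt, h]

theorem nxt_src_one (p : D.Src) (h : D.letter p.1.1 = 1) (t : Fin 3) :
    nxt (D := D) (Sum.inr (Sum.inr p, t)) = Sum.inr (Sum.inr p, t + 2) := by
  simp [nxt, ccwAt, h]

theorem nxt_src_zero (p : D.Src) (h : D.letter p.1.1 = 0) (t : Fin 3) :
    nxt (D := D) (Sum.inr (Sum.inr p, t)) = Sum.inr (Sum.inr p, t + 1) := by
  simp [nxt, ccwAt, h]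

theorem finRotate_symm_val (i : Fin N) : (((finRotate N).symm i : Fin N) : ℕ) =
    if (i : ℕ) = 0 then N - 1 else (i : ℕ) - 1 := by
  obtain ⟨j, rfl⟩ := (finRotate N).surjective i
  rw [Equiv.symm_apply_apply]
  cases N with
  | zero => exact j.elim0
  | succ N =>
    rw [coe_finRotate]
    by_cases h : j = Fin.last N
    · simp [h]
    · simp [h]

/-- The next boundary half-edge is one position to the left. The wrap-around from the first position
to the last is harmless, since no arc extends beyond the word and both corners lie under none. -/
theorem under_nxt_bdry (i : Fin N) {c d : ℕ} (h : IsArc D.H c d ∨ IsArc D.K c d) :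
    Under c d (nxt (D := D) (Sum.inl i)) ↔ c < s + i + 1 ∧ s + i + 1 ≤ d := by
  have := arc_range h
  simp only [nxt, Under, finRotate_symm_val]
  split_ifs <;> omega

/-- The two corners at `e` are the lower and the upper side of the piece of its arc that follows
`k`. They lie under the same arcs, except that only the lower one lies under the arc itself. -/
theorem Out1.under {e : D.HE} {h : ℤ} {k : ℕ} (he : Out1 e h k) :
    ∃ a b, IsArc D.H a b ∧ h = D.H a ∧ a ≤ k ∧ k < b ∧
      ∀ c d, (IsArc D.H c d ∨ IsArc D.K c d) → (Under c d e ↔ Seg a b c d k) ∧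
        (Under c d (nxt e) ↔ Seg a b c d k ∧ ¬ (a = c ∧ b = d)) := by
  obtain ⟨i, rfl, hi, rfl, rfl⟩ | ⟨⟨⟨u, v⟩, hp, hlt⟩, rfl, h1, h2⟩ := out1_iff.1 he
  · obtain ⟨b, hb⟩ := exists_arc_H_from hi
    refine ⟨_, b, hb, rfl, le_rfl, hb.lt, fun c d hcd => ?_⟩
    rw [under_nxt_bdry i hcd]
    simp only [Under, Seg]
    rcases hcd with h | h
    · have := hb.compat h; omega
    · have := arc_compat hb h; omega
  · simp only at hp h1 h2 hlt
    obtain ⟨a, b, a', b', hA, hB, l1, l2, ⟨m1, m2, m3, m4, m5, m6, m7, m8⟩ |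
      ⟨m1, m2, m3, m4, m5, m6, m7, m8⟩⟩ := hp.exists_arcs
    · refine ⟨a, b, hA, by omega, by omega, by omega, fun c d hcd => ?_⟩
      rw [nxt_src_one _ m1]
      simp only [Under, Seg, m1]
      simp
      have := arc_compat hA hB
      rcases hcd with h | h
      · have := hA.compat h; have := arc_compat h hB; omega
      · have := hB.compat h; have := arc_compat hA h; omega
    · refine ⟨a, b, hA, by omega, by omega, by omega, fun c d hcd => ?_⟩
      rw [nxt_src_zero _ m1]
      simp only [Under, Seg, m1]
      simp
      have := arc_compat hA hB
      rcases hcd with h | h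
      · have := hA.compat h; have := arc_compat h hB; omega
      · have := hB.compat h; have := arc_compat hA h; omega

/-- The piece that arrives here lies just before `k`, whence `k - 1`. Seen from its end, the two
sides are exchanged. -/
theorem In1.under {e : D.HE} {h : ℤ} {k : ℕ} (he : In1 e h k) :
    ∃ a b, IsArc D.H a b ∧ h = D.H a ∧ a < k ∧ k ≤ b ∧
      ∀ c d, (IsArc D.H c d ∨ IsArc D.K c d) → (Under c d (nxt e) ↔ Seg a b c d (k - 1)) ∧
        (Under c d e ↔ Seg a b c d (k - 1) ∧ ¬ (a = c ∧ b = d)) := by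
  obtain ⟨⟨⟨u, v⟩, hp⟩, rfl, h1, h2⟩ := in1_iff.1 he
  simp only at hp h1 h2
  obtain ⟨a, b, a', b', hA, hB, l1, l2, ⟨m1, m2, m3, m4, m5, m6, m7, m8⟩ |
    ⟨m1, m2, m3, m4, m5, m6, m7, m8⟩⟩ := hp.exists_arcs
  · refine ⟨a, b, hA, by omega, by omega, by omega, fun c d hcd => ?_⟩
    rw [nxt_snk_one _ m1]
    simp only [Under, Seg, m1]
    simp
    have := arc_compat hA hB
    rcases hcd with h | h
    · have := hA.compat h; have := arc_compat h hB; omega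
    · have := hB.compat h; have := arc_compat hA h; omega
  · refine ⟨a, b, hA, by omega, by omega, by omega, fun c d hcd => ?_⟩
    rw [nxt_snk_zero _ m1]
    simp only [Under, Seg, m1]
    simp
    have := arc_compat hA hB
    rcases hcd with h | h
    · have := hA.compat h; have := arc_compat h hB; omega
    · have := hB.compat h; have := arc_compat hA h; omega

theorem Out2.under {e : D.HE} {h : ℤ} {k : ℕ} (he : Out2 e h k) :
    ∃ a b, IsArc D.K a b ∧ h = D.K a ∧ a < k ∧ k ≤ b ∧
      ∀ c d, (IsArc D.H c d ∨ IsArc D.K c d) → (Under c d (nxt e) ↔ Seg a b c d (k - 1)) ∧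
        (Under c d e ↔ Seg a b c d (k - 1) ∧ ¬ (a = c ∧ b = d)) := by
  obtain ⟨i, rfl, hi, rfl, rfl⟩ | ⟨⟨⟨u, v⟩, hp, hlt⟩, rfl, h1, h2⟩ := out2_iff.1 he
  · obtain ⟨a, hb⟩ := exists_arc_K_to hi
    refine ⟨a, _, hb, hb.2.2.2.1, hb.lt, le_rfl, fun c d hcd => ?_⟩
    rw [under_nxt_bdry i hcd]
    simp only [Under, Seg]
    rcases hcd with h | h
    · have := arc_compat h hb; omega
    · have := hb.compat h; omega
  · simp only at hp h1 h2 hlt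
    obtain ⟨a', b', a, b, hA, hB, l1, l2, ⟨m1, m2, m3, m4, m5, m6, m7, m8⟩ |
      ⟨m1, m2, m3, m4, m5, m6, m7, m8⟩⟩ := hp.exists_arcs
    · refine ⟨a, b, hB, by omega, by omega, by omega, fun c d hcd => ?_⟩
      rw [nxt_src_one _ m1]
      simp only [Under, Seg, m1]
      simp
      have := arc_compat hA hB
      rcases hcd with h | h
      · have := hA.compat h; have := arc_compat h hB; omega
      · have := hB.compat h; have := arc_compat hA h; omega
    · refine ⟨a, b, hB, by omega, by omega, by omega, fun c d hcd => ?_⟩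
      rw [nxt_src_zero _ m1]
      simp only [Under, Seg, m1]
      simp
      have := arc_compat hA hB
      rcases hcd with h | h
      · have := hA.compat h; have := arc_compat h hB; omega
      · have := hB.compat h; have := arc_compat hA h; omega

theorem In2.under {e : D.HE} {h : ℤ} {k : ℕ} (he : In2 e h k) :
    ∃ a b, IsArc D.K a b ∧ h = D.K a ∧ a ≤ k ∧ k < b ∧
      ∀ c d, (IsArc D.H c d ∨ IsArc D.K c d) → (Under c d e ↔ Seg a b c d k) ∧
        (Under c d (nxt e) ↔ Seg a b c d k ∧ ¬ (a = c ∧ b = d)) := by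
  obtain ⟨⟨⟨u, v⟩, hp⟩, rfl, h1, h2⟩ := in2_iff.1 he
  simp only at hp h1 h2
  obtain ⟨a', b', a, b, hA, hB, l1, l2, ⟨m1, m2, m3, m4, m5, m6, m7, m8⟩ |
    ⟨m1, m2, m3, m4, m5, m6, m7, m8⟩⟩ := hp.exists_arcs
  · refine ⟨a, b, hB, by omega, by omega, by omega, fun c d hcd => ?_⟩
    rw [nxt_snk_one _ m1]
    simp only [Under, Seg, m1]
    simp
    have := arc_compat hA hB
    rcases hcd with h | h
    · have := hA.compat h; have := arc_compat h hB; omega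
    · have := hB.compat h; have := arc_compat hA h; omega
  · refine ⟨a, b, hB, by omega, by omega, by omega, fun c d hcd => ?_⟩
    rw [nxt_snk_zero _ m1]
    simp only [Under, Seg, m1]
    simp
    have := arc_compat hA hB
    rcases hcd with h | h
    · have := hA.compat h; have := arc_compat h hB; omega
    · have := hB.compat h; have := arc_compat hA h; omega

end LatticeWord

/-! ### Functions constant on faces -/

namespace LatticeWord

variable {s N : ℕ} {D : LatticeWord s N}

theorem next_iff (d e : D.HE) : D.graph.Next d e ↔ e = nxt d := by
  constructor
  · rintro (⟨h1, rfl⟩ | ⟨i, rfl, rfl⟩)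
    · match d, h1 with
      | Sum.inl i, h1 => exact (h1 ⟨i, rfl⟩).elim
      | Sum.inr (x, t), _ => rfl
    · exact congrArg Sum.inl ((finRotate N).symm_apply_apply i).symm
  · rintro rfl
    match d with
    | Sum.inl i =>
      exact Or.inr ⟨(finRotate N).symm i, congrArg Sum.inl ((finRotate N).apply_symm_apply i).symm, rfl⟩
    | Sum.inr (x, t) =>
      refine Or.inl ⟨?_, rfl⟩
      rintro ⟨i, hi⟩
      exact Sum.inl_ne_inr hi

/-- An arc can pass from above `(a, b)` to below it only at a crossing, which is a sink on `(a, b)`.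
Minimality of `k'` leaves none between `k` and `k'`. -/
theorem Edge.seg {a b a' b' c d k k' : ℕ} {h : ℤ} (hA : IsArc D.H a b) (hA' : IsArc D.H a' b')
    (ha : h = D.H a) (ha' : h = D.H a') (h1 : a ≤ k) (h2 : k < b) (h3 : a' < k') (h4 : k' ≤ b')
    (hk : k < k') (hc : ∀ (e' : D.HE) (j : ℕ), In1 e' h j → k < j → k' ≤ j)
    (hcd : IsArc D.H c d ∨ IsArc D.K c d) : a = a' ∧ b = b' ∧ (Seg a b c d k ↔ Seg a b c d (k' - 1)) := by
  -- The fork at `b` is a sink of level `h`, so the piece ends no later than its arc.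
  have hb : k' ≤ b := by
    have hl := (letter_of_arc_H hA).2
    refine hc _ b (in1_iff.2 ⟨⟨(b, b), D.cr_self hl⟩, rfl, ?_, ?_⟩) h2
    · simp only [lev1, hl, if_pos]; rw [ha, hA.2.2.2.1]
    · simp [key1]
  have haa : a = a' := by
    have p1 := hA.prev
    have p2 := hA'.prev
    rcases lt_trichotomy a a' with hlt | heq | hlt
    · have := hA.2.2.2.2 (a' - 1) (by omega) (by omega); omega
    · exact heq
    · have := hA'.2.2.2.2 (a - 1) (by omega) (by omega); omega
  subst haa
  obtain rfl := hA.right_unique hA'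
  refine ⟨rfl, rfl, ?_⟩
  rcases hcd with hB | hB
  · have := hA.compat hB
    simp only [Seg]; omega
  · have h5 := arc_compat hA hB
    have e1 : a < c → c < b → b < d → k < c → k' ≤ c := by
      intro g1 g2 g3
      obtain ⟨hC, hl⟩ := cr_of_arcs hA hB g1 g2.le g3
      exact hc _ c (in1_iff.2 ⟨⟨(c, b), hC⟩, rfl, by simp only [lev1, hl, if_pos]; rw [ha, hA.2.2.2.1],
        by simp [key1, hl]⟩)
    have e2 : c < a → a < d → d < b → k < d → k' ≤ d := by
      intro g1 g2 g3
      obtain ⟨hC, hl⟩ := cr_of_arcs' hA hB g1 g2 g3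
      exact hc _ d (in1_iff.2 ⟨⟨(a, d), hC⟩, rfl, by simp [lev1, hl, ha], by simp [key1, hl]⟩)
    simp only [Seg]; omega

theorem Edge.seg' {a b a' b' c d k k' : ℕ} {h : ℤ} (hA : IsArc D.K a b) (hA' : IsArc D.K a' b')
    (ha : h = D.K a) (ha' : h = D.K a') (h1 : a < k) (h2 : k ≤ b) (h3 : a' ≤ k') (h4 : k' < b')
    (hk : k' < k) (hc : ∀ (e' : D.HE) (j : ℕ), In2 e' h j → j < k → j ≤ k')
    (hcd : IsArc D.H c d ∨ IsArc D.K c d) : a = a' ∧ b = b' ∧ (Seg a b c d (k - 1) ↔ Seg a b c d k') := by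
  -- Now the fork at the left end `a` is the sink in which the strand ends.
  have hb : a ≤ k' := by
    have hl := (letter_of_arc_K hA).1
    exact hc _ a (in2_iff.2 ⟨⟨(a, a), D.cr_self hl⟩, rfl, by simp [lev2, hl, ha], by simp [key2]⟩) h1
  have haa : a = a' := by
    have p1 := hA.prev
    have p2 := hA'.prev
    rcases lt_trichotomy a a' with hlt | heq | hlt
    · have := hA.2.2.2.2 (a' - 1) (by omega) (by omega); omega
    · exact heq
    · have := hA'.2.2.2.2 (a - 1) (by omega) (by omega); omega
  subst haa
  obtain rfl := hA.right_unique hA'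
  refine ⟨rfl, rfl, ?_⟩
  rcases hcd with hB | hB
  · have h5 := arc_compat hB hA
    have e1 : c < a → a < d → d < b → d < k → d ≤ k' := by
      intro g1 g2 g3
      obtain ⟨hC, hl⟩ := cr_of_arcs hB hA g1 g2.le g3
      exact hc _ d (in2_iff.2 ⟨⟨(a, d), hC⟩, rfl, by simp [lev2, hl, ha], by simp [key2, hl]⟩)
    have e2 : a < c → c < b → b < d → c < k → c ≤ k' := by
      intro g1 g2 g3
      obtain ⟨hC, hl⟩ := cr_of_arcs' hB hA g1 g2 g3
      exact hc _ c (in2_iff.2 ⟨⟨(c, b), hC⟩, rfl, by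
        have := hA.2.2.2.1
        simp [lev2, hl, ha]; omega, by simp [key2, hl]⟩)
    simp only [Seg]; omega
  · have := hA.compat hB
    simp only [Seg]; omega

/-- The two sides of an edge: both half-edges see the same corners below an arc. -/
theorem Edge.under {d e : D.HE} (hE : Edge d e) {x y : ℕ} (hxy : IsArc D.H x y ∨ IsArc D.K x y) :
    (Under x y d ↔ Under x y (nxt e)) ∧ (Under x y e ↔ Under x y (nxt d)) := by
  obtain ⟨i, h, rfl, rfl⟩ | ⟨p, rfl, rfl⟩ | ⟨h, k, k', h1, h2, h3, h4⟩ |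
    ⟨h, k, k', h1, h2, h3, h4⟩ := edge_iff.1 hE
  · rw [under_nxt_bdry i hxy, nxt_snk_one _ h]
    simp [Under, h]
  · obtain ⟨⟨u, v⟩, hp, hlt⟩ := p
    obtain ⟨-, ⟨h, -⟩ | ⟨h, -⟩⟩ := hp.cases
    · rw [nxt_snk_one _ h, nxt_src_one _ h]
      simp [Under, h]
    · rw [nxt_snk_zero _ h, nxt_src_zero _ h]
      simp [Under, h]
  · obtain ⟨a, b, hA, a1, a2, a3, a4⟩ := h1.under
    obtain ⟨a', b', hA', a1', a2', a3', a4'⟩ := h2.under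
    obtain ⟨rfl, rfl, h5⟩ := Edge.seg hA hA' a1 a1' a2 a3 a2' a3' h3 h4 hxy
    rw [(a4 x y hxy).1, (a4 x y hxy).2, (a4' x y hxy).1, (a4' x y hxy).2, h5]
    exact ⟨Iff.rfl, Iff.rfl⟩
  · obtain ⟨a, b, hA, a1, a2, a3, a4⟩ := h1.under
    obtain ⟨a', b', hA', a1', a2', a3', a4'⟩ := h2.under
    obtain ⟨rfl, rfl, h5⟩ := Edge.seg' hA hA' a1 a1' a2 a3 a2' a3' h3 h4 hxy
    rw [(a4 x y hxy).1, (a4 x y hxy).2, (a4' x y hxy).1, (a4' x y hxy).2, h5]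
    exact ⟨Iff.rfl, Iff.rfl⟩

/-- A function on half-edges that takes the same value at all corners of a face. -/
def FaceInvariant (D : LatticeWord s N) {α : Type*} (f : D.HE → α) : Prop :=
  ∀ d e, Edge d e → f d = f (nxt e) ∧ f e = f (nxt d)

theorem faceInvariant_of_lift {α : Type*} {f : D.HE → α}
    (hf : ∀ d e, D.graph.FaceNext d e → f d = f e) : D.FaceInvariant f := fun d e h =>
  ⟨hf _ _ ⟨e, Or.inl h, (next_iff _ _).2 rfl⟩, hf _ _ ⟨d, Or.inr h, (next_iff _ _).2 rfl⟩⟩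

theorem FaceInvariant.eq {α : Type*} {f : D.HE → α} (hf : D.FaceInvariant f) (d e : D.HE)
    (h : D.graph.FaceNext d e) : f d = f e := by
  obtain ⟨d', h1 | h1, h2⟩ := h
  · obtain rfl := (next_iff _ _).1 h2
    exact (hf _ _ h1).1
  · obtain rfl := (next_iff _ _).1 h2
    exact (hf _ _ h1).2

instance finite_snk : Finite D.Snk := by
  have : ∀ p : D.Snk, p.1 ∈ Set.Icc (0, 0) (s + N, s + N) := by
    rintro ⟨⟨u, v⟩, hp⟩
    simp only at hp
    obtain ⟨h0, ⟨h, h', -⟩ | ⟨h, h', -⟩⟩ := hp.cases <;>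
    · have h1 := (D.letter_le u).1 (by omega)
      have h2 := (D.letter_le v).1 (by omega)
      exact ⟨⟨Nat.zero_le _, Nat.zero_le _⟩, ⟨h1.2, h2.2⟩⟩
  exact Finite.of_injective (fun p : D.Snk => (⟨p.1, this p⟩ : Set.Icc ((0, 0) : ℕ × ℕ) (s + N, s + N)))
    fun p q h => by simpa [Subtype.ext_iff] using h

instance finite_src : Finite D.Src :=
  Finite.of_injective (fun p : D.Src => (⟨p.1, p.2.1⟩ : D.Snk))
    fun p q h => by simpa [Subtype.ext_iff] using h

theorem Cr.letter_cases {p : ℕ × ℕ} (h : D.Cr p.1 p.2) : D.letter p.1 = 1 ∨ D.letter p.1 = 0 := by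
  obtain ⟨-, h | h⟩ := h
  · exact Or.inl h.1
  · exact Or.inr h.1

theorem bdry_eq_of_nxt {α : Type*} {f : D.HE → α} (hn : ∀ d, f (nxt d) = f d) (i i₀ : Fin N) :
    f (Sum.inl i) = f (Sum.inl i₀) := by
  have hb : ∀ k : ℕ, ∀ hk : k < N, f (Sum.inl ⟨k, hk⟩) = f (Sum.inl ⟨0, by omega⟩) := by
    intro k
    induction k with
    | zero => intro _; rfl
    | succ k ih =>
      intro hk
      rw [← ih (by omega), ← hn (Sum.inl ⟨k + 1, hk⟩)]
      simp only [nxt]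
      congr 2
      apply Fin.ext
      rw [finRotate_symm_val]
      simp
  exact (hb i i.2).trans (hb i₀ i₀.2).symm

theorem vertex_eq_of_nxt {α : Type*} {f : D.HE → α} (hn : ∀ d, f (nxt d) = f d)
    (x : D.Snk ⊕ D.Src) (t : Fin 3) : f (Sum.inr (x, t)) = f (Sum.inr (x, 0)) := by
  have h0 := hn (Sum.inr (x, 0))
  have h1 := hn (Sum.inr (x, 1))
  have h2 := hn (Sum.inr (x, 2))
  simp only [nxt, ccwAt] at h0 h1 h2
  split_ifs at h0 h1 h2
  · simp only [Equiv.coe_addRight] at h0 h1 h2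
    fin_cases t
    · rfl
    · exact h1.symm
    · exact h0
  · simp only [Equiv.coe_addRight] at h0 h1 h2
    fin_cases t
    · rfl
    · exact h0
    · exact h2.symm

/-- A function that is constant on vertices and edges is constant. -/
theorem eq_of_invariant {α : Type*} {f : D.HE → α} (hn : ∀ d, f (nxt d) = f d)
    (he : ∀ d e, Edge d e → f d = f e) (i₀ : Fin N) (d : D.HE) : f d = f (Sum.inl i₀) := by
  have hb' : ∀ i : Fin N, f (Sum.inl i) = f (Sum.inl i₀) := fun i => bdry_eq_of_nxt hn i i₀
  have hsnk : ∀ (p : D.Snk) (t : Fin 3), f (Sum.inr (Sum.inl p, t)) = f (Sum.inr (Sum.inl p, 0)) :=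
    fun p t => vertex_eq_of_nxt hn _ t
  have hsrc : ∀ (p : D.Src) (t : Fin 3), f (Sum.inr (Sum.inr p, t)) =
      f (Sum.inr (Sum.inl ⟨p.1, p.2.1⟩, 0)) := by
    intro p t
    rw [vertex_eq_of_nxt hn _ t, ← vertex_eq_of_nxt hn _ 2, he _ _ (Edge.new p), hsnk]
  -- Going back along a first strand leads either to the boundary or to a source whose companion
  -- sink has a smaller position.
  have key : ∀ k (e : D.HE) (h : ℤ), In1 e h k → f e = f (Sum.inl i₀) := by
    intro k
    induction k using Nat.strong_induction_on with
    | _ k ih =>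
      intro e h hin
      obtain ⟨d, k', h1, h2, h3⟩ := hin.exists_edge
      rw [← he _ _ h3]
      obtain ⟨i, rfl, -⟩ | ⟨p, rfl, h4, h5⟩ := out1_iff.1 h1
      · exact hb' i
      · rw [hsrc]
        exact ih k' h2 _ _ (in1_iff.2 ⟨⟨p.1, p.2.1⟩, rfl, h4, h5⟩)
  match d with
  | Sum.inl i => exact hb' i
  | Sum.inr (Sum.inl p, t) => rw [hsnk]; exact key _ _ _ (In1.snk p)
  | Sum.inr (Sum.inr p, t) => rw [hsrc]; exact key _ _ _ (In1.snk ⟨p.1, p.2.1⟩)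

/-- The half-edges at the corners to the right, to the left, above and below a crossing (in some
order). -/
def topOrBot (p : D.Src) : D.HE :=
  Sum.inr (Sum.inl ⟨p.1, p.2.1⟩, if D.letter p.1.1 = 1 then 0 else 1)

/-- If the four corners of a crossing sum to zero, the jump across an arc is the same before and
after the crossing. Zero jumps at the outer ends thus spread along all arcs, then to stems and new
edges; the graph being connected, `f` is constant. -/
theorem FaceInvariant.eq_zero {f : D.HE → ZMod 2} (hf : D.FaceInvariant f) (i₀ : Fin N)
    (h0 : f (Sum.inl i₀) = 0)
    (hb : ∀ i : Fin N, D.letter (s + i + 1) ≠ 1 → f (Sum.inl i) + f (nxt (Sum.inl i)) = 0)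
    (hx : ∀ p : D.Src, f (Sum.inr (Sum.inr p, 0)) + f (Sum.inr (Sum.inr p, 1)) +
      f (Sum.inr (Sum.inr p, 2)) + f (topOrBot p) = 0) (d : D.HE) : f d = 0 := by
  have add2 : ∀ a b : ZMod 2, a + b = 0 → a = b := by decide
  have sum4 : ∀ a b c d : ZMod 2, a + b + c + d = 0 → (a = b → c = d) ∧ (a = c → b = d) ∧
    (a = d → b = c) ∧ (b = c → a = d) ∧ (b = d → a = c) ∧ (c = d → a = b) := by decide
  -- No jump across first arcs, by induction from their outer, left ends.
  have k1 : ∀ k (e : D.HE) (h : ℤ), In1 e h k → f (nxt e) = f e := by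
    intro k
    induction k using Nat.strong_induction_on with
    | _ k ih =>
      intro e h hin
      obtain ⟨d, k', h1, h2, h3⟩ := hin.exists_edge
      rw [← (hf _ _ h3).1, (hf _ _ h3).2]
      obtain ⟨i, rfl, hi, -⟩ | ⟨p, rfl, h4, h5⟩ := out1_iff.1 h1
      · exact add2 _ _ (hb i (by omega))
      · have h6 := ih k' h2 _ _ (in1_iff.2 ⟨⟨p.1, p.2.1⟩, rfl, h4, h5⟩)
        have h7 := hf _ _ (Edge.new p)
        have h8 := sum4 _ _ _ _ (hx p)
        rcases p.2.1.letter_cases with hl | hl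
        · rw [nxt_snk_one _ hl] at h6
          rw [nxt_snk_one _ hl, nxt_src_one _ hl] at h7
          rw [nxt_src_one _ hl]
          simp only [topOrBot, hl, if_pos] at h8
          exact h8.2.2.2.2.1 (h7.2.symm.trans h6)
        · rw [nxt_snk_zero _ hl] at h6
          rw [nxt_snk_zero _ hl, nxt_src_zero _ hl] at h7
          rw [nxt_src_zero _ hl]
          simp only [topOrBot, hl, zero_ne_one, if_false] at h8
          exact h8.2.2.2.2.2 (h7.1.trans h6.symm)
  -- No jump across second arcs. Their outer ends are on the right, so the induction is on the
  -- distance to the end of the word.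
  have k2 : ∀ n k (e : D.HE) (h : ℤ), s + N - k ≤ n → In2 e h k → f (nxt e) = f e := by
    intro n
    induction n with
    | zero =>
      intro k e h hk hin
      have := (D.strands2 hin.pos).of_out k ⟨e, hin⟩
      have := D.eq_zero_of_ge (k := k) (by omega)
      have := hin.pos
      omega
    | succ n ih =>
      intro k e h hk hin
      obtain ⟨d, k', h1, h2, h3⟩ := hin.exists_edge
      rw [← (hf _ _ h3).1, (hf _ _ h3).2]
      obtain ⟨i, rfl, hi, -⟩ | ⟨p, rfl, h4, h5⟩ := out2_iff.1 h1
      · exact add2 _ _ (hb i (by omega))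
      · have hn := (D.strands2 hin.pos).of_out k ⟨e, hin⟩
        have hkN : k < s + N := by
          by_contra hc
          have := D.eq_zero_of_ge (k := k) (by omega)
          have := hin.pos
          omega
        have h6 := ih k' _ _ (by omega) (in2_iff.2 ⟨⟨p.1, p.2.1⟩, rfl, h4, h5⟩)
        have h7 := hf _ _ (Edge.new p)
        have h8 := sum4 _ _ _ _ (hx p)
        rcases p.2.1.letter_cases with hl | hl
        · rw [nxt_snk_one _ hl] at h6
          rw [nxt_snk_one _ hl, nxt_src_one _ hl] at h7
          rw [nxt_src_one _ hl]
          simp only [topOrBot, hl, if_pos] at h8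
          exact (h8.2.2.2.2.2 (h7.1.trans h6.symm)).symm
        · rw [nxt_snk_zero _ hl] at h6
          rw [nxt_snk_zero _ hl, nxt_src_zero _ hl] at h7
          rw [nxt_src_zero _ hl]
          simp only [topOrBot, hl, zero_ne_one, if_false] at h8
          exact h8.2.2.1 (h7.2.symm.trans h6)
  -- Two edges at a trivalent vertex without jump force all three corners there to agree.
  have k3 : ∀ p : D.Snk, f (Sum.inr (Sum.inl p, 0)) = f (Sum.inr (Sum.inl p, 1)) ∧
      f (Sum.inr (Sum.inl p, 1)) = f (Sum.inr (Sum.inl p, 2)) := by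
    intro p
    have h1 := k1 _ _ _ (In1.snk p)
    have h2 := k2 _ _ _ _ le_rfl (In2.snk p)
    rcases p.2.letter_cases with hl | hl
    · rw [nxt_snk_one _ hl] at h1 h2
      exact ⟨h2, h2.symm.trans h1.symm⟩
    · rw [nxt_snk_zero _ hl] at h1 h2
      exact ⟨h1.symm, h2.symm⟩
  have hin : ∀ (p : D.Snk) (t : Fin 3), f (nxt (Sum.inr (Sum.inl p, t))) = f (Sum.inr (Sum.inl p, t)) := by
    intro p t
    obtain ⟨h1, h2⟩ := k3 p
    rcases p.2.letter_cases with hl | hl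
    · rw [nxt_snk_one _ hl]
      fin_cases t
      · exact (h1.trans h2).symm
      · exact h1
      · exact h2
    · rw [nxt_snk_zero _ hl]
      fin_cases t
      · exact h1.symm
      · exact h2.symm
      · exact h1.trans h2
  have hin' : ∀ e : D.HE, ¬ IsOutHE e → f (nxt e) = f e := by
    intro e he
    match e, he with
    | Sum.inl _, h => exact (h trivial).elim
    | Sum.inr (Sum.inr _, _), h => exact (h trivial).elim
    | Sum.inr (Sum.inl p, t), _ => exact hin p t
  have hE : ∀ d e : D.HE, Edge d e → f d = f e := fun d e h =>
    (hf d e h).1.trans (hin' e h.isOut_isIn.2.1)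
  rw [← h0]
  refine eq_of_invariant (fun d => ?_) hE i₀ d
  by_cases hd : IsOutHE d
  · obtain ⟨e, he⟩ := exists_edge_out hd
    rw [hE d e he, (hf d e he).2]
  · exact hin' d hd

end LatticeWord

/-! ### Counting the faces by linear algebra over `ZMod 2` -/

namespace LatticeWord

variable {s N : ℕ} {D : LatticeWord s N}

open Classical in
/-- The indicator of a proposition modulo 2. -/
noncomputable def ind (P : Prop) : ZMod 2 := if P then 1 else 0

theorem ind_and (P Q : Prop) : ind (P ∧ Q) = ind P * ind Q := by
  by_cases hP : P <;> by_cases hQ : Q <;> simp [ind, hP, hQ]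

theorem ind_congr {P Q : Prop} (h : P ↔ Q) : ind P = ind Q := by rw [propext h]

theorem ind_le_add_ind_lt (x y : ℕ) : ind (x ≤ y) + ind (x < y) = ind (x = y) := by
  have h2 : (1 : ZMod 2) + 1 = 0 := by decide
  rcases lt_trichotomy x y with h | h | h
  · simp [ind, h, h.le, h.ne, h2]
  · simp [ind, h]
  · simp [ind, h.not_gt, h.not_ge, h.ne']

theorem ind_true {P : Prop} (h : P) : ind P = 1 := by simp [ind, h]

theorem ind_false {P : Prop} (h : ¬ P) : ind P = 0 := by simp [ind, h]

-- An arc has exactly one outer endpoint, the other one carrying the letter `1`. The indicator of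
-- the region under it jumps only at its endpoints, so among outer vertices only at `i`.
open Classical in
theorem exists_arc_at (i : Fin N) (hi : D.letter (s + i + 1) ≠ 1) :
    ∃ c d, (IsArc D.H c d ∨ IsArc D.K c d) ∧ ∀ j : Fin N, D.letter (s + j + 1) ≠ 1 →
      ind (Under c d (Sum.inl j : D.HE)) + ind (Under c d (nxt (Sum.inl j : D.HE))) =
        if i = j then 1 else 0 := by
  have key : ∀ c d, (IsArc D.H c d ∨ IsArc D.K c d) → ∀ j : Fin N,
      ind (Under c d (Sum.inl j : D.HE)) + ind (Under c d (nxt (Sum.inl j : D.HE))) =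
        ind (c = s + j + 1 ∨ d = s + j + 1) := by
    intro c d hcd j
    rw [ind_congr (under_nxt_bdry j hcd)]
    simp only [Under]
    have hlt := (arc_range hcd).2.1
    have h2 : (1 : ZMod 2) + 1 = 0 := by decide
    by_cases h1 : c = s + j + 1
    · rw [ind_true (P := c ≤ _ ∧ _) (by omega), ind_false (P := c < _ ∧ _) (by omega),
        ind_true (P := _ ∨ _) (by omega), add_zero]
    by_cases h3 : d = s + j + 1
    · rw [ind_false (P := c ≤ _ ∧ _) (by omega), ind_true (P := c < _ ∧ _) (by omega),
        ind_true (P := _ ∨ _) (by omega), zero_add]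
    rw [ind_false (P := _ ∨ _) (by omega)]
    by_cases h4 : c ≤ s + j + 1 ∧ s + j + 1 < d
    · rw [ind_true h4, ind_true (P := c < _ ∧ _) (by omega), h2]
    · rw [ind_false h4, ind_false (P := c < _ ∧ _) (by omega), add_zero]
  have hle := (D.letter_le (s + i + 1)).2 (by omega)
  have h02 : D.letter (s + i + 1) = 0 ∨ D.letter (s + i + 1) = 2 := by omega
  rcases h02 with h | h
  · obtain ⟨b, hb⟩ := exists_arc_H_from h
    refine ⟨_, b, Or.inl hb, fun j hj => ?_⟩
    rw [key _ _ (Or.inl hb)]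
    have := (letter_of_arc_H hb).2
    split_ifs with hij
    · subst hij; exact ind_true (Or.inl rfl)
    · refine ind_false ?_
      rintro (h1 | h1)
      · exact hij (Fin.ext (by omega))
      · rw [h1] at this; exact hj this
  · obtain ⟨b, hb⟩ := exists_arc_K_to h
    refine ⟨b, _, Or.inr hb, fun j hj => ?_⟩
    rw [key _ _ (Or.inr hb)]
    have := (letter_of_arc_K hb).1
    split_ifs with hij
    · subst hij; exact ind_true (Or.inr rfl)
    · refine ind_false ?_
      rintro (h1 | h1)
      · rw [h1] at this; exact hj this
      · exact hij (Fin.ext (by omega))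

/-- Evaluation at a half-edge. -/
abbrev ev (d : D.HE) : (D.HE → ZMod 2) →ₗ[ZMod 2] ZMod 2 := LinearMap.proj d

/-- The sum over the four corners at a crossing. -/
noncomputable def fourCorners (q : D.Src) : (D.HE → ZMod 2) →ₗ[ZMod 2] ZMod 2 :=
  ev (Sum.inr (Sum.inr q, 0)) + ev (Sum.inr (Sum.inr q, 1)) + ev (Sum.inr (Sum.inr q, 2)) +
    ev (topOrBot q)

theorem fourCorners_apply (q : D.Src) (f : D.HE → ZMod 2) : fourCorners q f =
    f (Sum.inr (Sum.inr q, 0)) + f (Sum.inr (Sum.inr q, 1)) + f (Sum.inr (Sum.inr q, 2)) +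
      f (topOrBot q) := rfl

/-- Modulo 2 the sum factors into the jump at `u` times the jump at `v`. It is nonzero only if `u`
and `v` are the two ends of one arc, which the letters of a crossing exclude. -/
theorem fourCorners_arc (q : D.Src) {c d : ℕ} (h : IsArc D.H c d ∨ IsArc D.K c d) :
    fourCorners q (fun e => ind (Under c d e)) = 0 := by
  obtain ⟨⟨u, v⟩, hp, hlt⟩ := q
  simp only at hp hlt
  have key : (ind (c ≤ u) + ind (c < u)) * (ind (v ≤ d) + ind (v < d)) = 0 := by
    rw [add_comm (ind (c ≤ u)), ← add_comm (ind (c ≤ u)), ind_le_add_ind_lt, ind_le_add_ind_lt]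
    by_cases h1 : c = u
    · subst h1
      by_cases h2 : v = d
      · subst h2
        exfalso
        rcases h with h | h
        · have := letter_of_arc_H h
          obtain ⟨-, ⟨a1, a2, -⟩ | ⟨a1, a2, -⟩⟩ := hp.cases <;> omega
        · have := letter_of_arc_K h
          obtain ⟨-, ⟨a1, a2, -⟩ | ⟨a1, a2, -⟩⟩ := hp.cases <;> omega
      · rw [ind_false h2, mul_zero]
    · rw [ind_false h1, zero_mul]
  rw [fourCorners_apply, ← key]
  rcases hp.letter_cases (p := (u, v)) with hl | hl
  · simp only [Under, topOrBot, hl]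
    simp [ind_and]
    ring
  · simp only [Under, topOrBot, hl]
    simp [ind_and]
    ring

-- The arcs are those that cross at `p`, and the function is the indicator of the region under both.
-- Exactly one corner at `p` lies in this region, and an even number of corners at every other
-- crossing.
open Classical in
theorem exists_arcs_at (p : D.Src) : ∃ a b c d, IsArc D.H a b ∧ IsArc D.K c d ∧ ∀ q : D.Src,
    fourCorners q (fun e => ind (Under a b e) * ind (Under c d e)) = if p = q then 1 else 0 := by
  obtain ⟨a, b, c, d, hA, hB, -, -, hp⟩ := p.2.1.exists_arcs
  refine ⟨a, b, c, d, hA, hB, fun q => ?_⟩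
  obtain ⟨a', b', c', d', hA', hB', -, -, hq⟩ := q.2.1.exists_arcs
  obtain ⟨⟨x, y⟩, hp1, hp2⟩ := p
  obtain ⟨⟨u, v⟩, hq1, hq2⟩ := q
  simp only at hp hq hp1 hp2 hq1 hq2
  have i3 := arc_compat hA hB'
  have i4 := arc_compat hA' hB
  have fwd : a = a' → b = b' → c = c' → d = d' → x = u ∧ y = v := by
    rintro rfl rfl rfl rfl
    omega
  rw [fourCorners_apply]
  rcases hq with hq | hq
  · have e1 : ind (a ≤ u) = ind (a < u) := ind_congr (by omega)
    have e2 : ind (v ≤ d) = ind (v < d) := ind_congr (by omega)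
    -- The equalities on the left say that the arcs at `q` share one endpoint each with the arcs at
    -- `p`. An endpoint determines its arc, so both crossings have the same arcs.
    have key' : ((a < u ∧ v < d) ∧ v = b) ∧ c = u ↔ x = u ∧ y = v := by
      constructor
      · rintro ⟨⟨-, h1⟩, h2⟩
        have h3 : b = b' := by omega
        have h4 : c = c' := by omega
        have h5 : a = a' := by rw [h3] at hA; exact hA.left_unique hA'
        have h6 : d = d' := by rw [h4] at hB; exact hB.right_unique hB'
        exact fwd h5 h3 h4 h6
      · rintro ⟨rfl, rfl⟩
        omega
    have key : ind (a < u) * ind (v < d) * (ind (v ≤ b) + ind (v < b)) *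
        (ind (c ≤ u) + ind (c < u)) =
        if (⟨(x, y), hp1, hp2⟩ : D.Src) = ⟨(u, v), hq1, hq2⟩ then 1 else 0 := by
      rw [ind_le_add_ind_lt, ind_le_add_ind_lt, ← ind_and, ← ind_and, ← ind_and, ind]
      congr 1
      rw [Subtype.mk.injEq, Prod.mk.injEq]
      exact propext key'
    rw [← key]
    simp only [Under, topOrBot, hq.1]
    simp [ind_and, e1, e2]
    ring
  · have e1 : ind (c ≤ u) = ind (c < u) := ind_congr (by omega)
    have e2 : ind (v ≤ b) = ind (v < b) := ind_congr (by omega)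
    have key' : ((c < u ∧ v < b) ∧ v = d) ∧ a = u ↔ x = u ∧ y = v := by
      constructor
      · rintro ⟨⟨-, h1⟩, h2⟩
        have h3 : d = d' := by omega
        have h4 : a = a' := by omega
        have h5 : c = c' := by rw [h3] at hB; exact hB.left_unique hB'
        have h6 : b = b' := by rw [h4] at hA; exact hA.right_unique hA'
        exact fwd h4 h6 h5 h3
      · rintro ⟨rfl, rfl⟩
        omega
    have key : ind (c < u) * ind (v < b) * (ind (v ≤ d) + ind (v < d)) *
        (ind (a ≤ u) + ind (a < u)) =
        if (⟨(x, y), hp1, hp2⟩ : D.Src) = ⟨(u, v), hq1, hq2⟩ then 1 else 0 := by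
      rw [ind_le_add_ind_lt, ind_le_add_ind_lt, ← ind_and, ← ind_and, ← ind_and, ind]
      congr 1
      rw [Subtype.mk.injEq, Prod.mk.injEq]
      exact propext key'
    rw [← key]
    simp only [Under, topOrBot, hq.1]
    simp [ind_and, e1, e2]
    ring

theorem faceInvariant_ind {c d : ℕ} (h : IsArc D.H c d ∨ IsArc D.K c d) :
    D.FaceInvariant (fun e => ind (Under c d e)) := fun _ _ hE =>
  ⟨ind_congr (hE.under h).1, ind_congr (hE.under h).2⟩

/-- The boundary vertices on the bottom and top rows. -/
abbrev Outer (D : LatticeWord s N) : Type := {i : Fin N // D.letter (s + i + 1) ≠ 1}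

/-- The number of faces is the dimension of the space of functions on them, bounded above by jointly
injective functionals and below by independent functions, with the same index set. -/
theorem card_faces (i₀ : Fin N) :
    Nat.card (Quot D.graph.FaceNext) = 1 + (Nat.card D.Outer + Nat.card D.Src) := by
  classical
  have : Finite D.graph.HalfEdge := inferInstanceAs (Finite D.HE)
  have fin : Fintype (Quot D.graph.FaceNext) := Fintype.ofFinite _
  have fs : Fintype D.Src := Fintype.ofFinite _
  have hcard : Nat.card (Quot D.graph.FaceNext) =
      Module.finrank (ZMod 2) (Quot D.graph.FaceNext → ZMod 2) := by
    rw [Module.finrank_fintype_fun_eq_card, Nat.card_eq_fintype_card]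
  have hcard' : 1 + (Nat.card D.Outer + Nat.card D.Src) =
      Fintype.card (Unit ⊕ (D.Outer ⊕ D.Src)) := by
    simp [Nat.card_eq_fintype_card]
  rw [hcard, hcard']
  let pull : (Quot D.graph.FaceNext → ZMod 2) →ₗ[ZMod 2] (D.HE → ZMod 2) :=
    LinearMap.funLeft (ZMod 2) (ZMod 2) (fun d : D.HE => (Quot.mk _ d : Quot D.graph.FaceNext))
  apply le_antisymm
  -- Upper bound: a value at one corner, the jumps at outer vertices and the four-corner sums
  -- separate face functions.
  · let Φ : (Quot D.graph.FaceNext → ZMod 2) →ₗ[ZMod 2] (Unit ⊕ (D.Outer ⊕ D.Src) → ZMod 2) :=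
      LinearMap.pi (Sum.elim (fun _ => ev (Sum.inl i₀) ∘ₗ pull)
        (Sum.elim (fun i => (ev (Sum.inl i.1) + ev (nxt (Sum.inl i.1))) ∘ₗ pull)
          (fun q => fourCorners q ∘ₗ pull)))
    have hΦ : Function.Injective Φ := by
      rw [injective_iff_map_eq_zero]
      intro g hg
      funext x
      induction x using Quot.ind with
      | _ d =>
        refine FaceInvariant.eq_zero (f := pull g)
          (faceInvariant_of_lift fun d e h => congrArg g (Quot.sound h)) i₀
          (congrFun hg (Sum.inl ())) (fun i hi => congrFun hg (Sum.inr (Sum.inl ⟨i, hi⟩)))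
          (fun q => congrFun hg (Sum.inr (Sum.inr q))) d
    exact (LinearMap.finrank_le_finrank_of_injective hΦ).trans
      (Module.finrank_fintype_fun_eq_card _).le
  -- Lower bound: the constant, the indicators of arcs at outer vertices and the products at
  -- crossings.
  · choose c d hcd hj using fun i : D.Outer => exists_arc_at i.1 i.2
    choose a b x y hab hxy hq using fun p : D.Src => exists_arcs_at p
    let B : Unit ⊕ (D.Outer ⊕ D.Src) → D.HE → ZMod 2 :=
      Sum.elim (fun _ _ => 1) (Sum.elim (fun i e => ind (Under (c i) (d i) e))
        (fun p e => ind (Under (a p) (b p) e) * ind (Under (x p) (y p) e)))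
    have hB : ∀ i, D.FaceInvariant (B i) := by
      rintro (_ | i | p)
      · exact fun _ _ _ => ⟨rfl, rfl⟩
      · exact faceInvariant_ind (hcd i)
      · intro d e hE
        have h1 := faceInvariant_ind (Or.inl (hab p)) d e hE
        have h2 := faceInvariant_ind (Or.inr (hxy p)) d e hE
        exact ⟨congrArg₂ (· * ·) h1.1 h2.1, congrArg₂ (· * ·) h1.2 h2.2⟩
    let B' : Unit ⊕ (D.Outer ⊕ D.Src) → Quot D.graph.FaceNext → ZMod 2 :=
      fun i => Quot.lift (B i) (hB i).eq
    have hli : LinearIndependent (ZMod 2) B' := by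
      rw [Fintype.linearIndependent_iff]
      intro g hg
      have hg' : ∑ i, g i • B i = 0 := by
        have h1 : ∀ i, B i = pull (B' i) := fun i => rfl
        simp only [h1, ← map_smul, ← map_sum]
        rw [hg, map_zero]
      -- The four-corner sums vanish on the constant and on the arc indicators and are dual to the
      -- products. This removes the products, so that the jumps next isolate the arc indicators.
      have hsrc : ∀ q, g (Sum.inr (Sum.inr q)) = 0 := by
        intro q
        have h1 := congrArg (fourCorners q) hg'
        rw [map_sum, Fintype.sum_sum_type, Fintype.sum_sum_type] at h1
        simp only [map_smul, map_zero, B, Sum.elim_inl, Sum.elim_inr, fourCorners_arc _ (hcd _), hq,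
          smul_zero, Finset.sum_const_zero, zero_add] at h1
        have h2 : fourCorners q (fun _ => 1) = 0 := by
          rw [fourCorners_apply]; decide
        simpa [h2] using h1
      have hout : ∀ j, g (Sum.inr (Sum.inl j)) = 0 := by
        intro j
        have h1 := congrArg (ev (D := D) (Sum.inl j.1) + ev (D := D) (nxt (Sum.inl j.1))) hg'
        rw [map_sum, Fintype.sum_sum_type, Fintype.sum_sum_type] at h1
        simp only [map_smul, map_zero, B, Sum.elim_inl, Sum.elim_inr, LinearMap.add_apply,
          LinearMap.proj_apply, hsrc, zero_smul, Finset.sum_const_zero, add_zero, hj _ _ j.2] at h1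
        have h2 : (1 : ZMod 2) + 1 = 0 := by decide
        simpa [h2, ← Subtype.ext_iff] using h1
      rintro (u | j | q)
      · have h1 := congrFun hg' (Sum.inl i₀)
        simpa [Fintype.sum_sum_type, hout, hsrc, B] using h1
      · exact hout j
      · exact hsrc q
    exact hli.fintype_card_le_finrank

end LatticeWord

/-! ### Euler's formula and the web axioms for the diagram of a word -/

namespace LatticeWord

variable {s N : ℕ} {D : LatticeWord s N}

/-- Every proper crossing contributes a sink and a source, and the remaining sinks are the forks. -/
theorem card_snk_eq : Nat.card D.Snk =
    Nat.card D.Src + Nat.card {i : Fin N // D.letter (s + i + 1) = 1} := by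
  rw [← Nat.card_sum]
  refine (Nat.card_congr (Equiv.ofBijective (Sum.elim (fun p : D.Src => (⟨p.1, p.2.1⟩ : D.Snk))
    (fun i => ⟨(s + i.1 + 1, s + i.1 + 1), D.cr_self i.2⟩)) ⟨?_, ?_⟩)).symm
  · rintro (p | i) (q | j) h
    · simp only [Sum.elim_inl, Subtype.mk.injEq] at h
      rw [Subtype.ext h]
    · simp only [Sum.elim_inl, Sum.elim_inr, Subtype.mk.injEq] at h
      have := p.2.2
      rw [h] at this
      simp at this
    · simp only [Sum.elim_inl, Sum.elim_inr, Subtype.mk.injEq] at h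
      have := q.2.2
      rw [← h] at this
      simp at this
    · simp only [Sum.elim_inr, Subtype.mk.injEq, Prod.mk.injEq] at h
      exact congrArg Sum.inr (Subtype.ext (Fin.ext (by omega)))
  · rintro ⟨⟨u, v⟩, hp⟩
    rcases hp.1.lt_or_eq with h | h
    · exact ⟨Sum.inl ⟨(u, v), hp, h⟩, rfl⟩
    · simp only at h hp
      subst h
      have h1 : D.letter u = 1 := by
        obtain ⟨-, h | h⟩ := hp.cases
        · exact h.1
        · omega
      have h2 := (D.letter_le u).1 (by omega)
      obtain ⟨i, rfl⟩ : ∃ i : Fin N, u = s + i + 1 := ⟨⟨u - s - 1, by omega⟩, by simp only; omega⟩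
      exact ⟨Sum.inr ⟨i, h1⟩, rfl⟩

theorem card_outer : Nat.card D.Outer + Nat.card {i : Fin N // D.letter (s + i + 1) = 1} = N := by
  classical
  rw [add_comm, ← Nat.card_sum, Nat.card_congr (Equiv.sumCompl (fun i : Fin N => D.letter (s + i + 1) = 1))]
  simp

/-- The half-edges directed into their vertex. -/
def sinkHE (x : D.Snk × Fin 3) : D.HE := Sum.inr (Sum.inl x.1, x.2)

/-- The half-edges directed out of their vertex. -/
def srcHE : Fin N ⊕ (D.Src × Fin 3) → D.HE
  | Sum.inl i => Sum.inl i
  | Sum.inr x => Sum.inr (Sum.inr x.1, x.2)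

theorem srcHE_isOut (x : Fin N ⊕ (D.Src × Fin 3)) : IsOutHE (srcHE x) := by
  rcases x with i | x <;> trivial

theorem exists_srcHE {d : D.HE} (h : IsOutHE d) : ∃ x, srcHE x = d := by
  match d, h with
  | Sum.inl i, _ => exact ⟨Sum.inl i, rfl⟩
  | Sum.inr (Sum.inr p, t), _ => exact ⟨Sum.inr (p, t), rfl⟩

theorem exists_sinkHE {d : D.HE} (h : ¬ IsOutHE d) : ∃ x, sinkHE x = d := by
  match d, h with
  | Sum.inl _, h => exact (h trivial).elim
  | Sum.inr (Sum.inr _, _), h => exact (h trivial).elim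
  | Sum.inr (Sum.inl p, t), _ => exact ⟨(p, t), rfl⟩

theorem srcHE_injective : Function.Injective (srcHE (D := D)) := by
  rintro (i | x) (j | y) h
  · exact congrArg Sum.inl (Sum.inl.inj h)
  · cases h
  · cases h
  · simp only [srcHE, Sum.inr.injEq, Prod.mk.injEq] at h
    rw [Prod.ext h.1 h.2]

/-- The edges match outgoing half-edges with incoming ones. Together with the count of sinks this
shows that the letter `1` occupies a third of the positions. -/
theorem card_srcHE : N + 3 * Nat.card D.Src = 3 * Nat.card D.Snk := by
  have h1 : Nat.card (Fin N ⊕ (D.Src × Fin 3)) = N + 3 * Nat.card D.Src := by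
    rw [Nat.card_sum, Nat.card_prod]
    simp [mul_comm]
  have h2 : Nat.card (D.Snk × Fin 3) = 3 * Nat.card D.Snk := by
    rw [Nat.card_prod]
    simp [mul_comm]
  rw [← h1, ← h2]
  have hout : ∀ x : Fin N ⊕ (D.Src × Fin 3), ∃ y : D.Snk × Fin 3, Edge (srcHE x) (sinkHE y) := by
    intro x
    obtain ⟨e, he⟩ := exists_edge_out (srcHE_isOut x)
    obtain ⟨y, rfl⟩ := exists_sinkHE he.isOut_isIn.2.1
    exact ⟨y, he⟩
  choose g hg using hout
  refine Nat.card_congr (Equiv.ofBijective g ⟨fun x y hxy => ?_, fun y => ?_⟩)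
  · have h3 := hg y
    rw [← hxy] at h3
    exact srcHE_injective ((hg x).left_unique h3)
  · obtain ⟨d, hd⟩ := exists_edge_in (e := sinkHE y) (fun h => h)
    obtain ⟨x, rfl⟩ := exists_srcHE hd.isOut_isIn.1
    have := (hg x).right_unique hd
    refine ⟨x, ?_⟩
    simp only [sinkHE, Sum.inr.injEq, Prod.mk.injEq, Sum.inl.injEq] at this
    exact Prod.ext this.1 this.2

/-- Each edge has exactly one end at a sink, so incoming half-edges count the edges. -/
theorem card_edges : Nat.card (Quot D.graph.Opp) = 3 * Nat.card D.Snk := by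
  have h2 : Nat.card (D.Snk × Fin 3) = 3 * Nat.card D.Snk := by
    rw [Nat.card_prod]
    simp [mul_comm]
  rw [← h2]
  have hout : ∀ d : D.HE, ∃ y : D.Snk × Fin 3, d = sinkHE y ∨ Edge d (sinkHE y) := by
    intro d
    by_cases hd : IsOutHE d
    · obtain ⟨e, he⟩ := exists_edge_out hd
      obtain ⟨y, rfl⟩ := exists_sinkHE he.isOut_isIn.2.1
      exact ⟨y, Or.inr he⟩
    · obtain ⟨y, rfl⟩ := exists_sinkHE hd
      exact ⟨y, Or.inl rfl⟩
  choose g hg using hout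
  have hsink : ∀ y y' : D.Snk × Fin 3, sinkHE y = sinkHE y' → y = y' := by
    intro y y' this
    simp only [sinkHE, Sum.inr.injEq, Prod.mk.injEq, Sum.inl.injEq] at this
    exact Prod.ext this.1 this.2
  have hE : ∀ d e : D.HE, Edge d e → g d = g e := by
    intro d e h
    apply hsink
    rcases hg d with h1 | h1
    · exact absurd h.isOut_isIn.1 (by rw [h1]; exact fun h => h)
    · rcases hg e with h3 | h3
      · rw [← h3]; exact h1.right_unique h
      · exact (h.isOut_isIn.2.1 h3.isOut_isIn.1).elim
  have hopp : ∀ d e : D.HE, D.graph.Opp d e → g d = g e := by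
    rintro d e (h | h)
    · exact hE d e h
    · exact (hE e d h).symm
  refine Nat.card_congr (Equiv.ofBijective (Quot.lift g hopp) ⟨?_, fun y => ⟨Quot.mk _ (sinkHE y), ?_⟩⟩)
  · have hmk : ∀ d : D.HE, (Quot.mk D.graph.Opp d) = Quot.mk D.graph.Opp (sinkHE (g d) : D.HE) := by
      intro d
      rcases hg d with h | h
      · exact congrArg _ h
      · exact Quot.sound (Or.inl h)
    rintro ⟨d⟩ ⟨e⟩ h
    have h' : g d = g e := h
    have h1 := hmk d
    rw [h'] at h1
    exact h1.trans (hmk e).symm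
  · apply hsink
    rcases hg (sinkHE y) with h | h
    · exact h.symm
    · exact (show False from h.isOut_isIn.1).elim

/-- The additional `1` is the vertex to which the boundary line is shrunk. -/
theorem card_vertices (i₀ : Fin N) :
    Nat.card (Quot D.graph.Next) = 1 + (Nat.card D.Snk + Nat.card D.Src) := by
  have h2 : Nat.card (Unit ⊕ (D.Snk ⊕ D.Src)) = 1 + (Nat.card D.Snk + Nat.card D.Src) := by
    rw [Nat.card_sum, Nat.card_sum]
    simp
  rw [← h2]
  let g : D.HE → Unit ⊕ (D.Snk ⊕ D.Src) := Sum.map (fun _ => ()) Prod.fst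
  have hg : ∀ d e : D.HE, D.graph.Next d e → g d = g e := by
    intro d e h
    obtain rfl := (next_iff d e).1 h
    rcases d with i | ⟨x, t⟩ <;> rfl
  have hn : ∀ d : D.HE, Quot.mk D.graph.Next (nxt d) = Quot.mk D.graph.Next d := fun d =>
    (Quot.sound ((next_iff _ _).2 rfl)).symm
  refine Nat.card_congr (Equiv.ofBijective (Quot.lift g hg) ⟨?_, ?_⟩)
  · rintro ⟨d⟩ ⟨e⟩ h
    have h' : g d = g e := h
    rcases d with i | ⟨x, t⟩ <;> rcases e with j | ⟨y, t'⟩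
    · exact bdry_eq_of_nxt (f := fun d : D.HE => Quot.mk D.graph.Next d) hn i j
    · cases h'
    · cases h'
    · simp only [g, Sum.map_inr, Sum.inr.injEq] at h'
      subst h'
      exact (vertex_eq_of_nxt (f := fun d : D.HE => Quot.mk D.graph.Next d) hn x t).trans
        (vertex_eq_of_nxt (f := fun d : D.HE => Quot.mk D.graph.Next d) hn x t').symm
  · rintro (u | x)
    · exact ⟨Quot.mk _ (Sum.inl i₀ : D.HE), rfl⟩
    · exact ⟨Quot.mk _ (Sum.inr (x, 0) : D.HE), rfl⟩

theorem card_components (i₀ : Fin N) :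
    Nat.card (Quot fun d e => D.graph.Next d e ∨ D.graph.Opp d e) = 1 := by
  rw [Nat.card_eq_one_iff_unique]
  have key : ∀ d : D.HE, (Quot.mk (fun d e => D.graph.Next d e ∨ D.graph.Opp d e) d) =
      Quot.mk _ (Sum.inl i₀ : D.HE) := fun d =>
    eq_of_invariant (f := fun d : D.HE => Quot.mk (fun d e => D.graph.Next d e ∨ D.graph.Opp d e) d)
      (fun d => (Quot.sound (r := fun d e => D.graph.Next d e ∨ D.graph.Opp d e)
        (Or.inl ((next_iff d _).2 rfl))).symm)
      (fun d e h => Quot.sound (Or.inr (Or.inl h))) i₀ d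
  refine ⟨⟨?_⟩, ⟨Quot.mk _ (Sum.inl i₀ : D.HE)⟩⟩
  rintro ⟨d⟩ ⟨e⟩
  exact (key d).trans (key e).symm

/-- With `m` letters `1` and `x` proper crossings there are `N = 3m` positions, `x + m` sinks and
`x` sources. So `V = 1 + 2x + m`, `F = 1 + 2m + x`, `E = 3x + 3m` and `C = 1`. -/
theorem graph_isPlanar : D.graph.IsPlanar := by
  -- For the empty word there is no boundary half-edge, the shrunk vertex is not counted, and all
  -- four numbers vanish.
  rcases Nat.eq_zero_or_pos N with rfl | hN
  · have h1 : ∀ k, ¬ D.letter k ≤ 2 := by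
      intro k hk
      have := (D.letter_le k).1 hk
      omega
    have hS : IsEmpty D.Snk := ⟨fun p => by
      rcases p.2.letter_cases with h | h
      · exact h1 p.1.1 (by omega)
      · exact h1 p.1.1 (by omega)⟩
    have hS' : IsEmpty D.Src := ⟨fun p => hS.false ⟨p.1, p.2.1⟩⟩
    have : IsEmpty D.graph.HalfEdge := inferInstanceAs (IsEmpty D.HE)
    simp [BoundaryGraph.IsPlanar]
  · have i₀ : Fin N := ⟨0, hN⟩
    have h1 := D.card_vertices i₀
    have h2 := D.card_faces i₀
    have h3 := D.card_edges
    have h4 := D.card_components i₀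
    have h5 := D.card_snk_eq
    have h6 := D.card_outer
    have h7 := D.card_srcHE
    unfold BoundaryGraph.IsPlanar
    omega

theorem graph_isWeb (D : LatticeWord s N) : D.graph.IsWeb where
  finite := inferInstanceAs (Finite D.HE)
  exists_unique_opp d := by
    by_cases hd : IsOutHE (D := D) d
    · obtain ⟨e, he⟩ := exists_edge_out hd
      refine ⟨e, Or.inl he, ?_⟩
      rintro e' (h | h)
      · exact h.right_unique he
      · exact (h.isOut_isIn.2.1 hd).elim
    · obtain ⟨e, he⟩ := exists_edge_in hd
      refine ⟨e, Or.inr he, ?_⟩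
      rintro e' (h | h)
      · exact (hd h.isOut_isIn.1).elim
      · exact h.left_unique he
  bdry_injective := Sum.inl_injective
  bdry_degree_one _ := rfl
  internal_trivalent d hd := by
    match d, hd with
    | Sum.inl i, hd => exact (hd ⟨i, rfl⟩).elim
    | Sum.inr (x, t), _ =>
      have h1 : ∀ t : Fin 3, D.ccwAt x t ≠ t ∧ D.ccwAt x (D.ccwAt x (D.ccwAt x t)) = t := by
        intro t
        simp only [ccwAt]
        split_ifs <;> simp only [Equiv.coe_addRight] <;> revert t <;> decide
      constructor
      · intro h
        exact (h1 t).1 (congrArg Prod.snd (Sum.inr.inj h))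
      · exact congrArg (fun t => (Sum.inr (x, t) : D.HE)) (h1 t).2
  not_out_and_in := by
    rintro d ⟨⟨e, h⟩, ⟨e', h'⟩⟩
    exact (Edge.isOut_isIn h').2.1 (Edge.isOut_isIn h).1
  source_or_sink d := by
    have key : ∀ d : D.HE, D.graph.IsOut d ↔ IsOutHE d := fun d =>
      ⟨fun ⟨e, h⟩ => (Edge.isOut_isIn h).1, fun h => exists_edge_out h⟩
    rw [key d]
    refine (key _).trans ?_
    match d with
    | Sum.inl i => exact Iff.rfl
    | Sum.inr (Sum.inl p, t) => exact Iff.rfl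
    | Sum.inr (Sum.inr p, t) => exact Iff.rfl
  planar := graph_isPlanar

end LatticeWord

/-! ### Invariance of webs under isomorphism -/

namespace BoundaryGraph

variable {N : ℕ} {G H : BoundaryGraph N}

theorem card_quot_congr {α β : Type*} {r : α → α → Prop} {r' : β → β → Prop} (φ : α ≃ β)
    (h : ∀ a b, r a b ↔ r' (φ a) (φ b)) : Nat.card (Quot r) = Nat.card (Quot r') :=
  Nat.card_congr (Quot.congr φ h)

theorem IsWeb.congr (hH : H.IsWeb) (h : G.Equivalent H) : G.IsWeb := by
  obtain ⟨φ, h1, h2, h3⟩ := h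
  have hopp : ∀ d e, G.Opp d e ↔ H.Opp (φ d) (φ e) := fun d e => or_congr (h2 d e) (h2 e d)
  have hout : ∀ d, G.IsOut d ↔ H.IsOut (φ d) := fun d =>
    ⟨fun ⟨e, he⟩ => ⟨φ e, (h2 _ _).1 he⟩, fun ⟨e, he⟩ => ⟨φ.symm e, (h2 _ _).2 (by simpa using he)⟩⟩
  have hin : ∀ d, G.IsIn d ↔ H.IsIn (φ d) := fun d =>
    ⟨fun ⟨e, he⟩ => ⟨φ e, (h2 _ _).1 he⟩, fun ⟨e, he⟩ => ⟨φ.symm e, (h2 _ _).2 (by simpa using he)⟩⟩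
  have hr : ∀ d, d ∈ Set.range G.bdry ↔ φ d ∈ Set.range H.bdry := fun d =>
    ⟨fun ⟨i, hi⟩ => ⟨i, by rw [← h3, hi]⟩, fun ⟨i, hi⟩ => ⟨i, φ.injective (by rw [h3, hi])⟩⟩
  have hnext : ∀ d e, G.Next d e ↔ H.Next (φ d) (φ e) := fun d e => by
    unfold Next
    rw [hr, ← φ.apply_eq_iff_eq (x := e), h1]
    simp only [← h3, φ.apply_eq_iff_eq]
  have hface : ∀ d e, G.FaceNext d e ↔ H.FaceNext (φ d) (φ e) := fun d e =>
    ⟨fun ⟨d', a, b⟩ => ⟨φ d', (hopp _ _).1 a, (hnext _ _).1 b⟩,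
      fun ⟨d', a, b⟩ => ⟨φ.symm d', (hopp _ _).2 (by simpa using a), (hnext _ _).2 (by simpa using b)⟩⟩
  have := hH.finite
  refine ⟨Finite.of_equiv _ φ.symm, fun d => ?_, fun i j hij => ?_, fun i => ?_, fun d hd => ?_,
    fun d => ?_, fun d => ?_, ?_⟩
  · obtain ⟨e, he, hu⟩ := hH.exists_unique_opp (φ d)
    refine ⟨φ.symm e, (hopp _ _).2 (by simpa using he), fun e' he' => ?_⟩
    rw [← hu _ ((hopp _ _).1 he'), φ.symm_apply_apply]
  · exact hH.bdry_injective (by rw [← h3, ← h3, hij])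
  · exact φ.injective (by rw [h1, h3, hH.bdry_degree_one])
  · obtain ⟨a, b⟩ := hH.internal_trivalent (φ d) (fun h => hd ((hr d).2 h))
    exact ⟨fun h => a (by rw [← h1, h]), φ.injective (by rw [h1, h1, h1, b])⟩
  · rw [hout, hin]; exact hH.not_out_and_in _
  · rw [hout, hout, h1]; exact hH.source_or_sink _
  · unfold IsPlanar
    rw [card_quot_congr φ hnext, card_quot_congr φ hface, card_quot_congr φ hopp,
      card_quot_congr (r' := fun d e => H.Next d e ∨ H.Opp d e) φ
        fun d e => or_congr (hnext d e) (hopp d e)]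
    exact hH.planar

theorem Equivalent.symm (h : G.Equivalent H) : H.Equivalent G := by
  obtain ⟨φ, h1, h2, h3⟩ := h
  refine ⟨φ.symm, fun d => ?_, fun d e => ?_, fun i => ?_⟩
  · apply φ.injective; rw [h1]; simp
  · rw [h2]; simp
  · rw [← h3]; simp

theorem Equivalent.trans {K : BoundaryGraph N} (h : G.Equivalent H) (h' : H.Equivalent K) :
    G.Equivalent K := by
  obtain ⟨φ, h1, h2, h3⟩ := h
  obtain ⟨ψ, g1, g2, g3⟩ := h'
  exact ⟨φ.trans ψ, fun d => by simp [h1, g1], fun d e => by simp [h2, g2], fun i => by simp [h3, g3]⟩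

theorem Equivalent.rotate (h : G.Equivalent H) : G.rotate.Equivalent H.rotate := by
  obtain ⟨φ, h1, h2, h3⟩ := h
  exact ⟨φ, h1, h2, fun i => h3 _⟩

end BoundaryGraph

/-! ### The resolved `m`-diagram in terms of the height functions -/

/-- The semicircles over `[0, b]` and `[c, d]` meet at abscissa `cd / (c + d - b)`, and this is
compared for nested intervals. After multiplication by `d₂ - c₂` the difference of the two sides is
the sum of the two positive products. -/
theorem abscissa_aux {c₁ c₂ b d₁ d₂ : ℚ} (h0 : 0 < c₁) (h1 : c₁ < c₂) (h2 : c₂ < b) (h3 : b < d₂)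
    (h4 : d₂ < d₁) : c₁ * d₁ * (c₂ + d₂ - b) < c₂ * d₂ * (c₁ + d₁ - b) := by
  have e1 : 0 < (d₂ - b) * (d₂ * (c₂ - c₁) * (d₁ - c₂)) :=
    mul_pos (by linarith) (mul_pos (mul_pos (by linarith) (by linarith)) (by linarith))
  have e2 : 0 < (b - c₂) * (c₂ * (d₁ - d₂) * (d₂ - c₁)) :=
    mul_pos (by linarith) (mul_pos (mul_pos (by linarith) (by linarith)) (by linarith))
  have e3 : 0 < (c₂ * d₂ * (c₁ + d₁ - b) - c₁ * d₁ * (c₂ + d₂ - b)) * (d₂ - c₂) := by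
    linarith
  have := pos_of_mul_pos_left e3 (by linarith)
  linarith

/-- Abscissa of the intersection point of two semicircles. -/
def semicircleX (A C : ℕ × ℕ) : ℚ :=
  ((C.1 : ℚ) * C.2 - (A.1 : ℚ) * A.2) / (((C.1 : ℚ) + C.2) - ((A.1 : ℚ) + A.2))

theorem semicircleX_mem {A C : ℕ × ℕ} (h1 : A.1 < C.1) (h2 : C.1 < A.2) (h3 : A.2 < C.2) :
    (C.1 : ℚ) < semicircleX A C ∧ semicircleX A C < A.2 := by
  have h1' : (A.1 : ℚ) < C.1 := by exact_mod_cast h1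
  have h2' : (C.1 : ℚ) < A.2 := by exact_mod_cast h2
  have h3' : (A.2 : ℚ) < C.2 := by exact_mod_cast h3
  unfold semicircleX
  rw [lt_div_iff₀ (by linarith), div_lt_iff₀ (by linarith)]
  constructor
  · nlinarith [mul_pos (sub_pos.2 h1') (sub_pos.2 h2')]
  · nlinarith [mul_pos (sub_pos.2 h2') (sub_pos.2 h3')]

/-- Of two nested semicircles that leave `A` over its right end, the outer one meets `A` further
left: `abscissa_aux` with the left end of `A` moved to `0`. -/
theorem semicircleX_lt_of_right {A C C' : ℕ × ℕ} (h1 : A.1 < C.1) (h2 : C.1 < C'.1)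
    (h3 : C'.1 < A.2) (h4 : A.2 < C'.2) (h5 : C'.2 < C.2) : semicircleX A C < semicircleX A C' := by
  have h1' : (A.1 : ℚ) < C.1 := by exact_mod_cast h1
  have h2' : (C.1 : ℚ) < C'.1 := by exact_mod_cast h2
  have h3' : (C'.1 : ℚ) < A.2 := by exact_mod_cast h3
  have h4' : (A.2 : ℚ) < C'.2 := by exact_mod_cast h4
  have h5' : (C'.2 : ℚ) < C.2 := by exact_mod_cast h5
  have := abscissa_aux (sub_pos.2 h1') (sub_lt_sub_right h2' (A.1 : ℚ))
    (sub_lt_sub_right h3' (A.1 : ℚ)) (sub_lt_sub_right h4' (A.1 : ℚ)) (sub_lt_sub_right h5' (A.1 : ℚ))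
  unfold semicircleX
  rw [div_lt_div_iff₀ (by linarith) (by linarith)]
  linarith

/-- The same after a reflection that moves the right end of `A` to `0`. -/
theorem semicircleX_lt_of_left {A C C' : ℕ × ℕ} (h1 : C'.1 < C.1) (h2 : C.1 < A.1)
    (h3 : A.1 < C.2) (h4 : C.2 < C'.2) (h5 : C'.2 < A.2) : semicircleX C A < semicircleX C' A := by
  have h1' : (C'.1 : ℚ) < C.1 := by exact_mod_cast h1
  have h2' : (C.1 : ℚ) < A.1 := by exact_mod_cast h2
  have h3' : (A.1 : ℚ) < C.2 := by exact_mod_cast h3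
  have h4' : (C.2 : ℚ) < C'.2 := by exact_mod_cast h4
  have h5' : (C'.2 : ℚ) < A.2 := by exact_mod_cast h5
  have := abscissa_aux (sub_pos.2 h5') (sub_lt_sub_left h4' (A.2 : ℚ))
    (sub_lt_sub_left h3' (A.2 : ℚ)) (sub_lt_sub_left h2' (A.2 : ℚ)) (sub_lt_sub_left h1' (A.2 : ℚ))
  unfold semicircleX
  rw [div_lt_div_iff₀ (by linarith) (by linarith)]
  linarith

theorem LatticeWord.exists_eq_add {s N : ℕ} {D : LatticeWord s N} {k : ℕ} (h : D.letter k ≤ 2) :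
    ∃ a, k = s + a := by
  have := (D.letter_le k).1 h
  exact ⟨k - s, by omega⟩

/-! ### Vertices and half-edges of the diagram of a tableau in terms of its word -/

namespace StdTableau

variable {n s : ℕ}

/-- The ballot word `D` describes the rows and arcs of `T`. -/
structure Model (T : StdTableau n) (D : LatticeWord s (3 * n)) : Prop where
  arcs_iff : ∀ a b, (a, b) ∈ T.arcs ↔ IsArc D.H (s + a) (s + b) ∨ IsArc D.K (s + a) (s + b)
  row_zero : ∀ a, T.OnRow 0 a ↔ D.letter (s + a) = 0

open LatticeWord

namespace Model

variable {T : StdTableau n} {D : LatticeWord s (3 * n)} (M : T.Model D)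
include M

theorem isFork_iff (a : ℕ) : T.IsFork a ↔ D.letter (s + a) = 1 := by
  constructor
  · rintro ⟨⟨i, hi⟩, ⟨k, hk⟩⟩
    rw [M.arcs_iff] at hi hk
    rcases hi with hi | hi <;> rcases hk with hk | hk
    · exact (letter_of_arc_H hi).2
    · exact (letter_of_arc_H hi).2
    · have := letter_of_arc_K hi; have := letter_of_arc_H hk; omega
    · exact (letter_of_arc_K hk).1
  · intro h
    obtain ⟨i, hi⟩ := exists_arc_H_to h
    obtain ⟨k, hk⟩ := exists_arc_K_from h
    obtain ⟨i, rfl⟩ := D.exists_eq_add (k := i) (by have := letter_of_arc_H hi; omega)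
    obtain ⟨k, rfl⟩ := D.exists_eq_add (k := k) (by have := letter_of_arc_K hk; omega)
    exact ⟨⟨i, (M.arcs_iff _ _).2 (Or.inl hi)⟩, ⟨k, (M.arcs_iff _ _).2 (Or.inr hk)⟩⟩

/-- The two types of crossings. -/
theorem crossing_cases (x : T.Crossing) :
    (D.letter (s + x.right.1) = 1 ∧ IsArc D.H (s + x.left.1) (s + x.left.2) ∧
      IsArc D.K (s + x.right.1) (s + x.right.2)) ∨
    (D.letter (s + x.right.1) = 0 ∧ IsArc D.K (s + x.left.1) (s + x.left.2) ∧
      IsArc D.H (s + x.right.1) (s + x.right.2)) := by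
  obtain ⟨⟨a, b⟩, ⟨c, d⟩, h1, h2, h3, h4, h5⟩ := x
  simp only at *
  rw [M.arcs_iff] at h1 h2
  rcases h1 with h1 | h1 <;> rcases h2 with h2 | h2
  · have := h1.compat h2; omega
  · exact Or.inl ⟨(letter_of_arc_K h2).1, h1, h2⟩
  · exact Or.inr ⟨(letter_of_arc_H h2).1, h1, h2⟩
  · have := h1.compat h2; omega

theorem cr_crossing (x : T.Crossing) : D.Cr (s + x.right.1) (s + x.left.2) := by
  have h1 := x.h₁
  have h2 := x.h₂
  have h3 := x.h₃
  rcases M.crossing_cases x with ⟨-, hA, hB⟩ | ⟨-, hA, hB⟩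
  · exact (cr_of_arcs hA hB (by omega) (by omega) (by omega)).1
  · exact (cr_of_arcs' hB hA (by omega) (by omega) (by omega)).1

/-- The letter at the inner endpoint decides which arc is of which kind, and in its matching an
endpoint determines its partner. -/
theorem crossing_ext {x y : T.Crossing} (h1 : x.right.1 = y.right.1) (h2 : x.left.2 = y.left.2) :
    x = y := by
  have key : x.left.1 = y.left.1 ∧ x.right.2 = y.right.2 := by
    rcases M.crossing_cases x with ⟨l, hA, hB⟩ | ⟨l, hA, hB⟩ <;>
      rcases M.crossing_cases y with ⟨l', hA', hB'⟩ | ⟨l', hA', hB'⟩ <;>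
      rw [← h1] at hB' l' <;> rw [← h2] at hA'
    · have := hA.left_unique hA'; have := hB.right_unique hB'; omega
    · omega
    · omega
    · have := hA.left_unique hA'; have := hB.right_unique hB'; omega
  obtain ⟨⟨a, b⟩, ⟨c, d⟩, _, _, _, _, _⟩ := x
  obtain ⟨⟨a', b'⟩, ⟨c', d'⟩, _, _, _, _, _⟩ := y
  simp only at h1 h2 key
  obtain ⟨rfl, rfl⟩ := key
  subst h1 h2
  rfl

theorem exists_crossing {u v : ℕ} (h : D.Cr u v) (hlt : u < v) :
    ∃ x : T.Crossing, s + x.right.1 = u ∧ s + x.left.2 = v := by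
  obtain ⟨a, b, c, d, hA, hB, -, -, hh⟩ := h.exists_arcs
  have l1 := letter_of_arc_H hA
  have l2 := letter_of_arc_K hB
  obtain ⟨a, rfl⟩ := D.exists_eq_add (k := a) (by omega)
  obtain ⟨b, rfl⟩ := D.exists_eq_add (k := b) (by omega)
  obtain ⟨c, rfl⟩ := D.exists_eq_add (k := c) (by omega)
  obtain ⟨d, rfl⟩ := D.exists_eq_add (k := d) (by omega)
  have m1 := (M.arcs_iff a b).2 (Or.inl hA)
  have m2 := (M.arcs_iff c d).2 (Or.inr hB)
  rcases hh with hh | hh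
  · exact ⟨⟨(a, b), (c, d), m1, m2, by simp only; omega, by simp only; omega, by simp only; omega⟩,
      by simp only; omega, by simp only; omega⟩
  · exact ⟨⟨(c, d), (a, b), m2, m1, by simp only; omega, by simp only; omega, by simp only; omega⟩,
      by simp only; omega, by simp only; omega⟩

/-- The vertices of the resolved diagram in terms of inner endpoints. -/
def vertexFun : T.InternalVertex → D.Snk ⊕ D.Src
  | .fork a ha => Sum.inl ⟨(s + a, s + a), D.cr_self ((M.isFork_iff a).1 ha)⟩
  | .sink x => Sum.inl ⟨(s + x.right.1, s + x.left.2), M.cr_crossing x⟩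
  | .source x => Sum.inr ⟨(s + x.right.1, s + x.left.2), M.cr_crossing x, Nat.add_lt_add_left x.h₂ s⟩

theorem vertexFun_bijective : Function.Bijective M.vertexFun := by
  constructor
  · rintro (⟨a, ha⟩ | x | x) (⟨b, hb⟩ | y | y) h <;> simp only [vertexFun, Sum.inl.injEq, Sum.inr.injEq,
      Subtype.mk.injEq, Prod.mk.injEq, reduceCtorEq] at h
    · obtain rfl : a = b := by omega
      rfl
    · have := y.h₂; omega
    · have := x.h₂; omega
    · rw [M.crossing_ext (x := x) (y := y) (by omega) (by omega)]
    · rw [M.crossing_ext (x := x) (y := y) (by omega) (by omega)]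
  · rintro (⟨⟨u, v⟩, hp⟩ | ⟨⟨u, v⟩, hp, hlt⟩)
    · rcases hp.1.lt_or_eq with h | h
      · obtain ⟨x, h1, h2⟩ := M.exists_crossing hp h
        exact ⟨.sink x, by simp only [vertexFun, h1, h2]⟩
      · simp only at h hp
        subst h
        have hl : D.letter u = 1 := by
          obtain ⟨-, h | h⟩ := hp.cases
          · exact h.1
          · omega
        obtain ⟨a, rfl⟩ := D.exists_eq_add (k := u) (by omega)
        exact ⟨.fork a ((M.isFork_iff a).2 hl), rfl⟩
    · obtain ⟨x, h1, h2⟩ := M.exists_crossing hp hlt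
      exact ⟨.source x, by simp only [vertexFun, h1, h2]⟩

/-- The half-edges of the resolved diagram in terms of inner endpoints. -/
noncomputable def halfEdgeEquiv : T.WebHalfEdge ≃ D.HE :=
  Equiv.sumCongr (Equiv.refl _) (Equiv.prodShear (Equiv.ofBijective _ M.vertexFun_bijective)
    -- In the word colour `0` is always the first arc. At a fork, and at a crossing whose right arc
    -- is a second arc, the web gives number `0` to the second arc, hence the swap.
    (fun x => if D.letter (Sum.elim (fun p => p.1.1) (fun p => p.1.1) (M.vertexFun x)) = 1
      then Equiv.swap 0 1 else Equiv.refl _))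

theorem halfEdgeEquiv_ccw (d : T.web.HalfEdge) :
    M.halfEdgeEquiv (T.web.ccw d) = D.graph.ccw (M.halfEdgeEquiv d) := by
  rcases d with i | ⟨x, t⟩
  · rfl
  · refine congrArg Sum.inr (Prod.ext rfl ?_)
    change (if D.letter (Sum.elim (fun p => p.1.1) (fun p => p.1.1) (M.vertexFun x)) = 1
      then Equiv.swap 0 1 else Equiv.refl _) (finRotate 3 t) =
      (if D.letter (Sum.elim (fun p => p.1.1) (fun p => p.1.1) (M.vertexFun x)) = 1 then
      Equiv.addRight 2 else Equiv.addRight 1) ((if D.letter (Sum.elim (fun p => p.1.1)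
      (fun p => p.1.1) (M.vertexFun x)) = 1 then Equiv.swap 0 1 else Equiv.refl _) t)
    split_ifs <;> revert t <;> decide

end Model

end StdTableau

/-! ### The order of points along an arc: positions versus abscissas -/

namespace StdTableau

open LatticeWord

variable {n s : ℕ}

namespace Model

variable {T : StdTableau n} {D : LatticeWord s (3 * n)} (M : T.Model D)

theorem abscissa_eq (x : T.Crossing) : x.abscissa = semicircleX x.left x.right := rfl

theorem abscissa_mem (x : T.Crossing) : (x.right.1 : ℚ) < x.abscissa ∧ x.abscissa < x.left.2 :=
  semicircleX_mem x.h₁ x.h₂ x.h₃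

/-- A point on the arc `A` with abscissa `t`; its key `k` orders the points on `A`. -/
def PointOn (T : StdTableau n) (s : ℕ) (A : ℕ × ℕ) (k : ℕ) (t : ℚ) : Prop :=
  (k = s + A.1 ∧ t = A.1) ∨ (k = s + A.2 ∧ t = A.2) ∨
    ∃ x : T.Crossing, t = x.abscissa ∧
      ((x.left = A ∧ k = s + x.right.1) ∨ (x.right = A ∧ k = s + x.left.2))

include M

theorem rightward_iff (A : ℕ × ℕ) : T.Rightward A ↔ D.letter (s + A.1) = 0 := M.row_zero _

/-- An arc that is crossed by arcs of the matching of `f` only. -/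
def CrossedBy (T : StdTableau n) (s : ℕ) (A : ℕ × ℕ) (f : ℕ → ℤ) : Prop :=
  (∀ x : T.Crossing, x.left = A → IsArc f (s + x.right.1) (s + x.right.2)) ∧
    ∀ x : T.Crossing, x.right = A → IsArc f (s + x.left.1) (s + x.left.2)

theorem crossedBy_of_H {A : ℕ × ℕ} (hA : IsArc D.H (s + A.1) (s + A.2)) : CrossedBy T s A D.K := by
  have l := letter_of_arc_H hA
  constructor
  · rintro x rfl
    rcases M.crossing_cases x with ⟨h1, h2, h3⟩ | ⟨h1, h2, h3⟩
    · exact h3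
    · have := letter_of_arc_K h2; omega
  · rintro x rfl
    rcases M.crossing_cases x with ⟨h1, h2, h3⟩ | ⟨h1, h2, h3⟩
    · omega
    · exact h2

theorem crossedBy_of_K {A : ℕ × ℕ} (hA : IsArc D.K (s + A.1) (s + A.2)) : CrossedBy T s A D.H := by
  have l := letter_of_arc_K hA
  constructor
  · rintro x rfl
    rcases M.crossing_cases x with ⟨h1, h2, h3⟩ | ⟨h1, h2, h3⟩
    · have := letter_of_arc_H h2; omega
    · exact h3
  · rintro x rfl
    rcases M.crossing_cases x with ⟨h1, h2, h3⟩ | ⟨h1, h2, h3⟩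
    · exact h2
    · omega

-- The arcs that cross `A` belong to one matching and do not cross each other. On the same side of
-- `A` they are nested, and the semicircle inequalities apply. On opposite sides, the one over the
-- left end closes before the one over the right end opens, and these endpoints separate the
-- abscissas.
omit M in
theorem PointOn.lt_of_lt {A : ℕ × ℕ} {f : ℕ → ℤ} (hA : CrossedBy T s A f) (hlt : A.1 < A.2)
    {k k' : ℕ} {t t' : ℚ} (h : PointOn T s A k t) (h' : PointOn T s A k' t') (hk : k < k') : t < t' := by
  have hlt' : (A.1 : ℚ) < A.2 := by exact_mod_cast hlt
  have in1 : ∀ x : T.Crossing, (x.left = A ∨ x.right = A) →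
      (A.1 : ℚ) < x.abscissa ∧ x.abscissa < A.2 ∧ A.1 < x.right.1 + 1 ∧ x.left.2 < A.2 + 1 := by
    rintro x hx
    have h1 : (x.left.1 : ℚ) < x.right.1 := by exact_mod_cast x.h₁
    have h2 : (x.left.2 : ℚ) < x.right.2 := by exact_mod_cast x.h₃
    have h3 := x.h₁
    have h4 := x.h₃
    obtain ⟨h5, h6⟩ := abscissa_mem x
    rcases hx with rfl | rfl
    · exact ⟨by linarith, h6, by omega, by omega⟩
    · exact ⟨h5, by linarith, by omega, by omega⟩
  rcases h with ⟨rfl, rfl⟩ | ⟨rfl, rfl⟩ | ⟨x, rfl, hx⟩ <;>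
    rcases h' with ⟨rfl, rfl⟩ | ⟨rfl, rfl⟩ | ⟨y, rfl, hy⟩
  · omega
  · exact hlt'
  · exact (in1 y (hy.imp And.left And.left)).1
  · omega
  · omega
  · have h1 := in1 y (hy.imp And.left And.left)
    have h2 := y.h₂
    rcases hy with ⟨-, rfl⟩ | ⟨-, rfl⟩ <;> omega
  · have h1 := in1 x (hx.imp And.left And.left)
    have h2 := x.h₂
    rcases hx with ⟨-, rfl⟩ | ⟨-, rfl⟩ <;> omega
  · exact (in1 x (hx.imp And.left And.left)).2.1
  · have x1 := x.h₁
    have x2 := x.h₂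
    have x3 := x.h₃
    have y1 := y.h₁
    have y2 := y.h₂
    have y3 := y.h₃
    rw [abscissa_eq, abscissa_eq]
    rcases hx with ⟨hx, rfl⟩ | ⟨hx, rfl⟩ <;> rcases hy with ⟨hy, rfl⟩ | ⟨hy, rfl⟩
    · have := (hA.1 x hx).compat (hA.1 y hy)
      rw [hx] at x1 x2 x3 ⊢
      rw [hy] at y1 y2 y3 ⊢
      exact semicircleX_lt_of_right (by omega) (by omega) (by omega) (by omega) (by omega)
    · have := (hA.1 x hx).compat (hA.2 y hy)
      rw [hx] at x1 x2 x3
      rw [hy] at y1 y2 y3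
      omega
    · have h1 : (x.left.2 : ℚ) < y.right.1 := by
        have : x.left.2 < y.right.1 := by omega
        exact_mod_cast this
      exact (abscissa_mem x).2.trans (h1.trans (abscissa_mem y).1)
    · have := (hA.2 x hx).compat (hA.2 y hy)
      rw [hx] at x1 x2 x3 ⊢
      rw [hy] at y1 y2 y3 ⊢
      exact semicircleX_lt_of_left (by omega) (by omega) (by omega) (by omega) (by omega)

theorem PointOn.eq_of_eq {A : ℕ × ℕ} {f : ℕ → ℤ} (hA : CrossedBy T s A f) (hlt : A.1 < A.2)
    {k : ℕ} {t t' : ℚ} (h : PointOn T s A k t) (h' : PointOn T s A k t') : t = t' := by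
  have in1 : ∀ x : T.Crossing, (x.left = A ∨ x.right = A) → A.1 < x.right.1 + 1 ∧ x.left.2 < A.2 + 1 ∧
      (x.left = A → A.1 < x.right.1) ∧ (x.right = A → x.left.2 < A.2) := by
    rintro x hx
    have h3 := x.h₁
    have h4 := x.h₃
    refine ⟨?_, ?_, ?_, ?_⟩
    · rcases hx with rfl | rfl <;> omega
    · rcases hx with rfl | rfl <;> omega
    · rintro rfl; omega
    · rintro rfl; omega
  rcases h with ⟨rfl, rfl⟩ | ⟨rfl, rfl⟩ | ⟨x, rfl, hx⟩ <;>
    rcases h' with ⟨h1, rfl⟩ | ⟨h1, rfl⟩ | ⟨y, rfl, hy⟩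
  · rfl
  · omega
  · have hin := in1 y (hy.imp And.left And.left)
    have := y.h₂
    rcases hy with ⟨hy, h1⟩ | ⟨hy, h1⟩
    · have := hin.2.2.1 hy; omega
    · omega
  · omega
  · rfl
  · have hin := in1 y (hy.imp And.left And.left)
    have := y.h₂
    rcases hy with ⟨hy, h1⟩ | ⟨hy, h1⟩
    · omega
    · have := hin.2.2.2 hy; omega
  · have hin := in1 x (hx.imp And.left And.left)
    have := x.h₂
    rcases hx with ⟨hx, h1⟩ | ⟨hx, h1⟩
    · have := hin.2.2.1 hx; omega
    · omega
  · have hin := in1 x (hx.imp And.left And.left)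
    have := x.h₂
    rcases hx with ⟨hx, h1⟩ | ⟨hx, h1⟩
    · omega
    · have := hin.2.2.2 hx; omega
  · rcases hx with ⟨hx, rfl⟩ | ⟨hx, rfl⟩ <;> rcases hy with ⟨hy, h1⟩ | ⟨hy, h1⟩
    · rw [M.crossing_ext (x := x) (y := y) (by omega) (by rw [hx, hy])]
    · have := (hA.1 x hx).compat (hA.2 y hy); omega
    · have := (hA.2 x hx).compat (hA.1 y hy); omega
    · rw [M.crossing_ext (x := x) (y := y) (by rw [hx, hy]) (by omega)]

theorem PointOn.lt_iff {A : ℕ × ℕ} {f : ℕ → ℤ} (hA : CrossedBy T s A f) (hlt : A.1 < A.2)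
    {k k' : ℕ} {t t' : ℚ} (h : PointOn T s A k t) (h' : PointOn T s A k' t') : t < t' ↔ k < k' := by
  refine ⟨fun hh => ?_, h.lt_of_lt hA hlt h'⟩
  rcases lt_trichotomy k k' with hk | rfl | hk
  · exact hk
  · exact absurd (PointOn.eq_of_eq M hA hlt h h') hh.ne
  · exact absurd (h'.lt_of_lt hA hlt h hk) hh.not_gt

/-- Exactly one of the two arcs is directed to the right. In either case the first incoming corner,
`0` or `2`, lies on the right arc. -/
theorem arcAt_eq (x : T.Crossing) : x.arcAt x.firstIn = x.right ∧ x.arcAt (x.firstIn + 1) = x.left ∧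
    x.arcAt (x.firstIn + 2) = x.right ∧ x.arcAt (x.firstIn + 3) = x.left := by
  have h1 := M.rightward_iff x.left
  have h2 := M.rightward_iff x.right
  rcases M.crossing_cases x with ⟨h3, h4, h5⟩ | ⟨h3, h4, h5⟩
  · have h6 := (letter_of_arc_H h4).1
    have h7 : ¬ T.Rightward x.right := by rw [h2]; omega
    simp [StdTableau.Crossing.firstIn, h1.2 h6, h7, StdTableau.Crossing.arcAt]
  · have h6 := (letter_of_arc_K h4).1
    have h7 : ¬ T.Rightward x.left := by rw [h1]; omega
    simp [StdTableau.Crossing.firstIn, h2.2 h3, h7, StdTableau.Crossing.arcAt]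

theorem halfEdgeEquiv_sink_one (x : T.Crossing) (h : D.letter (s + x.right.1) = 1) (t : Fin 3) :
    M.halfEdgeEquiv (Sum.inr (.sink x, t)) =
      Sum.inr (Sum.inl ⟨(s + x.right.1, s + x.left.2), M.cr_crossing x⟩, Equiv.swap 0 1 t) := by
  refine congrArg Sum.inr (Prod.ext rfl ?_)
  change (if D.letter (s + x.right.1) = 1 then Equiv.swap 0 1 else Equiv.refl _) t = _
  rw [if_pos h]

theorem halfEdgeEquiv_sink_zero (x : T.Crossing) (h : D.letter (s + x.right.1) = 0) (t : Fin 3) :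
    M.halfEdgeEquiv (Sum.inr (.sink x, t)) =
      Sum.inr (Sum.inl ⟨(s + x.right.1, s + x.left.2), M.cr_crossing x⟩, t) := by
  refine congrArg Sum.inr (Prod.ext rfl ?_)
  change (if D.letter (s + x.right.1) = 1 then Equiv.swap 0 1 else Equiv.refl _) t = _
  rw [if_neg (by omega)]
  rfl

theorem halfEdgeEquiv_source_one (x : T.Crossing) (h : D.letter (s + x.right.1) = 1) (t : Fin 3) :
    M.halfEdgeEquiv (Sum.inr (.source x, t)) =
      Sum.inr (Sum.inr ⟨(s + x.right.1, s + x.left.2), M.cr_crossing x,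
        Nat.add_lt_add_left x.h₂ s⟩, Equiv.swap 0 1 t) := by
  refine congrArg Sum.inr (Prod.ext rfl ?_)
  change (if D.letter (s + x.right.1) = 1 then Equiv.swap 0 1 else Equiv.refl _) t = _
  rw [if_pos h]

theorem halfEdgeEquiv_source_zero (x : T.Crossing) (h : D.letter (s + x.right.1) = 0) (t : Fin 3) :
    M.halfEdgeEquiv (Sum.inr (.source x, t)) =
      Sum.inr (Sum.inr ⟨(s + x.right.1, s + x.left.2), M.cr_crossing x,
        Nat.add_lt_add_left x.h₂ s⟩, t) := by
  refine congrArg Sum.inr (Prod.ext rfl ?_)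
  change (if D.letter (s + x.right.1) = 1 then Equiv.swap 0 1 else Equiv.refl _) t = _
  rw [if_neg (by omega)]
  rfl

theorem halfEdgeEquiv_fork (a : ℕ) (ha : T.IsFork a) (t : Fin 3) :
    M.halfEdgeEquiv (Sum.inr (.fork a ha, t)) =
      Sum.inr (Sum.inl ⟨(s + a, s + a), D.cr_self ((M.isFork_iff a).1 ha)⟩, Equiv.swap 0 1 t) := by
  refine congrArg Sum.inr (Prod.ext rfl ?_)
  change (if D.letter (s + a) = 1 then Equiv.swap 0 1 else Equiv.refl _) t = _
  rw [if_pos ((M.isFork_iff a).1 ha)]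

theorem halfEdgeEquiv_bdry (i : Fin (3 * n)) : M.halfEdgeEquiv (Sum.inl i) = Sum.inl i := rfl

end Model

end StdTableau

/-- Between its ends an arc keeps the height at or above its level, while another arc of this level
would have to start from below it. Hence level and position recover the arc. -/
theorem IsArc.eq_of_level {f : ℕ → ℤ} {a b c d k : ℕ} (h1 : IsArc f a b) (h2 : IsArc f c d)
    (h : f a = f c) (hak : a ≤ k) (hkb : k < b) (hck : c ≤ k) (hkd : k < d) : a = c ∧ b = d := by
  have key : ∀ {a b c d : ℕ}, IsArc f a b → IsArc f c d → f a = f c → a ≤ k → k < b → c ≤ k →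
      a < c → False := by
    rintro a b c d ⟨a1, a2, a3, a4, a5⟩ ⟨c1, c2, c3, c4, c5⟩ h h1 h2 h3 h4
    have := a5 (c - 1) (by omega) (by omega)
    omega
  have hac : a = c := by
    rcases lt_trichotomy a c with hlt | hlt | hlt
    · exact (key h1 h2 h hak hkb hck hlt).elim
    · exact hlt
    · exact (key h2 h1 h.symm hck hkd hak hlt).elim
  subst hac
  exact ⟨rfl, h1.right_unique h2⟩

/-! ### The edges of the diagram of a tableau are those of its word -/

namespace StdTableau

open LatticeWord

variable {n s : ℕ}

namespace Model

variable {T : StdTableau n} {D : LatticeWord s (3 * n)} (M : T.Model D)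

theorem out1_of_outOn {A : ℕ × ℕ} (hA : IsArc D.H (s + A.1) (s + A.2)) {d : T.WebHalfEdge} {t : ℚ}
    (h : T.OutOn A d t) : ∃ k, Out1 (M.halfEdgeEquiv d) (D.H (s + A.1)) k ∧ s + A.1 ≤ k ∧
      k < s + A.2 ∧ PointOn T s A k t := by
  have hl := letter_of_arc_H hA
  have hlt := hA.lt
  rcases h with ⟨i, hi, hf⟩ | ⟨x, hx⟩ | ⟨x, hx⟩
  · have hi' : (i : ℕ) + 1 = A.1 := by
      rcases hi with hi | hi
      · exact hi
      · exact (hf ((M.isFork_iff _).2 (by rw [hi]; exact hl.2))).elim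
    refine ⟨s + A.1, ?_, le_rfl, hlt, Or.inl ⟨rfl, by rw [← hi']; push_cast; ring⟩⟩
    rw [M.halfEdgeEquiv_bdry]
    have e : s + i + 1 = s + A.1 := by omega
    exact out1_iff.2 (Or.inl ⟨i, rfl, by rw [e]; exact hl.1, by rw [e], e.symm⟩)
  · rw [(M.arcAt_eq x).2.2.1] at hx
    subst hx
    refine ⟨s + x.left.2, ?_, ?_, ?_, Or.inr (Or.inr ⟨x, rfl, Or.inr ⟨rfl, rfl⟩⟩)⟩
    · rw [M.halfEdgeEquiv_source_zero x hl.1]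
      exact out1_iff.2 (Or.inr ⟨_, rfl, by simp [lev1, hl.1], by simp [key1, hl.1]⟩)
    · have := x.h₂; omega
    · have := x.h₃; omega
  · rw [(M.arcAt_eq x).2.2.2] at hx
    subst hx
    have h1 : D.letter (s + x.right.1) = 1 := by
      rcases M.crossing_cases x with ⟨h1, -⟩ | ⟨-, h1, -⟩
      · exact h1
      · have := letter_of_arc_K h1; omega
    refine ⟨s + x.right.1, ?_, ?_, ?_, Or.inr (Or.inr ⟨x, rfl, Or.inl ⟨rfl, rfl⟩⟩)⟩
    · rw [M.halfEdgeEquiv_source_one x h1]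
      exact out1_iff.2 (Or.inr ⟨_, rfl, by simp [lev1, h1, hA.2.2.2.1], by simp [key1, h1]⟩)
    · have := x.h₁; omega
    · have := x.h₂; omega

theorem in1_of_inOn {A : ℕ × ℕ} (hA : IsArc D.H (s + A.1) (s + A.2)) {d : T.WebHalfEdge} {t : ℚ}
    (h : T.InOn A d t) : ∃ k, In1 (M.halfEdgeEquiv d) (D.H (s + A.1)) k ∧ s + A.1 < k ∧
      k ≤ s + A.2 ∧ PointOn T s A k t := by
  have hl := letter_of_arc_H hA
  have hlt := hA.lt
  rcases h with ⟨x, hx⟩ | ⟨x, hx⟩ | ⟨a, ha, hi⟩ | ⟨a, ha, hi⟩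
  · rw [(M.arcAt_eq x).1] at hx
    subst hx
    refine ⟨s + x.left.2, ?_, ?_, ?_, Or.inr (Or.inr ⟨x, rfl, Or.inr ⟨rfl, rfl⟩⟩)⟩
    · rw [M.halfEdgeEquiv_sink_zero x hl.1]
      exact in1_iff.2 ⟨_, rfl, by simp [lev1, hl.1], by simp [key1, hl.1]⟩
    · have := x.h₂; omega
    · have := x.h₃; omega
  · rw [(M.arcAt_eq x).2.1] at hx
    subst hx
    have h1 : D.letter (s + x.right.1) = 1 := by
      rcases M.crossing_cases x with ⟨h1, -⟩ | ⟨-, h1, -⟩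
      · exact h1
      · have := letter_of_arc_K h1; omega
    refine ⟨s + x.right.1, ?_, ?_, ?_, Or.inr (Or.inr ⟨x, rfl, Or.inl ⟨rfl, rfl⟩⟩)⟩
    · rw [M.halfEdgeEquiv_sink_one x h1]
      exact in1_iff.2 ⟨_, rfl, by simp [lev1, h1, hA.2.2.2.1], by simp [key1, h1]⟩
    · have := x.h₁; omega
    · have := x.h₂; omega
  · have := (M.isFork_iff a).1 ha
    rw [hi] at this
    omega
  · subst hi
    refine ⟨s + A.2, ?_, hlt, le_rfl, Or.inr (Or.inl ⟨rfl, rfl⟩)⟩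
    rw [M.halfEdgeEquiv_fork]
    exact in1_iff.2 ⟨_, rfl, by simp [lev1, hl.2, hA.2.2.2.1], by simp [key1]⟩

theorem out2_of_outOn {A : ℕ × ℕ} (hA : IsArc D.K (s + A.1) (s + A.2)) {d : T.WebHalfEdge} {t : ℚ}
    (h : T.OutOn A d t) : ∃ k, Out2 (M.halfEdgeEquiv d) (D.K (s + A.1)) k ∧ s + A.1 < k ∧
      k ≤ s + A.2 ∧ PointOn T s A k t := by
  have hl := letter_of_arc_K hA
  have hlt := hA.lt
  rcases h with ⟨i, hi, hf⟩ | ⟨x, hx⟩ | ⟨x, hx⟩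
  · have hi' : (i : ℕ) + 1 = A.2 := by
      rcases hi with hi | hi
      · exact (hf ((M.isFork_iff _).2 (by rw [hi]; exact hl.1))).elim
      · exact hi
    refine ⟨s + A.2, ?_, hlt, le_rfl, Or.inr (Or.inl ⟨rfl, by rw [← hi']; push_cast; ring⟩)⟩
    rw [M.halfEdgeEquiv_bdry]
    have e : s + i + 1 = s + A.2 := by omega
    exact out2_iff.2 (Or.inl ⟨i, rfl, by rw [e]; exact hl.2, by rw [e, hA.2.2.2.1], e.symm⟩)
  · rw [(M.arcAt_eq x).2.2.1] at hx
    subst hx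
    refine ⟨s + x.left.2, ?_, ?_, ?_, Or.inr (Or.inr ⟨x, rfl, Or.inr ⟨rfl, rfl⟩⟩)⟩
    · rw [M.halfEdgeEquiv_source_one x hl.1]
      exact out2_iff.2 (Or.inr ⟨_, rfl, by simp [lev2, hl.1], by simp [key2, hl.1]⟩)
    · have := x.h₂; omega
    · have := x.h₃; omega
  · rw [(M.arcAt_eq x).2.2.2] at hx
    subst hx
    have h1 : D.letter (s + x.right.1) = 0 := by
      rcases M.crossing_cases x with ⟨-, h1, -⟩ | ⟨h1, -⟩
      · have := letter_of_arc_H h1; omega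
      · exact h1
    refine ⟨s + x.right.1, ?_, ?_, ?_, Or.inr (Or.inr ⟨x, rfl, Or.inl ⟨rfl, rfl⟩⟩)⟩
    · rw [M.halfEdgeEquiv_source_zero x h1]
      exact out2_iff.2 (Or.inr ⟨_, rfl, by simp [lev2, h1, hA.2.2.2.1], by simp [key2, h1]⟩)
    · have := x.h₁; omega
    · have := x.h₂; omega

theorem in2_of_inOn {A : ℕ × ℕ} (hA : IsArc D.K (s + A.1) (s + A.2)) {d : T.WebHalfEdge} {t : ℚ}
    (h : T.InOn A d t) : ∃ k, In2 (M.halfEdgeEquiv d) (D.K (s + A.1)) k ∧ s + A.1 ≤ k ∧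
      k < s + A.2 ∧ PointOn T s A k t := by
  have hl := letter_of_arc_K hA
  have hlt := hA.lt
  rcases h with ⟨x, hx⟩ | ⟨x, hx⟩ | ⟨a, ha, hi⟩ | ⟨a, ha, hi⟩
  · rw [(M.arcAt_eq x).1] at hx
    subst hx
    refine ⟨s + x.left.2, ?_, ?_, ?_, Or.inr (Or.inr ⟨x, rfl, Or.inr ⟨rfl, rfl⟩⟩)⟩
    · rw [M.halfEdgeEquiv_sink_one x hl.1]
      exact in2_iff.2 ⟨_, rfl, by simp [lev2, hl.1], by simp [key2, hl.1]⟩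
    · have := x.h₂; omega
    · have := x.h₃; omega
  · rw [(M.arcAt_eq x).2.1] at hx
    subst hx
    have h1 : D.letter (s + x.right.1) = 0 := by
      rcases M.crossing_cases x with ⟨-, h1, -⟩ | ⟨h1, -⟩
      · have := letter_of_arc_H h1; omega
      · exact h1
    refine ⟨s + x.right.1, ?_, ?_, ?_, Or.inr (Or.inr ⟨x, rfl, Or.inl ⟨rfl, rfl⟩⟩)⟩
    · rw [M.halfEdgeEquiv_sink_zero x h1]
      exact in2_iff.2 ⟨_, rfl, by simp [lev2, h1, hA.2.2.2.1], by simp [key2, h1]⟩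
    · have := x.h₁; omega
    · have := x.h₂; omega
  · subst hi
    refine ⟨s + A.1, ?_, le_rfl, hlt, Or.inl ⟨rfl, rfl⟩⟩
    rw [M.halfEdgeEquiv_fork]
    exact in2_iff.2 ⟨_, rfl, by simp [lev2, hl.1], by simp [key2]⟩
  · have := (M.isFork_iff a).1 ha
    rw [hi] at this
    omega

theorem outOn_of_out1 {d : T.WebHalfEdge} {h : ℤ} {k : ℕ} (hd : Out1 (M.halfEdgeEquiv d) h k) :
    ∃ A t, IsArc D.H (s + A.1) (s + A.2) ∧ T.OutOn A d t := by
  rcases d with i | ⟨a | x | x, t⟩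
  · rw [M.halfEdgeEquiv_bdry] at hd
    obtain ⟨j, hj, hl, -⟩ | ⟨p, hj, -⟩ := out1_iff.1 hd <;> cases hj
    obtain ⟨b, hb⟩ := exists_arc_H_from hl
    obtain ⟨b, rfl⟩ := D.exists_eq_add (k := b) (by have := letter_of_arc_H hb; omega)
    refine ⟨(i + 1, b), _, hb, .boundary i (Or.inl rfl) ?_⟩
    rw [M.isFork_iff, ← add_assoc]
    omega
  · cases hd
  · cases hd
  · rcases M.crossing_cases x with ⟨h1, h2, h3⟩ | ⟨h1, h2, h3⟩
    · rw [M.halfEdgeEquiv_source_one x h1] at hd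
      obtain ⟨j, hj, -⟩ | ⟨p, hj, -⟩ := out1_iff.1 hd
      · cases hj
      · have ht : Equiv.swap 0 1 t = 0 := congrArg Prod.snd (Sum.inr.inj hj)
        obtain rfl : t = 1 := by clear hd hj; revert ht t; decide
        exact ⟨x.left, _, h2, .crossing₁ x (M.arcAt_eq x).2.2.2⟩
    · rw [M.halfEdgeEquiv_source_zero x h1] at hd
      obtain ⟨j, hj, -⟩ | ⟨p, hj, -⟩ := out1_iff.1 hd
      · cases hj
      · obtain rfl : t = 0 := congrArg Prod.snd (Sum.inr.inj hj)
        exact ⟨x.right, _, h3, .crossing₀ x (M.arcAt_eq x).2.2.1⟩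

theorem outOn_of_out2 {d : T.WebHalfEdge} {h : ℤ} {k : ℕ} (hd : Out2 (M.halfEdgeEquiv d) h k) :
    ∃ A t, IsArc D.K (s + A.1) (s + A.2) ∧ T.OutOn A d t := by
  rcases d with i | ⟨a | x | x, t⟩
  · rw [M.halfEdgeEquiv_bdry] at hd
    obtain ⟨j, hj, hl, -⟩ | ⟨p, hj, -⟩ := out2_iff.1 hd <;> cases hj
    obtain ⟨b, hb⟩ := exists_arc_K_to hl
    obtain ⟨b, rfl⟩ := D.exists_eq_add (k := b) (by have := letter_of_arc_K hb; omega)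
    refine ⟨(b, i + 1), _, hb, .boundary i (Or.inr rfl) ?_⟩
    rw [M.isFork_iff, ← add_assoc]
    omega
  · cases hd
  · cases hd
  · rcases M.crossing_cases x with ⟨h1, h2, h3⟩ | ⟨h1, h2, h3⟩
    · rw [M.halfEdgeEquiv_source_one x h1] at hd
      obtain ⟨j, hj, -⟩ | ⟨p, hj, -⟩ := out2_iff.1 hd
      · cases hj
      · have ht : Equiv.swap 0 1 t = 1 := congrArg Prod.snd (Sum.inr.inj hj)
        obtain rfl : t = 0 := by clear hd hj; revert ht t; decide
        exact ⟨x.right, _, h3, .crossing₀ x (M.arcAt_eq x).2.2.1⟩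
    · rw [M.halfEdgeEquiv_source_zero x h1] at hd
      obtain ⟨j, hj, -⟩ | ⟨p, hj, -⟩ := out2_iff.1 hd
      · cases hj
      · obtain rfl : t = 1 := congrArg Prod.snd (Sum.inr.inj hj)
        exact ⟨x.left, _, h2, .crossing₁ x (M.arcAt_eq x).2.2.2⟩

theorem inOn_of_in1 {d : T.WebHalfEdge} {h : ℤ} {k : ℕ} (hd : In1 (M.halfEdgeEquiv d) h k) :
    ∃ A t, IsArc D.H (s + A.1) (s + A.2) ∧ T.InOn A d t := by
  rcases d with i | ⟨⟨a, ha⟩ | x | x, t⟩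
  · cases hd
  · rw [M.halfEdgeEquiv_fork] at hd
    obtain ⟨p, hj, -⟩ := in1_iff.1 hd
    have ht : Equiv.swap 0 1 t = 0 := congrArg Prod.snd (Sum.inr.inj hj)
    obtain rfl : t = 1 := by clear hd hj; revert ht t; decide
    obtain ⟨b, hb⟩ := exists_arc_H_to ((M.isFork_iff a).1 ha)
    obtain ⟨b, rfl⟩ := D.exists_eq_add (k := b) (by have := letter_of_arc_H hb; omega)
    exact ⟨(b, a), _, hb, .forkLeft a ha rfl⟩
  · rcases M.crossing_cases x with ⟨h1, h2, h3⟩ | ⟨h1, h2, h3⟩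
    · rw [M.halfEdgeEquiv_sink_one x h1] at hd
      obtain ⟨p, hj, -⟩ := in1_iff.1 hd
      have ht : Equiv.swap 0 1 t = 0 := congrArg Prod.snd (Sum.inr.inj hj)
      obtain rfl : t = 1 := by clear hd hj; revert ht t; decide
      exact ⟨x.left, _, h2, .crossing₁ x (M.arcAt_eq x).2.1⟩
    · rw [M.halfEdgeEquiv_sink_zero x h1] at hd
      obtain ⟨p, hj, -⟩ := in1_iff.1 hd
      obtain rfl : t = 0 := congrArg Prod.snd (Sum.inr.inj hj)
      exact ⟨x.right, _, h3, .crossing₀ x (M.arcAt_eq x).1⟩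
  · cases hd

theorem inOn_of_in2 {d : T.WebHalfEdge} {h : ℤ} {k : ℕ} (hd : In2 (M.halfEdgeEquiv d) h k) :
    ∃ A t, IsArc D.K (s + A.1) (s + A.2) ∧ T.InOn A d t := by
  rcases d with i | ⟨⟨a, ha⟩ | x | x, t⟩
  · cases hd
  · rw [M.halfEdgeEquiv_fork] at hd
    obtain ⟨p, hj, -⟩ := in2_iff.1 hd
    have ht : Equiv.swap 0 1 t = 1 := congrArg Prod.snd (Sum.inr.inj hj)
    obtain rfl : t = 0 := by clear hd hj; revert ht t; decide
    obtain ⟨b, hb⟩ := exists_arc_K_from ((M.isFork_iff a).1 ha)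
    obtain ⟨b, rfl⟩ := D.exists_eq_add (k := b) (by have := letter_of_arc_K hb; omega)
    exact ⟨(a, b), _, hb, .forkRight a ha rfl⟩
  · rcases M.crossing_cases x with ⟨h1, h2, h3⟩ | ⟨h1, h2, h3⟩
    · rw [M.halfEdgeEquiv_sink_one x h1] at hd
      obtain ⟨p, hj, -⟩ := in2_iff.1 hd
      have ht : Equiv.swap 0 1 t = 1 := congrArg Prod.snd (Sum.inr.inj hj)
      obtain rfl : t = 0 := by clear hd hj; revert ht t; decide
      exact ⟨x.right, _, h3, .crossing₀ x (M.arcAt_eq x).1⟩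
    · rw [M.halfEdgeEquiv_sink_zero x h1] at hd
      obtain ⟨p, hj, -⟩ := in2_iff.1 hd
      obtain rfl : t = 1 := congrArg Prod.snd (Sum.inr.inj hj)
      exact ⟨x.left, _, h2, .crossing₁ x (M.arcAt_eq x).2.1⟩
  · cases hd

/-- `WebEdge` compares abscissas on one arc, `Edge` positions on one level. The translation uses
`PointOn.lt_iff` and the fact that a competing sink of the same level lies on the same arc. -/
theorem edge_of_webEdge {d e : T.WebHalfEdge} (h : T.WebEdge d e) :
    Edge (M.halfEdgeEquiv d) (M.halfEdgeEquiv e) := by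
  rcases h with ⟨i, hi⟩ | x | ⟨A, hA, hr, _, _, t, t', hd, he, hst, hcons⟩ |
    ⟨A, hA, hr, _, _, t, t', hd, he, hst, hcons⟩
  · rw [M.halfEdgeEquiv_bdry, M.halfEdgeEquiv_fork]
    exact .stem i ((M.isFork_iff _).1 hi)
  · have h2 : Equiv.swap (0 : Fin 3) 1 2 = 2 := by decide
    rcases M.crossing_cases x with ⟨h1, -⟩ | ⟨h1, -⟩
    · rw [M.halfEdgeEquiv_source_one x h1, M.halfEdgeEquiv_sink_one x h1, h2]
      exact .new ⟨(s + x.right.1, s + x.left.2), _⟩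
    · rw [M.halfEdgeEquiv_source_zero x h1, M.halfEdgeEquiv_sink_zero x h1]
      exact .new ⟨(s + x.right.1, s + x.left.2), _⟩
  · have hA' : IsArc D.H (s + A.1) (s + A.2) := by
      rcases (M.arcs_iff A.1 A.2).1 hA with h | h
      · exact h
      · have h1 := letter_of_arc_K h
        have h2 := (M.rightward_iff A).1 hr
        omega
    have hX := M.crossedBy_of_H hA'
    have hlt : A.1 < A.2 := by have := hA'.lt; omega
    obtain ⟨k, k1, k2, k3, k4⟩ := M.out1_of_outOn hA' hd
    obtain ⟨k', l1, l2, l3, l4⟩ := M.in1_of_inOn hA' he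
    refine .first _ _ _ k k' k1 l1 ((k4.lt_iff M hX hlt l4).1 hst) fun e' j hj hkj => ?_
    by_contra hjk
    obtain ⟨e', rfl⟩ := M.halfEdgeEquiv.surjective e'
    obtain ⟨A', t₁, a1, a2⟩ := M.inOn_of_in1 hj
    obtain ⟨j', j1, j2, j3, j4⟩ := M.in1_of_inOn a1 a2
    obtain ⟨hh, rfl⟩ := hj.inj j1
    -- The position `j` may be the right end of an arc, so `j - 1` is the position that both arcs
    -- cover.
    have hAA := hA'.eq_of_level a1 hh (k := j - 1) (by omega) (by omega) (by omega) (by omega)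
    obtain rfl : A = A' := Prod.ext (by omega) (by omega)
    have h1 := hcons e' t₁ a2 ((k4.lt_iff M hX hlt j4).2 hkj)
    exact hjk (not_lt.1 fun h => (not_lt.2 h1) ((j4.lt_iff M hX hlt l4).2 h))
  · have hA' : IsArc D.K (s + A.1) (s + A.2) := by
      rcases (M.arcs_iff A.1 A.2).1 hA with h | h
      · exact (hr ((M.rightward_iff A).2 (letter_of_arc_H h).1)).elim
      · exact h
    have hX := M.crossedBy_of_K hA'
    have hlt : A.1 < A.2 := by have := hA'.lt; omega
    obtain ⟨k, k1, k2, k3, k4⟩ := M.out2_of_outOn hA' hd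
    obtain ⟨k', l1, l2, l3, l4⟩ := M.in2_of_inOn hA' he
    refine .second _ _ _ k k' k1 l1 ((l4.lt_iff M hX hlt k4).1 hst) fun e' j hj hkj => ?_
    by_contra hjk
    obtain ⟨e', rfl⟩ := M.halfEdgeEquiv.surjective e'
    obtain ⟨A', t₁, a1, a2⟩ := M.inOn_of_in2 hj
    obtain ⟨j', j1, j2, j3, j4⟩ := M.in2_of_inOn a1 a2
    obtain ⟨hh, rfl⟩ := hj.inj j1
    have hAA := hA'.eq_of_level a1 hh (k := j) (by omega) (by omega) (by omega) (by omega)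
    obtain rfl : A = A' := Prod.ext (by omega) (by omega)
    have h1 := hcons e' t₁ a2 ((j4.lt_iff M hX hlt k4).2 hkj)
    exact hjk (not_lt.1 fun h => (not_lt.2 h1) ((l4.lt_iff M hX hlt j4).2 h))

theorem webEdge_of_edge {d e : T.WebHalfEdge} (h : Edge (M.halfEdgeEquiv d) (M.halfEdgeEquiv e)) :
    T.WebEdge d e := by
  obtain ⟨i, hi, hd, he⟩ | ⟨⟨⟨u, v⟩, hp, hlt⟩, hd, he⟩ | ⟨h, k, k', h1, h2, h3, h4⟩ |
    ⟨h, k, k', h1, h2, h3, h4⟩ := edge_iff.1 h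
  · have hf : T.IsFork (i + 1) := (M.isFork_iff _).2 hi
    -- Once `d` is known, uniqueness of partners in the word identifies `e`.
    have h1 := M.edge_of_webEdge (.stem i hf)
    obtain rfl : d = Sum.inl i := M.halfEdgeEquiv.injective hd
    obtain rfl : e = _ := M.halfEdgeEquiv.injective (h.right_unique h1)
    exact .stem i hf
  · obtain ⟨x, rfl, rfl⟩ := M.exists_crossing hp hlt
    have h1 := M.edge_of_webEdge (.new x)
    have h2 : M.halfEdgeEquiv (Sum.inr (.source x, 2)) = M.halfEdgeEquiv d := by
      rw [hd]
      rcases M.crossing_cases x with ⟨h1, -⟩ | ⟨h1, -⟩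
      · rw [M.halfEdgeEquiv_source_one x h1]
        have h2 : Equiv.swap (0 : Fin 3) 1 2 = 2 := by decide
        rw [h2]
      · rw [M.halfEdgeEquiv_source_zero x h1]
    obtain rfl := M.halfEdgeEquiv.injective h2
    obtain rfl : e = _ := M.halfEdgeEquiv.injective (h.right_unique h1)
    exact .new x
  · obtain ⟨A, t, hA, hd⟩ := M.outOn_of_out1 h1
    obtain ⟨A', t', hA', he⟩ := M.inOn_of_in1 h2
    obtain ⟨k₁, k1, k2, k3, k4⟩ := M.out1_of_outOn hA hd
    obtain ⟨k₂, l1, l2, l3, l4⟩ := M.in1_of_inOn hA' he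
    obtain ⟨hh, rfl⟩ := h1.inj k1
    obtain ⟨hh', rfl⟩ := h2.inj l1
    have hl := letter_of_arc_H hA
    -- The fork at the right end of `A` is a candidate for the next sink, so `k'` does not lie
    -- beyond `A`.
    have h5 := h4 _ (s + A.2) (in1_iff.2 ⟨⟨(s + A.2, s + A.2), D.cr_self hl.2⟩, rfl,
      by simp [lev1, hl.2, hA.2.2.2.1, hh], by simp [key1]⟩) k3
    have hAA := hA.eq_of_level hA' (hh.symm.trans hh') (k := k' - 1) (by omega) (by omega) (by omega)
      (by omega)
    obtain rfl : A = A' := Prod.ext (by omega) (by omega)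
    have hX := M.crossedBy_of_H hA
    have hlt : A.1 < A.2 := by have := hA.lt; omega
    refine .rightward A ((M.arcs_iff A.1 A.2).2 (Or.inl hA)) ((M.rightward_iff A).2 hl.1) d e t t'
      hd he ((k4.lt_iff M hX hlt l4).2 h3) fun e' t₁ he' ht => ?_
    obtain ⟨j, j1, j2, j3, j4⟩ := M.in1_of_inOn hA he'
    have h6 := h4 _ j (hh ▸ j1) ((k4.lt_iff M hX hlt j4).1 ht)
    exact not_lt.1 fun hc => (not_lt.2 h6) ((j4.lt_iff M hX hlt l4).1 hc)
  · obtain ⟨A, t, hA, hd⟩ := M.outOn_of_out2 h1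
    obtain ⟨A', t', hA', he⟩ := M.inOn_of_in2 h2
    obtain ⟨k₁, k1, k2, k3, k4⟩ := M.out2_of_outOn hA hd
    obtain ⟨k₂, l1, l2, l3, l4⟩ := M.in2_of_inOn hA' he
    obtain ⟨hh, rfl⟩ := h1.inj k1
    obtain ⟨hh', rfl⟩ := h2.inj l1
    have hl := letter_of_arc_K hA
    have h5 := h4 _ (s + A.1) (in2_iff.2 ⟨⟨(s + A.1, s + A.1), D.cr_self hl.1⟩, rfl,
      by simp [lev2, hl.1, hh], by simp [key2]⟩) k2
    have hAA := hA.eq_of_level hA' (hh.symm.trans hh') (k := k') (by omega) (by omega) (by omega)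
      (by omega)
    obtain rfl : A = A' := Prod.ext (by omega) (by omega)
    have hX := M.crossedBy_of_K hA
    have hlt : A.1 < A.2 := by have := hA.lt; omega
    refine .leftward A ((M.arcs_iff A.1 A.2).2 (Or.inr hA)) (fun hr => ?_) d e t t'
      hd he ((l4.lt_iff M hX hlt k4).2 h3) fun e' t₁ he' ht => ?_
    · have := (M.rightward_iff A).1 hr
      omega
    · obtain ⟨j, j1, j2, j3, j4⟩ := M.in2_of_inOn hA he'
      have h6 := h4 _ j (hh ▸ j1) ((j4.lt_iff M hX hlt k4).1 ht)
      exact not_lt.1 fun hc => (not_lt.2 h6) ((l4.lt_iff M hX hlt j4).1 hc)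

include M in
/-- The web of a tableau is determined by the height functions of its word. -/
theorem web_equivalent : T.web.Equivalent D.graph :=
  ⟨M.halfEdgeEquiv, M.halfEdgeEquiv_ccw, fun _ _ => ⟨M.edge_of_webEdge, M.webEdge_of_edge⟩,
    fun _ => rfl⟩

end Model

end StdTableau

/-! ### The ballot word of a tableau -/

theorem isArc_shift {f : ℕ → ℤ} {s a b : ℕ} :
    IsArc (fun k => f (k - s)) (s + a) (s + b) ↔ IsArc f a b := by
  constructor
  · rintro ⟨h1, h2, h3, h4, h5⟩
    simp only [Nat.add_sub_cancel_left] at h2 h4 h5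
    -- For `a = 0` the truncated subtraction would turn the up-step into `f 0 = f 0 + 1`.
    have ha : 1 ≤ a := by
      by_contra hc
      obtain rfl : a = 0 := by omega
      rw [show s + 0 - 1 - s = 0 by omega] at h2
      omega
    rw [show s + a - 1 - s = a - 1 by omega] at h2
    refine ⟨ha, h2, by omega, h4, fun j j1 j2 => ?_⟩
    have := h5 (s + j) (by omega) (by omega)
    rwa [Nat.add_sub_cancel_left] at this
  · rintro ⟨h1, h2, h3, h4, h5⟩
    refine ⟨by omega, ?_, by omega, ?_, fun j j1 j2 => ?_⟩ <;> simp only [Nat.add_sub_cancel_left]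
    · rw [show s + a - 1 - s = a - 1 by omega]
      exact h2
    · exact h4
    · exact h5 _ (by omega) (by omega)

namespace StdTableau

variable {n : ℕ} (T : StdTableau n)

theorem onRow_range {r k : ℕ} (h : T.OnRow r k) : r < 3 ∧ 1 ≤ k ∧ k ≤ 3 * n := by
  obtain ⟨hr, c, rfl⟩ := h
  exact ⟨hr, T.bijOn.mapsTo (Set.mem_univ ((⟨r, hr⟩ : Fin 3), c))⟩

theorem exists_onRow {k : ℕ} (h1 : 1 ≤ k) (h2 : k ≤ 3 * n) : ∃ r, T.OnRow r k := by
  obtain ⟨⟨r, c⟩, -, h⟩ := T.bijOn.surjOn (show k ∈ Set.Icc 1 (3 * n) from ⟨h1, h2⟩)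
  exact ⟨r, r.2, c, h⟩

theorem entry_inj {r r' : Fin 3} {c c' : Fin n} (h : T.entry r c = T.entry r' c') :
    r = r' ∧ c = c' := by
  simpa using T.bijOn.injOn (Set.mem_univ (r, c)) (Set.mem_univ (r', c')) h

theorem onRow_unique {r r' k : ℕ} (h : T.OnRow r k) (h' : T.OnRow r' k) : r = r' := by
  obtain ⟨hr, c, h1⟩ := h
  obtain ⟨hr', c', h2⟩ := h'
  exact congrArg Fin.val (T.entry_inj (h1.trans h2.symm)).1

/-- The number of entries at most `k` in a row. -/
def count (r : Fin 3) (k : ℕ) : ℕ := (Finset.univ.filter fun c => T.entry r c ≤ k).card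

/-- Rows increase, so the entries at most `k` fill an initial segment of columns. -/
theorem lt_count_iff (r : Fin 3) (k : ℕ) (c : Fin n) : (c : ℕ) < T.count r k ↔ T.entry r c ≤ k := by
  constructor
  · intro h
    by_contra hc
    have : (Finset.univ.filter fun c => T.entry r c ≤ k) ⊆ Finset.Iio c := by
      intro c' hc'
      simp only [Finset.mem_filter, Finset.mem_univ, true_and, Finset.mem_Iio] at hc' ⊢
      exact (T.row_lt r).lt_iff_lt.1 (by omega)
    have := Finset.card_le_card this
    rw [Fin.card_Iio] at this
    rw [count] at h
    omega
  · intro h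
    have : Finset.Iic c ⊆ (Finset.univ.filter fun c => T.entry r c ≤ k) := by
      intro c' hc'
      simp only [Finset.mem_filter, Finset.mem_univ, true_and, Finset.mem_Iic] at hc' ⊢
      exact ((T.row_lt r).monotone hc').trans h
    have := Finset.card_le_card this
    rw [Fin.card_Iic] at this
    rw [count]
    omega

theorem count_le (r : Fin 3) (k : ℕ) : T.count r k ≤ n :=
  (Finset.card_le_univ _).trans (Fintype.card_fin n).le

theorem count_zero (r : Fin 3) : T.count r 0 = 0 := by
  rw [count, Finset.card_eq_zero, Finset.filter_eq_empty_iff]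
  intro c _
  have : 1 ≤ T.entry r c := (T.onRow_range ⟨r.2, c, rfl⟩).2.1
  omega

theorem count_last (r : Fin 3) : T.count r (3 * n) = n := by
  rw [count, Finset.filter_true_of_mem, Finset.card_univ, Fintype.card_fin]
  intro c _
  have := T.onRow_range ⟨r.2, c, rfl⟩
  exact this.2.2

theorem count_succ (r : Fin 3) (k : ℕ) : (T.OnRow r (k + 1) ∧ T.count r (k + 1) = T.count r k + 1) ∨
    (¬ T.OnRow r (k + 1) ∧ T.count r (k + 1) = T.count r k) := by
  by_cases h : T.OnRow r (k + 1)
  · left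
    refine ⟨h, ?_⟩
    obtain ⟨hr, c, hc⟩ := h
    rw [count, count, ← Finset.card_insert_of_notMem (a := c)]
    · congr 1
      ext c'
      simp only [Finset.mem_filter, Finset.mem_univ, true_and, Finset.mem_insert]
      constructor
      · intro h1
        rcases h1.lt_or_eq with h2 | h2
        · exact Or.inr (by omega)
        · exact Or.inl (T.entry_inj (h2.trans hc.symm)).2
      · rintro (rfl | h1)
        · exact hc.le
        · omega
    · simp only [Finset.mem_filter, Finset.mem_univ, true_and]
      change T.entry r c = k + 1 at hc
      omega
  · right
    refine ⟨h, ?_⟩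
    rw [count, count]
    congr 1
    ext c
    simp only [Finset.mem_filter, Finset.mem_univ, true_and]
    have : T.entry r c ≠ k + 1 := fun hc => h ⟨r.2, c, hc⟩
    omega

theorem count_anti {r r' : Fin 3} (h : r ≤ r') (k : ℕ) : T.count r' k ≤ T.count r k := by
  refine Finset.card_le_card fun c hc => ?_
  simp only [Finset.mem_filter, Finset.mem_univ, true_and] at hc ⊢
  exact ((T.col_lt c).monotone h).trans hc

open Classical in
/-- The row of a number. -/
noncomputable def rowOf (k : ℕ) : ℕ :=
  if T.OnRow 0 k then 0 else if T.OnRow 1 k then 1 else if T.OnRow 2 k then 2 else 3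

theorem rowOf_eq_iff {r k : ℕ} (hr : r ≤ 2) : T.rowOf k = r ↔ T.OnRow r k := by
  unfold rowOf
  split_ifs with h0 h1 h2
  · exact ⟨fun h => h ▸ h0, fun h => T.onRow_unique h0 h⟩
  · exact ⟨fun h => h ▸ h1, fun h => T.onRow_unique h1 h⟩
  · exact ⟨fun h => h ▸ h2, fun h => T.onRow_unique h2 h⟩
  · refine ⟨fun h => by omega, fun h => ?_⟩
    interval_cases r <;> contradiction

theorem rowOf_le_iff (k : ℕ) : T.rowOf k ≤ 2 ↔ 1 ≤ k ∧ k ≤ 3 * n := by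
  constructor
  · intro h
    exact (T.onRow_range ((T.rowOf_eq_iff h).1 rfl)).2
  · rintro ⟨h1, h2⟩
    obtain ⟨r, hr⟩ := T.exists_onRow h1 h2
    have := T.onRow_range hr
    rw [(T.rowOf_eq_iff (by omega)).2 hr]
    omega

theorem count_step (k : ℕ) (r : Fin 3) : T.count r (k + 1) = T.count r k + if T.rowOf (k + 1) = r then 1 else 0 := by
  have h := T.rowOf_eq_iff (r := r) (k := k + 1) (by omega)
  rcases T.count_succ r k with ⟨h1, h2⟩ | ⟨h1, h2⟩
  · rw [if_pos (h.2 h1), h2]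
  · rw [if_neg (fun hc => h1 (h.1 hc)), h2, add_zero]

/-- The ballot word of a tableau, on the positions `s + 1, …, s + 3 * n`. -/
noncomputable def word (s : ℕ) : LatticeWord s (3 * n) where
  letter k := T.rowOf (k - s)
  H k := (T.count 0 (k - s) : ℤ) - T.count 1 (k - s)
  K k := (T.count 1 (k - s) : ℤ) - T.count 2 (k - s)
  letter_le k := by
    rw [T.rowOf_le_iff]
    omega
  H_start := by simp [count_zero]
  K_start := by simp [count_zero]
  H_end := by simp [count_last]
  K_end := by simp [count_last]
  H_nonneg k := by have := T.count_anti (show (0 : Fin 3) ≤ 1 by decide) (k - s); omega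
  K_nonneg k := by have := T.count_anti (show (1 : Fin 3) ≤ 2 by decide) (k - s); omega
  bot k h := by
    have hk := (T.rowOf_le_iff (k + 1 - s)).1 (by omega)
    rw [show k + 1 - s = k - s + 1 by omega] at h ⊢
    simp only [count_step, h]
    simp
    omega
  mid k h := by
    have hk := (T.rowOf_le_iff (k + 1 - s)).1 (by omega)
    rw [show k + 1 - s = k - s + 1 by omega] at h ⊢
    simp only [count_step, h]
    simp
    omega
  top k h := by
    have hk := (T.rowOf_le_iff (k + 1 - s)).1 (by omega)
    rw [show k + 1 - s = k - s + 1 by omega] at h ⊢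
    simp only [count_step, h]
    simp
    omega
  out k h := by
    rcases Nat.lt_or_ge k s with hk | hk
    · rw [show k + 1 - s = 0 by omega, show k - s = 0 by omega]
      exact ⟨rfl, rfl⟩
    · rw [show k + 1 - s = k - s + 1 by omega] at h ⊢
      have h0 : T.rowOf (k - s + 1) ≠ 0 := by omega
      have h1 : T.rowOf (k - s + 1) ≠ 1 := by omega
      have h2 : T.rowOf (k - s + 1) ≠ 2 := by omega
      simp only [count_step]
      simp [h0, h1, h2]

open LatticeWord

/-- Why the greedy rule is the noncrossing matching: any up-step between `a` and its partner `i + 1`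
has its own partner before `i + 1`, since arcs do not cross. It is therefore already taken, and `a`
is the largest free candidate. -/
theorem isGreatest_iff {f : ℕ → ℤ} (hf : SmallSteps f) {lo hi : ℕ → Prop} {i : ℕ} {S : Set (ℕ × ℕ)}
    (harc : ∀ a b, IsArc f a b → lo a ∧ hi b) (hlo : ∀ a, lo a → 1 ≤ a ∧ f a = f (a - 1) + 1)
    (hto : ∃ a, IsArc f a (i + 1)) (hS : ∀ a b, hi b → ((a, b) ∈ S ↔ b ≤ i ∧ IsArc f a b)) (a : ℕ) :
    IsGreatest {k | lo k ∧ k < i + 1 ∧ ∀ i', hi i' → (k, i') ∉ S} a ↔ IsArc f a (i + 1) := by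
  have key : ∀ a, IsArc f a (i + 1) →
      IsGreatest {k | lo k ∧ k < i + 1 ∧ ∀ i', hi i' → (k, i') ∉ S} a := by
    intro a ha
    refine ⟨⟨(harc _ _ ha).1, ha.lt, fun i' hi' hm => ?_⟩, fun k ⟨hk, hki, hkS⟩ => ?_⟩
    · obtain ⟨h1, h2⟩ := (hS _ _ hi').1 hm
      have := h2.right_unique ha
      omega
    · by_contra hka
      obtain ⟨k1, k2⟩ := hlo k hk
      have h3 := ha.2.2.2.2 (k - 1) (by omega) (by omega)
      have h4 := ha.2.2.2.1
      obtain ⟨b, hb⟩ := hf.exists_arc_of_rise (a := k) (e := i + 1) (by omega) (by omega) k1 k2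
      have := ha.not_cross hb (by omega) hki
      exact hkS b (harc _ _ hb).2 ((hS _ _ (harc _ _ hb).2).2 ⟨by omega, hb⟩)
  refine ⟨fun h => ?_, key a⟩
  obtain ⟨a', ha'⟩ := hto
  rwa [h.unique (key a' ha')]

theorem mem_arcsUpTo_iff (i a b : ℕ) : (a, b) ∈ T.arcsUpTo i ↔
    b ≤ i ∧ (IsArc (T.word 0).H a b ∨ IsArc (T.word 0).K a b) := by
  have hl : ∀ {r k : ℕ}, r ≤ 2 → ((T.word 0).letter k = r ↔ T.OnRow r k) := fun hr => T.rowOf_eq_iff hr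
  have hl0 : ∀ {k : ℕ}, (T.word 0).letter k = 0 ↔ T.OnRow 0 k := hl (by omega)
  have hl1 : ∀ {k : ℕ}, (T.word 0).letter k = 1 ↔ T.OnRow 1 k := hl (by omega)
  have hl2 : ∀ {k : ℕ}, (T.word 0).letter k = 2 ↔ T.OnRow 2 k := hl (by omega)
  induction i generalizing a b with
  | zero =>
    refine ⟨fun h => h.elim, fun ⟨h1, h2⟩ => ?_⟩
    have : a < b := h2.elim IsArc.lt IsArc.lt
    omega
  | succ i ih =>
    have g1 (h : T.OnRow 1 (i + 1)) (a : ℕ) := isGreatest_iff (T.word 0).smallSteps_H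
      (lo := T.OnRow 0) (hi := T.OnRow 1) (i := i) (S := T.arcsUpTo i)
      (fun a b h => by have := letter_of_arc_H h; rwa [hl0, hl1] at this)
      (fun a h => by have := (T.word 0).letter_zero (hl0.2 h); exact ⟨this.1, this.2.1⟩)
      (exists_arc_H_to (hl1.2 h))
      (fun a b hb => by
        refine (ih a b).trans (and_congr_right fun _ => or_iff_left fun hc => ?_)
        have := letter_of_arc_K hc
        rw [← hl1] at hb
        omega) a
    have g2 (h : T.OnRow 2 (i + 1)) (a : ℕ) := isGreatest_iff (T.word 0).smallSteps_K
      (lo := T.OnRow 1) (hi := T.OnRow 2) (i := i) (S := T.arcsUpTo i)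
      (fun a b h => by have := letter_of_arc_K h; rwa [hl1, hl2] at this)
      (fun a h => by have := (T.word 0).letter_one (hl1.2 h); exact ⟨this.1, this.2.2⟩)
      (exists_arc_K_to (hl2.2 h))
      (fun a b hb => by
        refine (ih a b).trans (and_congr_right fun _ => or_iff_right fun hc => ?_)
        have := letter_of_arc_H hc
        rw [← hl2] at hb
        omega) a
    rw [arcsUpTo, Set.mem_union]
    refine (or_congr (ih a b) Iff.rfl).trans ?_
    constructor
    · rintro (⟨h1, h2⟩ | ⟨rfl, r, h1, h2⟩)
      · exact ⟨by omega, h2⟩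
      · refine ⟨le_rfl, ?_⟩
        have := T.onRow_range h1
        obtain rfl | rfl : r = 0 ∨ r = 1 := by omega
        · exact Or.inl ((g1 h1 a).1 h2)
        · exact Or.inr ((g2 h1 a).1 h2)
    · rintro ⟨h1, h2⟩
      rcases h1.lt_or_eq with h3 | rfl
      · exact Or.inl ⟨by omega, h2⟩
      · right
        rcases h2 with h2 | h2
        · have h4 := hl1.1 (letter_of_arc_H h2).2
          exact ⟨rfl, 0, h4, (g1 h4 a).2 h2⟩
        · have h4 := hl2.1 (letter_of_arc_K h2).2
          exact ⟨rfl, 1, h4, (g2 h4 a).2 h2⟩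

theorem model_word (s : ℕ) : T.Model (T.word s) where
  arcs_iff a b := by
    rw [arcs, mem_arcsUpTo_iff]
    have h1 : IsArc (T.word s).H (s + a) (s + b) ↔ IsArc (T.word 0).H a b :=
      isArc_shift (f := (T.word 0).H)
    have h2 : IsArc (T.word s).K (s + a) (s + b) ↔ IsArc (T.word 0).K a b :=
      isArc_shift (f := (T.word 0).K)
    rw [h1, h2]
    refine and_iff_right_of_imp fun h => ?_
    have := arc_range h
    omega
  row_zero a := by
    change _ ↔ T.rowOf (s + a - s) = 0
    rw [Nat.add_sub_cancel_left, T.rowOf_eq_iff (by omega)]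

end StdTableau

/-! ### The path of the empty box -/

namespace JeuDeTaquin

theorem move_apply (s : State) {p : ℕ × ℕ} (q : ℕ × ℕ) :
    (move s p).1 q = if q = p then ⊤ else if q = s.2 then s.1 p else s.1 q := by
  simp only [move, Function.update_apply]

/-- The empty box is in the bottom row. -/
structure InBottom (F : ℕ × ℕ → ℕ∞) (s : State) (j : ℕ) : Prop where
  hole : s.2 = (0, j)
  row0 : ∀ c, s.1 (0, c) = if c < j then F (0, c + 1) else if c = j then ⊤ else F (0, c)
  rest : ∀ r c, 1 ≤ r → s.1 (r, c) = F (r, c)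
  cond0 : ∀ c < j, F (0, c + 1) < F (1, c)

/-- The empty box is in the middle row. -/
structure InMiddle (F : ℕ × ℕ → ℕ∞) (s : State) (j k : ℕ) : Prop where
  hole : s.2 = (1, k)
  le : j ≤ k
  row0 : ∀ c, s.1 (0, c) = if c < j then F (0, c + 1) else if c = j then F (1, c) else F (0, c)
  row1 : ∀ c, s.1 (1, c) = if c < j then F (1, c) else if c < k then F (1, c + 1) else
    if c = k then ⊤ else F (1, c)
  rest : ∀ r c, 2 ≤ r → s.1 (r, c) = F (r, c)
  cond0 : ∀ c < j, F (0, c + 1) < F (1, c)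
  turn0 : F (1, j) < F (0, j + 1)
  cond1 : ∀ c, j ≤ c → c < k → F (1, c + 1) < F (2, c)

/-- The empty box is in the top row. -/
structure InTop (F : ℕ × ℕ → ℕ∞) (s : State) (j k l : ℕ) : Prop where
  hole : s.2 = (2, l)
  le : j ≤ k
  le' : k ≤ l
  row0 : ∀ c, s.1 (0, c) = if c < j then F (0, c + 1) else if c = j then F (1, c) else F (0, c)
  row1 : ∀ c, s.1 (1, c) = if c < j then F (1, c) else if c < k then F (1, c + 1) else
    if c = k then F (2, c) else F (1, c)
  row2 : ∀ c, s.1 (2, c) = if c < k then F (2, c) else if c < l then F (2, c + 1) else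
    if c = l then ⊤ else F (2, c)
  rest : ∀ r c, 3 ≤ r → s.1 (r, c) = F (r, c)
  cond0 : ∀ c < j, F (0, c + 1) < F (1, c)
  turn0 : F (1, j) < F (0, j + 1)
  cond1 : ∀ c, j ≤ c → c < k → F (1, c + 1) < F (2, c)
  turn1 : F (2, k) < F (1, k + 1)

/-- The shape of the path of the empty box. -/
def OnPath (F : ℕ × ℕ → ℕ∞) (s : State) : Prop :=
  (∃ j, InBottom F s j) ∨ (∃ j k, InMiddle F s j k) ∨ ∃ j k l, InTop F s j k l

variable {F : ℕ × ℕ → ℕ∞} {s : State}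

/-- Above and to the right of the empty box the entries are still the original ones. A slide thus
compares two original entries, and the outcome is the next recorded inequality. -/
theorem InBottom.slide {j : ℕ} (h : InBottom F s j) : OnPath F (slide s) := by
  unfold JeuDeTaquin.slide
  obtain ⟨g, p⟩ := s
  obtain rfl : p = (0, j) := h.hole
  have h0 := h.row0
  have h1 := h.rest
  have h2 := h.cond0
  simp only at h0 h1
  have e1 : g (0 + 1, j) = F (1, j) := h1 _ _ le_rfl
  have e2 : g (0, j + 1) = F (0, j + 1) := by rw [h0, if_neg (by omega), if_neg (by omega)]
  simp only [e1, e2]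
  split_ifs with c1 c2
  · refine Or.inr (Or.inl ⟨j, j, rfl, le_rfl, fun c => ?_, fun c => ?_, fun r c hr => ?_, h2, c1,
      fun c c1 c2 => by omega⟩)
    · rw [move_apply]
      grind
    · rw [move_apply]
      grind
    · rw [move_apply]
      grind
  · refine Or.inl ⟨j + 1, rfl, fun c => ?_, fun r c hr => ?_, fun c hc => ?_⟩
    · rw [move_apply]
      grind
    · rw [move_apply]
      grind
    · rcases Nat.lt_or_ge c j with h | h
      · exact h2 c h
      · obtain rfl : c = j := by omega
        exact c2
  · exact Or.inl ⟨j, h⟩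

theorem InMiddle.slide {j k : ℕ} (h : InMiddle F s j k) : OnPath F (slide s) := by
  unfold JeuDeTaquin.slide
  obtain ⟨g, p⟩ := s
  obtain rfl : p = (1, k) := h.hole
  have hle := h.le
  have h0 := h.row0
  have h1 := h.row1
  have h2 := h.rest
  simp only at h0 h1 h2
  have e1 : g (1 + 1, k) = F (2, k) := h2 _ _ le_rfl
  have e2 : g (1, k + 1) = F (1, k + 1) := by
    rw [h1, if_neg (by omega), if_neg (by omega), if_neg (by omega)]
  simp only [e1, e2]
  split_ifs with c1 c2
  · refine Or.inr (Or.inr ⟨j, k, k, rfl, hle, le_rfl, fun c => ?_, fun c => ?_, fun c => ?_,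
      fun r c hr => ?_, h.cond0, h.turn0, h.cond1, c1⟩)
    · rw [move_apply]
      grind
    · rw [move_apply]
      grind
    · rw [move_apply]
      grind
    · rw [move_apply]
      grind
  · refine Or.inr (Or.inl ⟨j, k + 1, rfl, by omega, fun c => ?_, fun c => ?_, fun r c hr => ?_,
      h.cond0, h.turn0, fun c hc hck => ?_⟩)
    · rw [move_apply]
      grind
    · rw [move_apply]
      grind
    · rw [move_apply]
      grind
    · rcases Nat.lt_or_ge c k with h' | h'
      · exact h.cond1 c hc h'
      · obtain rfl : c = k := by omega
        exact c2
  · exact Or.inr (Or.inl ⟨j, k, h⟩)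

theorem InTop.slide {j k l : ℕ} (hF : ∀ c, F (3, c) = ⊤) (h : InTop F s j k l) :
    OnPath F (slide s) := by
  unfold JeuDeTaquin.slide
  obtain ⟨g, p⟩ := s
  obtain rfl : p = (2, l) := h.hole
  have hle := h.le
  have hle' := h.le'
  have h0 := h.row0
  have h1 := h.row1
  have h2 := h.row2
  have h3 := h.rest
  simp only at h0 h1 h2 h3
  have e1 : g (2 + 1, l) = ⊤ := (h3 _ _ le_rfl).trans (hF l)
  have e2 : g (2, l + 1) = F (2, l + 1) := by
    rw [h2, if_neg (by omega), if_neg (by omega), if_neg (by omega)]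
  simp only [e1, e2, not_top_lt, if_false]
  split_ifs with c2
  · refine Or.inr (Or.inr ⟨j, k, l + 1, rfl, hle, by omega, fun c => ?_, fun c => ?_, fun c => ?_,
      fun r c hr => ?_, h.cond0, h.turn0, h.cond1, h.turn1⟩)
    · rw [move_apply]
      grind
    · rw [move_apply]
      grind
    · rw [move_apply]
      grind
    · rw [move_apply]
      grind
  · exact Or.inr (Or.inr ⟨j, k, l, h⟩)

theorem onPath_final {n : ℕ} (T : StdTableau n) : OnPath (filling T) (final T) := by
  have hF : ∀ c, filling T (3, c) = ⊤ := fun c => by simp [filling]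
  have key : ∀ m, OnPath (filling T) (slide^[m] (start T)) := by
    intro m
    induction m with
    | zero =>
      refine Or.inl ⟨0, rfl, fun c => ?_, fun r c hr => ?_, fun c hc => by omega⟩
      · simp only [Function.iterate_zero, id, start, Function.update_apply, Prod.mk.injEq]
        grind
      · simp only [Function.iterate_zero, id, start, Function.update_apply, Prod.mk.injEq]
        grind
    | succ m ih =>
      rw [Function.iterate_succ_apply']
      rcases ih with ⟨j, h⟩ | ⟨j, k, h⟩ | ⟨j, k, l, h⟩
      · exact h.slide
      · exact h.slide
      · exact h.slide hF
  exact key _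

theorem exists_inTop {n : ℕ} (hn : 0 < n) (T : StdTableau n) :
    ∃ j k, InTop (filling T) (final T) j k (n - 1) := by
  have h := (good_final hn T).2
  rcases onPath_final T with ⟨j, g⟩ | ⟨j, k, g⟩ | ⟨j, k, l, g⟩
  · have := g.hole.symm.trans h; simp at this
  · have := g.hole.symm.trans h; simp at this
  · have := g.hole.symm.trans h
    simp only [Prod.mk.injEq, true_and] at this
    subst this
    exact ⟨j, k, g⟩

end JeuDeTaquin

namespace StdTableau

open JeuDeTaquin

variable {n : ℕ} (T : StdTableau n)

theorem filling_eq {r c : ℕ} (hr : r < 3) (hc : c < n) :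
    filling T (r, c) = T.entry ⟨r, hr⟩ ⟨c, hc⟩ := by
  simp [filling, hr, hc]

theorem onRow_promotion {r c v : ℕ} (hn : 0 < n) (hr : r < 3) (hc : c < n)
    (h : (final T).1 (r, c) = ((v + 1 : ℕ) : ℕ∞)) : T.promotion.OnRow r v := by
  refine ⟨hr, ⟨c, hc⟩, ?_⟩
  have hne : (r, c) ≠ (final T).2 := by
    rintro h1
    have := (good_final hn T).1.hole_top
    rw [← h1, h] at this
    exact ENat.natCast_ne_top _ this
  change promotedEntry T _ _ = v
  simp only [promotedEntry, if_neg hne, h]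
  rfl

theorem entry_zero_zero (hn : 0 < n) : T.entry 0 ⟨0, hn⟩ = 1 := by
  obtain ⟨⟨r, c⟩, -, h⟩ := T.bijOn.surjOn (show 1 ∈ Set.Icc 1 (3 * n) by simp; omega)
  have h1 := ((T.col_lt ⟨0, hn⟩).monotone (Fin.zero_le r)).trans
    ((T.row_lt r).monotone (Fin.mk_le_of_le_val (Nat.zero_le c)))
  have h2 : 1 ≤ T.entry 0 ⟨0, hn⟩ := (T.onRow_range ⟨_, _, rfl⟩).2.1
  simp only at h h1
  omega

end StdTableau

/-! ### The ballot word of the promotion -/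

/-- `D'` is the word of the promotion, where the positions have not been lowered by one: the letter at
position `1` disappears, the letters at `p` and `q` decrease, and there is a new letter at the end. -/
structure Promotes {N : ℕ} (D : LatticeWord 0 N) (D' : LatticeWord 1 N) (p q : ℕ) : Prop where
  one_lt : 1 < p
  lt : p < q
  le : q ≤ N
  letter_one : D.letter 1 = 0
  letter_p : D.letter p = 1
  letter_q : D.letter q = 2
  H_p : D.H p = 0
  H_pos : ∀ j, 1 ≤ j → j < p → 0 < D.H j
  K_q : D.K q = 0
  K_pos : ∀ j, p ≤ j → j < q → 0 < D.K j
  letter_p' : D'.letter p = 0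
  letter_q' : D'.letter q = 1
  letter_last' : D'.letter (N + 1) = 2
  letter_eq : ∀ k, 2 ≤ k → k ≤ N → k ≠ p → k ≠ q → D'.letter k = D.letter k

/-- Losing the `0` at position `1` lowers `H` by one. Turning `1` into `0` at `p` raises `H` by two
and lowers `K` by one; turning `2` into `1` at `q` lowers `H` by one and raises `K` by two. -/
theorem Promotes.heights {N : ℕ} {D : LatticeWord 0 N} {D' : LatticeWord 1 N} {p q : ℕ}
    (P : Promotes D D' p q) (k : ℕ) :
    (k = 0 → D.H k = 0 ∧ D.K k = 0 ∧ D'.H k = 0 ∧ D'.K k = 0) ∧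
    (1 ≤ k ∧ k < p → D'.H k = D.H k - 1 ∧ D'.K k = D.K k) ∧
    (p ≤ k ∧ k < q → D'.H k = D.H k + 1 ∧ D'.K k = D.K k - 1) ∧
    (q ≤ k ∧ k ≤ N → D'.H k = D.H k ∧ D'.K k = D.K k + 1) ∧
    (N < k → D.H k = 0 ∧ D.K k = 0 ∧ D'.H k = 0 ∧ D'.K k = 0) := by
  obtain ⟨c1, c2, c3, l1, lp, lq, -, -, -, -, lp', lq', ll', hl⟩ := P
  induction k with
  | zero =>
    have h1 := D.eq_zero_of_le (k := 0) le_rfl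
    have h2 := D'.eq_zero_of_le (k := 0) (by omega)
    omega
  | succ k ih =>
    rcases Nat.eq_zero_or_pos k with rfl | hk
    · have h1 := D.eq_zero_of_le (k := 0) le_rfl
      have h2 := D'.eq_zero_of_le (k := 1) le_rfl
      have h3 := D.bot 0 l1
      simp only [zero_add] at *
      omega
    rcases Nat.lt_or_ge N (k + 1) with hkN | hkN
    · have h1 := D.eq_zero_of_ge (k := k + 1) (by omega)
      have h2 := D'.eq_zero_of_ge (k := k + 1) (by omega)
      omega
    have h1 := D.step_cases k
    have h2 := D'.step_cases k
    by_cases hp : k + 1 = p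
    · rw [← hp] at lp lp'
      omega
    by_cases hq : k + 1 = q
    · rw [← hq] at lq lq'
      omega
    have h3 := hl (k + 1) (by omega) hkN hp hq
    omega

namespace StdTableau

open JeuDeTaquin

variable {n : ℕ} (T : StdTableau n)

/-- The letters change at the entries `p` and `q` that slide down a row. The comparisons made while
the box moves right give positive heights, those made when it moves up give height zero. -/
theorem exists_promotes (hn : 0 < n) : ∃ p q, Promotes (T.word 0) (T.promotion.word 1) p q := by
  obtain ⟨j, k, hole, hjk, hkn, row0, row1, row2, -, cond0, turn0, cond1, turn1⟩ := exists_inTop hn T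
  have ej : j < n := by omega
  have ek : k < n := by omega
  have F (r : Fin 3) (c : ℕ) (hc : c < n) : filling T ((r : ℕ), c) = T.entry r ⟨c, hc⟩ :=
    T.filling_eq r.2 hc
  have F0 := F 0
  have F1 := F 1
  have F2 := F 2
  change ∀ c (hc : c < n), filling T (0, c) = T.entry 0 ⟨c, hc⟩ at F0
  change ∀ c (hc : c < n), filling T (1, c) = T.entry 1 ⟨c, hc⟩ at F1
  change ∀ c (hc : c < n), filling T (2, c) = T.entry 2 ⟨c, hc⟩ at F2
  obtain ⟨p, hp⟩ : ∃ p, p = T.entry 1 ⟨j, ej⟩ := ⟨_, rfl⟩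
  obtain ⟨q, hq⟩ : ∃ q, q = T.entry 2 ⟨k, ek⟩ := ⟨_, rfl⟩
  have rp : T.OnRow 1 p := ⟨by omega, ⟨j, ej⟩, hp.symm⟩
  have rq : T.OnRow 2 q := ⟨by omega, ⟨k, ek⟩, hq.symm⟩
  have h00 := T.entry_zero_zero hn
  have r1 : T.OnRow 0 1 := ⟨by omega, ⟨0, hn⟩, h00⟩
  have prom {r c v : ℕ} (hr : r < 3) (hc : c < n) (hv : 1 ≤ v) (h : (final T).1 (r, c) = (v : ℕ∞)) :
      T.promotion.OnRow r (v - 1) :=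
    T.onRow_promotion hn hr hc (by rw [Nat.sub_add_cancel hv]; exact h)
  have R0 (v : ℕ) (h : T.OnRow 0 v) (hv : v ≠ 1) : T.promotion.OnRow 0 (v - 1) := by
    have := T.onRow_range h
    obtain ⟨_, ⟨c, hc⟩, rfl⟩ := h
    have hc0 : c ≠ 0 := by rintro rfl; exact hv h00
    rcases Nat.lt_or_ge j c with h1 | h1
    · refine prom (c := c) (by omega) hc this.2.1 ?_
      rw [row0, if_neg (by omega), if_neg (by omega)]
      exact F0 c hc
    · obtain ⟨c, rfl⟩ : ∃ c', c = c' + 1 := ⟨c - 1, by omega⟩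
      refine prom (c := c) (by omega) (by omega) this.2.1 ?_
      rw [row0, if_pos (by omega)]
      exact F0 _ hc
  have R1 (v : ℕ) (h : T.OnRow 1 v) (hv : v ≠ p) : T.promotion.OnRow 1 (v - 1) := by
    have := T.onRow_range h
    obtain ⟨_, ⟨c, hc⟩, rfl⟩ := h
    have hc0 : c ≠ j := by rintro rfl; exact hv hp.symm
    rcases Nat.lt_or_ge c j with h1 | h1
    · refine prom (c := c) (by omega) hc this.2.1 ?_
      rw [row1, if_pos h1]
      exact F1 c hc
    rcases Nat.lt_or_ge k c with h2 | h2
    · refine prom (c := c) (by omega) hc this.2.1 ?_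
      rw [row1, if_neg (by omega), if_neg (by omega), if_neg (by omega)]
      exact F1 c hc
    · obtain ⟨c, rfl⟩ : ∃ c', c = c' + 1 := ⟨c - 1, by omega⟩
      refine prom (c := c) (by omega) (by omega) this.2.1 ?_
      rw [row1, if_neg (by omega), if_pos (by omega)]
      exact F1 _ hc
  have R2 (v : ℕ) (h : T.OnRow 2 v) (hv : v ≠ q) : T.promotion.OnRow 2 (v - 1) := by
    have := T.onRow_range h
    obtain ⟨_, ⟨c, hc⟩, rfl⟩ := h
    have hc0 : c ≠ k := by rintro rfl; exact hv hq.symm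
    rcases Nat.lt_or_ge c k with h1 | h1
    · refine prom (c := c) (by omega) hc this.2.1 ?_
      rw [row2, if_pos h1]
      exact F2 c hc
    · obtain ⟨c, rfl⟩ : ∃ c', c = c' + 1 := ⟨c - 1, by omega⟩
      refine prom (c := c) (by omega) (by omega) this.2.1 ?_
      rw [row2, if_neg (by omega), if_pos (by omega)]
      exact F2 _ hc
  have P0 : T.promotion.OnRow 0 (p - 1) := by
    refine prom (c := j) (by omega) ej (T.onRow_range rp).2.1 ?_
    rw [row0, if_neg (by omega), if_pos rfl, F1 j ej, hp]
  have Q1 : T.promotion.OnRow 1 (q - 1) := by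
    refine prom (c := k) (by omega) ek (T.onRow_range rq).2.1 ?_
    rw [row1, if_neg (by omega), if_neg (by omega), if_pos rfl, F2 k ek, hq]
  have L2 : T.promotion.OnRow 2 (3 * n) := by
    refine ⟨by omega, ⟨n - 1, by omega⟩, ?_⟩
    change promotedEntry T _ _ = _
    rw [promotedEntry, if_pos hole.symm]
  have cd0 (c : ℕ) (h : c < j) : T.entry 0 ⟨c + 1, by omega⟩ < T.entry 1 ⟨c, by omega⟩ := by
    have := cond0 c h
    rw [F0 _ (by omega), F1 _ (by omega)] at this
    exact_mod_cast this
  have td0 (h : j + 1 < n) : p < T.entry 0 ⟨j + 1, h⟩ := by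
    have := turn0
    rw [F0 _ h, F1 _ ej, ← hp] at this
    exact_mod_cast this
  have cd1 (c : ℕ) (h : j ≤ c) (h' : c < k) : T.entry 1 ⟨c + 1, by omega⟩ < T.entry 2 ⟨c, by omega⟩ := by
    have := cond1 c h h'
    rw [F1 _ (by omega), F2 _ (by omega)] at this
    exact_mod_cast this
  have td1 (h : k + 1 < n) : q < T.entry 1 ⟨k + 1, h⟩ := by
    have := turn1
    rw [F1 _ h, F2 _ ek, ← hq] at this
    exact_mod_cast this
  have lt_count (r : Fin 3) (i c : ℕ) (hc : c < n) (h : T.entry r ⟨c, hc⟩ ≤ i) : c < T.count r i :=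
    (T.lt_count_iff r i ⟨c, hc⟩).2 h
  have count_le (r : Fin 3) (i c : ℕ) (h : ∀ hc : c < n, i < T.entry r ⟨c, hc⟩) : T.count r i ≤ c := by
    by_contra hh
    have h1 := T.count_le r i
    have h2 := (T.lt_count_iff r i ⟨c, by omega⟩).1 (by simp only; omega)
    have := h (by omega)
    omega
  have le_entry (r : Fin 3) (i c : ℕ) (h : c < T.count r i) (hc : c < n) : T.entry r ⟨c, hc⟩ ≤ i :=
    (T.lt_count_iff r i ⟨c, hc⟩).1 h
  have col01 (c : ℕ) (hc : c < n) : T.entry 0 ⟨c, hc⟩ < T.entry 1 ⟨c, hc⟩ :=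
    T.col_lt _ (show (0 : Fin 3) < 1 by decide)
  have col12 (c : ℕ) (hc : c < n) : T.entry 1 ⟨c, hc⟩ < T.entry 2 ⟨c, hc⟩ :=
    T.col_lt _ (show (1 : Fin 3) < 2 by decide)
  have row (r : Fin 3) (c c' : ℕ) (hc' : c' < n) (h : c < c') :
      T.entry r ⟨c, by omega⟩ < T.entry r ⟨c', hc'⟩ := T.row_lt r (show (⟨c, _⟩ : Fin n) < ⟨c', hc'⟩ from h)
  have row_le (r : Fin 3) (c c' : ℕ) (hc' : c' < n) (h : c ≤ c') :
      T.entry r ⟨c, by omega⟩ ≤ T.entry r ⟨c', hc'⟩ :=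
    (T.row_lt r).monotone (show (⟨c, _⟩ : Fin n) ≤ ⟨c', hc'⟩ from h)
  have W {r i : ℕ} (hr : r ≤ 2) (h : T.OnRow r i) : (T.word 0).letter i = r :=
    (T.rowOf_eq_iff hr).2 h
  have W' {r i : ℕ} (hr : r ≤ 2) (h : T.promotion.OnRow r (i - 1)) : (T.promotion.word 1).letter i = r :=
    (T.promotion.rowOf_eq_iff hr).2 h
  have hH (i : ℕ) : (T.word 0).H i = (T.count 0 i : ℤ) - T.count 1 i := rfl
  have hK (i : ℕ) : (T.word 0).K i = (T.count 1 i : ℤ) - T.count 2 i := rfl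
  have pq : p < q := by
    have h1 := row_le 1 j k ek hjk
    have h2 := col12 k ek
    omega
  refine ⟨p, q, ?_, pq, (T.onRow_range rq).2.2, W (by omega) r1, W (by omega) rp, W (by omega) rq, ?_, ?_,
    ?_, ?_, W' (by omega) P0, W' (by omega) Q1, W' (by omega) (by simpa using L2), ?_⟩
  · have h1 := col01 j ej
    have h2 := row_le 0 0 j ej (by omega)
    omega
  -- Exactly `j + 1` entries of each of the two lower rows are at most `p`, by the comparison at
  -- which the box leaves the bottom row.
  · have h1 := lt_count 0 p j ej (by have := col01 j ej; omega)
    have h2 := count_le 0 p (j + 1) td0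
    have h3 := lt_count 1 p j ej (by omega)
    have h4 := T.count_anti (show (0 : Fin 3) ≤ 1 by decide) p
    rw [hH]
    omega
  -- If `m + 1` middle entries are at most `i < p`, then `m < j`, and the comparison in column `m`
  -- puts at least `m + 2` bottom entries below.
  · intro i i1 i2
    rw [hH]
    have h1 := count_le 1 i j (fun hc => by omega)
    rcases Nat.eq_zero_or_pos (T.count 1 i) with h2 | h2
    · have := lt_count 0 i 0 hn (by omega)
      omega
    · obtain ⟨m, hm⟩ : ∃ m, T.count 1 i = m + 1 := ⟨T.count 1 i - 1, by omega⟩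
      have h3 := le_entry 1 i m (by omega) (by omega)
      have h4 := cd0 m (by omega)
      have h5 := lt_count 0 i (m + 1) (by omega) (by omega)
      omega
  · have h1 := lt_count 1 q k ek (by have := col12 k ek; omega)
    have h2 := count_le 1 q (k + 1) td1
    have h3 := lt_count 2 q k ek (by omega)
    have h4 := T.count_anti (show (1 : Fin 3) ≤ 2 by decide) q
    rw [hK]
    omega
  -- Beyond column `j` the comparisons in the middle row play the same role; up to it the entry `p`
  -- alone suffices.
  · intro i i1 i2
    rw [hK]
    have h1 := count_le 2 i k (fun hc => by omega)
    rcases Nat.lt_or_ge j (T.count 2 i) with h2 | h2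
    · obtain ⟨m, hm⟩ : ∃ m, T.count 2 i = m + 1 := ⟨T.count 2 i - 1, by omega⟩
      have h3 := le_entry 2 i m (by omega) (by omega)
      have h4 := cd1 m (by omega) (by omega)
      have h5 := lt_count 1 i (m + 1) (by omega) (by omega)
      omega
    · have := lt_count 1 i j ej (by omega)
      omega
  · intro i i1 i2 i3 i4
    obtain ⟨r, hr⟩ := T.exists_onRow (k := i) (by omega) i2
    have := T.onRow_range hr
    rw [W (by omega) hr]
    refine W' (by omega) ?_
    obtain rfl | rfl | rfl : r = 0 ∨ r = 1 ∨ r = 2 := by omega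
    · exact R0 i hr (by omega)
    · exact R1 i hr i3
    · exact R2 i hr i4

end StdTableau

/-! ### Crossings of a word and of its promotion -/

namespace Promotes

open LatticeWord

variable {N : ℕ} {D : LatticeWord 0 N} {D' : LatticeWord 1 N} {p q : ℕ}

/-- Both positions lie strictly inside one of the blocks into which `1`, `p` and `q` divide the word. -/
def Zone (p q u v : ℕ) : Prop := 1 < u ∧ (v < p ∨ p < u ∧ v < q ∨ q < u)

variable (P : Promotes D D' p q)
include P

theorem height_diff {u v : ℕ} (hz : Zone p q u v) (hv : v ≤ N) : ∃ x y : ℤ,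
    ∀ j, u - 1 ≤ j → j ≤ v → D'.H j = D.H j + x ∧ D'.K j = D.K j + y := by
  obtain ⟨z0, z1 | z1 | z1⟩ := hz
  · exact ⟨-1, 0, fun j j1 j2 => by have := P.heights j; omega⟩
  · exact ⟨1, -1, fun j j1 j2 => by have := P.heights j; omega⟩
  · exact ⟨0, 1, fun j j1 j2 => by have := P.heights j; omega⟩

theorem letter_zone {u v : ℕ} (hz : Zone p q u v) (huv : u ≤ v) (hv : v ≤ N) :
    D'.letter u = D.letter u ∧ D'.letter v = D.letter v := by
  have := P.lt
  unfold Zone at hz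
  exact ⟨P.letter_eq u (by omega) (by omega) (by omega) (by omega),
    P.letter_eq v (by omega) (by omega) (by omega) (by omega)⟩

/-- The appended position is in no crossing: as a right inner endpoint it would carry a `2` under a
first arc, but `H` is zero there. -/
theorem le_of_cr' {u v : ℕ} (h : D'.Cr u v) : v ≤ N := by
  obtain ⟨h0, ⟨a1, a2, -⟩ | ⟨a1, a2, a3, -⟩⟩ := h
  · have h1 := (D'.letter_le v).1 (by omega)
    have h2 := P.letter_last'
    by_contra hc
    rw [show N + 1 = v by omega] at h2
    omega
  · have h1 := (D'.letter_le v).1 (by omega)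
    by_contra hc
    have h2 := D'.letter_zero a1
    have h3 := D'.H_nonneg (u - 1)
    have h4 := a3 v h0 le_rfl
    have h5 := P.heights v
    omega

omit P in
theorem le_of_cr {u v : ℕ} (h : D.Cr u v) : v ≤ N := by
  have h1 : D.letter v ≤ 2 := by
    obtain ⟨h0, ⟨a1, a2, -⟩ | ⟨a1, a2, a3, -⟩⟩ := h <;> omega
  have := (D.letter_le v).1 h1
  omega

/-- A crossing is defined by comparing heights between `u` and `v`, and there the two words differ
by constants. -/
theorem cr_zone {u v : ℕ} (hz : Zone p q u v) : D.Cr u v ↔ D'.Cr u v := by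
  constructor
  · intro h
    obtain ⟨x, y, hxy⟩ := P.height_diff hz (le_of_cr h)
    obtain ⟨l1, l2⟩ := P.letter_zone hz h.1 (le_of_cr h)
    have hu := hxy u (by omega) h.1
    have hv := hxy v (by have := h.1; omega) le_rfl
    obtain ⟨h0, ⟨a1, a2, a3, a4⟩ | ⟨a1, a2, a3, a4⟩⟩ := h
    · refine ⟨h0, Or.inl ⟨by omega, by omega, fun j j1 j2 => ?_, fun j j1 j2 => ?_⟩⟩
      · have := a3 j j1 j2; have := hxy j (by omega) (by omega); omega
      · have := a4 j j1 j2; have := hxy j (by omega) (by omega); omega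
    · refine ⟨h0, Or.inr ⟨by omega, by omega, fun j j1 j2 => ?_, fun j j1 j2 => ?_⟩⟩
      · have := a3 j j1 j2; have := hxy j (by omega) (by omega); omega
      · have := a4 j j1 j2; have := hxy j (by omega) (by omega); omega
  · intro h
    obtain ⟨x, y, hxy⟩ := P.height_diff hz (P.le_of_cr' h)
    obtain ⟨l1, l2⟩ := P.letter_zone hz h.1 (P.le_of_cr' h)
    have hu := hxy u (by omega) h.1
    have hv := hxy v (by have := h.1; omega) le_rfl
    obtain ⟨h0, ⟨a1, a2, a3, a4⟩ | ⟨a1, a2, a3, a4⟩⟩ := h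
    · refine ⟨h0, Or.inl ⟨by omega, by omega, fun j j1 j2 => ?_, fun j j1 j2 => ?_⟩⟩
      · have := a3 j j1 j2; have := hxy j (by omega) (by omega); omega
      · have := a4 j j1 j2; have := hxy j (by omega) (by omega); omega
    · refine ⟨h0, Or.inr ⟨by omega, by omega, fun j j1 j2 => ?_, fun j j1 j2 => ?_⟩⟩
      · have := a3 j j1 j2; have := hxy j (by omega) (by omega); omega
      · have := a4 j j1 j2; have := hxy j (by omega) (by omega); omega

/-- Positions and levels of a crossing inside one block. -/
theorem zone_key {u v : ℕ} (hz : Zone p q u v) (h : D.Cr u v) :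
    D'.letter u = D.letter u ∧ D'.key1 (u, v) = D.key1 (u, v) ∧ D'.key2 (u, v) = D.key2 (u, v) ∧
    (u ≤ D.key1 (u, v) ∧ D.key1 (u, v) ≤ v) ∧ (u ≤ D.key2 (u, v) ∧ D.key2 (u, v) ≤ v) ∧
    ∀ j, u - 1 ≤ j → j ≤ v → D'.lev1 (u, v) - D'.H j = D.lev1 (u, v) - D.H j ∧
      D'.lev2 (u, v) - D'.K j = D.lev2 (u, v) - D.K j := by
  obtain ⟨x, y, hxy⟩ := P.height_diff hz (le_of_cr h)
  obtain ⟨l1, l2⟩ := P.letter_zone hz h.1 (le_of_cr h)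
  have h0 := h.1
  have hu := hxy u (by omega) h.1
  have hv := hxy v (by omega) le_rfl
  refine ⟨l1, ?_⟩
  obtain ⟨-, b⟩ := h.cases
  obtain ⟨-, b'⟩ := ((P.cr_zone hz).1 h).cases
  refine ⟨by omega, by omega, by omega, by omega, fun j j1 j2 => ?_⟩
  have := hxy j j1 j2
  omega

/-- The crossings of the old word that do not lie inside one block. -/
theorem cr_cases {u v : ℕ} (h : D.Cr u v) : Zone p q u v ∨
    (v = p ∧ 1 < u ∧ u ≤ p ∧ D.letter u = 1 ∧ D.lev1 (u, v) = 1 ∧ D.key1 (u, v) = u ∧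
      D.lev2 (u, v) = D.K u ∧ D.key2 (u, v) = p ∧ 0 < D.K u ∧ (∀ j, u ≤ j → j ≤ p → D.K u ≤ D.K j)) ∨
    (v = q ∧ p < u ∧ u < q ∧ D.letter u = 0 ∧ D.lev1 (u, v) = D.H u ∧ D.key1 (u, v) = q ∧
      D.lev2 (u, v) = 1 ∧ D.key2 (u, v) = u ∧ 0 < D.H u ∧ (∀ j, u ≤ j → j ≤ q → D.H u ≤ D.H j)) := by
  obtain ⟨c1, c2, c3, l1, lp, lq, Hp, Hpos, Kq, Kpos, -⟩ := P
  unfold Zone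
  obtain ⟨h0, ⟨a1, a2, a3, a4, a5, a6, a7, a8⟩ | ⟨a1, a2, a3, a4, a5, a6, a7, a8, a9⟩⟩ := h.cases
  · have b1 := D.letter_one a1
    have b2 : u ≠ 1 := by rintro rfl; omega
    have b3 := D.K_nonneg (u - 1)
    have b4 := D.H_nonneg v
    by_cases hp : u ≤ p ∧ p ≤ v
    · right; left
      -- The height `H` is zero at `p`, so a first arc over or into `p` must end there.
      have hv : v = p := by
        by_contra hv
        have := a8 p hp.1 (by omega)
        omega
      subst hv
      exact ⟨rfl, by omega, by omega, a1, by omega, a4, a5, a6, by omega, a7⟩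
    by_cases hq : u ≤ q ∧ q ≤ v
    · have := a7 q hq.1 hq.2
      omega
    left
    omega
  · have b1 := D.letter_zero a1
    have b3 := D.H_nonneg (u - 1)
    have b4 := D.K_nonneg v
    have b2 : u ≠ 1 := by
      rintro rfl
      have := a9 1 le_rfl a7
      have := D.eq_zero_of_le (k := 0) le_rfl
      simp only [Nat.sub_self] at b1
      omega
    by_cases hp : u ≤ p ∧ p ≤ v
    · have := a8 p hp.1 hp.2
      omega
    by_cases hq : u ≤ q ∧ q ≤ v
    · right; right
      have hv : v = q := by
        by_contra hv
        have := a9 q hq.1 (by omega)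
        omega
      subst hv
      exact ⟨rfl, by omega, by omega, a1, by omega, a4, by omega, a6, by omega, a8⟩
    left
    omega

theorem heights_p_q : D'.H (p - 1) = 0 ∧ D'.H p = 1 ∧ D'.K (q - 1) = 0 ∧ D'.K q = 1 ∧ D'.H q = D.H q := by
  obtain ⟨c1, c2, c3, l1, lp, lq, Hp, -, Kq, -⟩ := id P
  have hp := P.heights p
  have hp1 := P.heights (p - 1)
  have kp := D.letter_one P.letter_p
  have h1 : D'.H (p - 1) = 0 := by omega
  have h2 : D'.H p = 1 := by omega
  clear hp hp1
  have hq := P.heights q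
  have hq1 := P.heights (q - 1)
  have kq := D.letter_two P.letter_q
  omega

/-- The crossings of the new word that do not lie inside one block. -/
theorem cr_cases' {u v : ℕ} (h : D'.Cr u v) : Zone p q u v ∨
    (u = p ∧ p < v ∧ v < q ∧ D'.lev1 (u, v) = 1 ∧ D'.key1 (u, v) = v ∧
      D'.lev2 (u, v) = D.K v ∧ D'.key2 (u, v) = p ∧ 0 < D.K v ∧ (∀ j, p ≤ j → j < v → D.K v < D.K j)) ∨
    (u = q ∧ q ≤ v ∧ v ≤ N ∧ D'.lev1 (u, v) = D'.H v + 1 ∧ D'.key1 (u, v) = q ∧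
      D'.lev2 (u, v) = 1 ∧ D'.key2 (u, v) = v ∧ (∀ j, q ≤ j → j < v → D'.H v < D'.H j)) := by
  have hv := P.le_of_cr' h
  obtain ⟨e1, e2, e3, e4, -⟩ := P.heights_p_q
  have ht := P.heights
  obtain ⟨c1, c2, c3, l1, lp, lq, Hp, Hpos, Kq, Kpos, lp', lq', -⟩ := P
  unfold Zone
  obtain ⟨h0, ⟨a1, a2, a3, a4, a5, a6, a7, a8⟩ | ⟨a1, a2, a3, a4, a5, a6, a7, a8, a9⟩⟩ := h.cases
  · have b0 := (D'.letter_le u).1 (by omega)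
    have b1 := D'.letter_one a1
    have b3 := D'.K_nonneg (u - 1)
    have b4 := D'.H_nonneg v
    have b5 : u ≠ p := by rintro rfl; omega
    by_cases h1 : u < p ∧ p ≤ v
    · have := a8 (p - 1) (by omega) (by omega)
      omega
    by_cases h2 : u < q ∧ q ≤ v
    · have := a7 (q - 1) (by omega) (by omega)
      omega
    by_cases h3 : u = q
    · subst h3
      exact Or.inr (Or.inr ⟨rfl, by omega, hv, by omega, a4, by omega, a6, a8⟩)
    · left
      omega
  · have b0 := (D'.letter_le u).1 (by omega)
    have b1 := D'.letter_zero a1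
    have b3 := D'.H_nonneg (u - 1)
    have b4 := D'.K_nonneg v
    have b5 : u ≠ q := by rintro rfl; omega
    by_cases h1 : u < p ∧ p ≤ v
    · have := a8 (p - 1) (by omega) (by omega)
      omega
    by_cases h2 : u < q ∧ q ≤ v
    · have := a9 (q - 1) (by omega)
      rcases Nat.lt_or_ge (q - 1) v with h | h
      · have := this h; omega
      · omega
    by_cases h3 : u = p
    · subst h3
      have h5 := ht v
      have h6 := Kpos v (by omega) (by omega)
      refine Or.inr (Or.inl ⟨rfl, by omega, by omega, by omega, a4, by omega, a6, h6, fun j j1 j2 => ?_⟩)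
      have := a9 j j1 j2
      have := ht j
      omega
    · left
      omega

/-- At every positive level up to `K p` a second arc starts at or before `p` and passes over it; it
crosses the old first arc from `1` to `p`. Its start is the last rise to `h`. -/
theorem exists_cr_p {h : ℤ} (h1 : 0 < h) (h2 : h ≤ D.K p) : ∃ c, D.Cr c p ∧ D.K c = h := by
  have h0 := D.eq_zero_of_le (k := 0) le_rfl
  obtain ⟨k, k1, k2, k3, k4, k5⟩ := D.smallSteps_K.exists_rise (a := 0) (b := p) (h := h) (by omega)
    (by omega) h2
  have hl : D.letter (k + 1) = 1 := by have := D.step_cases k; omega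
  refine ⟨k + 1, ⟨by omega, Or.inl ⟨hl, P.letter_p, fun j j1 j2 => ?_, fun j j1 j2 => ?_⟩⟩, k4⟩
  · have := k5 j (by omega) j2; omega
  · rw [P.H_p]; exact P.H_pos j (by omega) j2

/-- The first drop to `h` after `p` ends a second arc, which crosses the new first arc starting at
`p`. Level zero is excluded because that drop is at `q` itself. -/
theorem exists_cr_p' {h : ℤ} (h1 : 0 < h) (h2 : h < D.K p) : ∃ t, D'.Cr p t ∧ p < t ∧ D.K t = h := by
  obtain ⟨k, k1, k2, k3, k4, k5⟩ := D.smallSteps_K.exists_drop (a := p) (b := q) (h := h + 1) P.lt.le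
    (by omega) (by have := P.K_q; omega)
  have hk : k + 1 ≠ q := by rintro rfl; have := P.K_q; omega
  have hl : D.letter (k + 1) = 2 := by have := D.step_cases k; omega
  have hl' := P.letter_eq (k + 1) (by have := P.one_lt; omega) (by have := P.le; omega) (by omega) hk
  refine ⟨k + 1, ⟨by omega, Or.inr ⟨P.letter_p', by omega, fun j j1 j2 => ?_, fun j j1 j2 => ?_⟩⟩,
    by omega, by omega⟩
  · have h3 := P.heights j
    have h4 := P.heights p
    have h5 := P.H_p
    have h6 := D.H_nonneg j
    have h7 := P.lt
    omega
  · have h3 := P.heights j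
    have h4 := P.heights (k + 1)
    have := k5 j j1 (by omega)
    omega

/-- The first arcs that pass over `q` cross the old second arc ending there, one for each positive
level up to `H q`. -/
theorem exists_cr_q {h : ℤ} (h1 : 0 < h) (h2 : h ≤ D.H q) : ∃ b, D.Cr b q ∧ b < q ∧ D.H b = h := by
  obtain ⟨k, k1, k2, k3, k4, k5⟩ := D.smallSteps_H.exists_rise (a := p) (b := q) (h := h) P.lt.le
    (by have := P.H_p; omega) h2
  have hl : D.letter (k + 1) = 0 := by have := D.step_cases k; omega
  have hk : k + 1 ≠ q := by rintro rfl; have := P.letter_q; omega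
  refine ⟨k + 1, ⟨by omega, Or.inr ⟨hl, P.letter_q, fun j j1 j2 => ?_, fun j j1 j2 => ?_⟩⟩,
    by omega, k4⟩
  · have := k5 j (by omega) j2; omega
  · rw [P.K_q]; exact P.K_pos j (by omega) j2

/-- The first drop to `h` after `q` ends a first arc that crosses the new second arc starting at
`q`; the top level is the fork at `q`. -/
theorem exists_cr_q' {h : ℤ} (h1 : 0 ≤ h) (h2 : h ≤ D'.H q) : ∃ m, D'.Cr q m ∧ D'.H m = h := by
  rcases h2.lt_or_eq with h3 | rfl
  · have hN := P.heights (N + 1)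
    have hle := P.le
    obtain ⟨k, k1, k2, k3, k4, k5⟩ := D'.smallSteps_H.exists_drop (a := q) (b := N + 1) (h := h + 1)
      (by omega) (by omega) (by omega)
    have hl : D'.letter (k + 1) = 1 := by have := D'.step_cases k; omega
    have hk : k + 1 ≠ N + 1 := by
      intro hc
      rw [hc] at hl
      have := P.letter_last'; omega
    refine ⟨k + 1, ⟨by omega, Or.inl ⟨P.letter_q', hl, fun j j1 j2 => ?_, fun j j1 j2 => ?_⟩⟩, by omega⟩
    · have h3 := P.heights j
      have h4 := P.heights q
      have h5 := P.K_q
      have h6 := D.K_nonneg j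
      omega
    · have := k5 j j1 (by omega)
      omega
  · exact ⟨q, D'.cr_self P.letter_q', rfl⟩

/-- A sink inside a block does not lie on the strand of level one that starts at `1`. -/
theorem zone_lev1 {u v : ℕ} (hz : Zone p q u v) (h : D.Cr u v) (hl : D.lev1 (u, v) = 1) :
    p < D.key1 (u, v) := by
  have hk := (P.zone_key hz h).2.2.2.1
  by_contra hc
  obtain ⟨z0, z1 | z1 | z1⟩ := hz
  · obtain ⟨h0, ⟨a1, a2, a3, a4, a5, a6, a7, a8⟩ | ⟨a1, a2, a3, a4, a5, a6, a7, a8, a9⟩⟩ := h.cases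
    · have := P.H_pos v (by omega) z1
      omega
    · have := D.letter_zero a1
      have := P.H_pos (u - 1) (by omega) (by omega)
      omega
  · omega
  · have := P.lt; omega

theorem zone_lev2 {u v : ℕ} (hz : Zone p q u v) (h : D.Cr u v) (hl : D.lev2 (u, v) = 1) :
    D.key2 (u, v) < p ∨ q < D.key2 (u, v) := by
  have hk := (P.zone_key hz h).2.2.2.2.1
  by_contra hc
  obtain ⟨z0, z1 | z1 | z1⟩ := hz
  · omega
  · obtain ⟨h0, ⟨a1, a2, a3, a4, a5, a6, a7, a8⟩ | ⟨a1, a2, a3, a4, a5, a6, a7, a8, a9⟩⟩ := h.cases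
    · have := D.letter_one a1
      have := P.K_pos (u - 1) (by omega) (by omega)
      omega
    · have := P.K_pos v (by omega) (by omega)
      omega
  · omega

theorem zone_lev1' {u v : ℕ} (hz : Zone p q u v) (h : D'.Cr u v) (hl : D'.lev1 (u, v) = 1) :
    D'.key1 (u, v) ≤ p ∨ q < D'.key1 (u, v) := by
  have hk := P.zone_key hz ((P.cr_zone hz).2 h)
  by_contra hc
  obtain ⟨z0, z1 | z1 | z1⟩ := hz
  · omega
  · obtain ⟨h0, ⟨a1, a2, a3, a4, a5, a6, a7, a8⟩ | ⟨a1, a2, a3, a4, a5, a6, a7, a8, a9⟩⟩ := h.cases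
    · have := P.heights v
      have := D.H_nonneg v
      omega
    · have := D'.letter_zero a1
      have := P.heights (u - 1)
      have := D.H_nonneg (u - 1)
      omega
  · omega

theorem zone_lev2' {u v : ℕ} (hz : Zone p q u v) (h : D'.Cr u v) (hl : D'.lev2 (u, v) = 1) :
    D'.key2 (u, v) < q := by
  have hk := P.zone_key hz ((P.cr_zone hz).2 h)
  have hv := P.le_of_cr' h
  by_contra hc
  obtain ⟨z0, z1 | z1 | z1⟩ := hz
  · have := P.lt; omega
  · omega
  · obtain ⟨h0, ⟨a1, a2, a3, a4, a5, a6, a7, a8⟩ | ⟨a1, a2, a3, a4, a5, a6, a7, a8, a9⟩⟩ := h.cases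
    · have := D'.letter_one a1
      have := P.heights (u - 1)
      have := D.K_nonneg (u - 1)
      omega
    · have := P.heights v
      have := D.K_nonneg v
      omega

end Promotes

/-! ### The correspondence of sinks, sources and half-edges under promotion -/

theorem exists_equiv_of_rel {α β : Type*} (R : α → β → Prop) (h1 : ∀ a, ∃ b, R a b)
    (h2 : ∀ b, ∃ a, R a b) (h3 : ∀ a b b', R a b → R a b' → b = b')
    (h4 : ∀ a a' b, R a b → R a' b → a = a') : ∃ e : α ≃ β, ∀ a, R a (e a) := by
  choose f hf using h1
  refine ⟨Equiv.ofBijective f ⟨fun a a' h => h4 a a' (f a) (hf a) (h ▸ hf a'), fun b => ?_⟩, hf⟩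
  obtain ⟨a, ha⟩ := h2 b
  exact ⟨a, h3 a _ _ (hf a) ha⟩

namespace Promotes

open LatticeWord

variable {N : ℕ}

/-- The sinks that correspond to each other, with the permutation of their colours. -/
def SnkRel (D : LatticeWord 0 N) (D' : LatticeWord 1 N) (p q : ℕ) (a : D.Snk) (a' : D'.Snk)
    (σ : Equiv.Perm (Fin 3)) : Prop :=
  (Zone p q a.1.1 a.1.2 ∧ a'.1 = a.1 ∧ σ = 1) ∨
  (a.1.2 = p ∧ a'.1.1 = p ∧ D.K a.1.1 = D.K a'.1.2 + 1 ∧ σ = Equiv.swap 0 2) ∨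
  (a.1.2 = p ∧ D.K a.1.1 = 1 ∧ a'.1.1 = q ∧ D'.H a'.1.2 = 0 ∧ σ = Equiv.addRight 1) ∨
  (a.1.2 = q ∧ a'.1.1 = q ∧ D'.H a'.1.2 = D.H a.1.1 ∧ σ = Equiv.swap 1 2)

/-- The sources that correspond to each other, with the permutation of their colours. -/
def SrcRel (D : LatticeWord 0 N) (D' : LatticeWord 1 N) (p q : ℕ) (a : D.Src) (a' : D'.Src)
    (σ : Equiv.Perm (Fin 3)) : Prop :=
  (Zone p q a.1.1 a.1.2 ∧ a'.1 = a.1 ∧ σ = 1) ∨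
  (a.1.2 = p ∧ a'.1.1 = p ∧ D.K a.1.1 = D.K a'.1.2 ∧ σ = Equiv.swap 0 2) ∨
  (a.1.2 = q ∧ a'.1.1 = q ∧ D.H a.1.1 = D'.H a'.1.2 + 1 ∧ σ = Equiv.swap 1 2)

/-- The half-edges that correspond to each other. -/
def HERel (D : LatticeWord 0 N) (D' : LatticeWord 1 N) (p q : ℕ) (d : D.HE) (d' : D'.HE) : Prop :=
  (∃ i, d = Sum.inl (finRotate N i) ∧ d' = Sum.inl i) ∨
  (∃ a a' σ t, SnkRel D D' p q a a' σ ∧ d = Sum.inr (Sum.inl a, t) ∧ d' = Sum.inr (Sum.inl a', σ t)) ∨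
  ∃ a a' σ t, SrcRel D D' p q a a' σ ∧ d = Sum.inr (Sum.inr a, t) ∧ d' = Sum.inr (Sum.inr a', σ t)

variable {D : LatticeWord 0 N} {D' : LatticeWord 1 N} {p q : ℕ} (P : Promotes D D' p q)
include P

/-- A sink of a crossing keeps the arc on which an undisturbed piece arrives. At `p` this is the
second arc, coming from the right, whose level drops by one; at `q` it is the first arc, coming from
the left. The second arc ending at `q` offers no crossing after `p`, so its sink at `p` goes to the
crossing of height zero on the new second arc. -/
theorem exists_snkRel (a : D.Snk) : ∃ a' σ, SnkRel D D' p q a a' σ := by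
  obtain ⟨⟨u, v⟩, h⟩ := a
  simp only at h
  rcases P.cr_cases h with hz | ⟨rfl, -, h1, -, -, -, -, -, h2, h3⟩ | ⟨rfl, -, -, -, -, -, -, -, h2, h3⟩
  · exact ⟨⟨(u, v), (P.cr_zone hz).1 h⟩, _, Or.inl ⟨hz, rfl, rfl⟩⟩
  · have := h3 v h1 le_rfl
    rcases (show 1 ≤ D.K u from h2).lt_or_eq with h4 | h4
    · obtain ⟨t, ht, -, ht'⟩ := P.exists_cr_p' (h := D.K u - 1) (by omega) (by omega)
      exact ⟨⟨(v, t), ht⟩, _, Or.inr (Or.inl ⟨rfl, rfl, by simp only; omega, rfl⟩)⟩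
    · obtain ⟨m, hm, hm'⟩ := P.exists_cr_q' (h := 0) le_rfl (D'.H_nonneg _)
      exact ⟨⟨(q, m), hm⟩, _, Or.inr (Or.inr (Or.inl ⟨rfl, h4.symm, rfl, hm', rfl⟩))⟩
  · have h5 := h3 v h.1 le_rfl
    rw [← P.heights_p_q.2.2.2.2] at h5
    obtain ⟨m, hm, hm'⟩ := P.exists_cr_q' h2.le h5
    exact ⟨⟨(v, m), hm⟩, _, Or.inr (Or.inr (Or.inr ⟨rfl, rfl, hm', rfl⟩))⟩

theorem exists_snkRel' (a' : D'.Snk) : ∃ a σ, SnkRel D D' p q a a' σ := by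
  obtain ⟨⟨u, v⟩, h⟩ := a'
  simp only at h
  have e := P.heights_p_q.2.2.2.2
  rcases P.cr_cases' h with hz | ⟨rfl, h1, -, -, -, -, -, h2, h3⟩ | ⟨rfl, h1, -, -, -, -, -, h3⟩
  · exact ⟨⟨(u, v), (P.cr_zone hz).2 h⟩, _, Or.inl ⟨hz, rfl, rfl⟩⟩
  · have := h3 u le_rfl h1
    obtain ⟨c, hc, hc'⟩ := P.exists_cr_p (h := D.K v + 1) (by omega) (by omega)
    exact ⟨⟨(c, u), hc⟩, _, Or.inr (Or.inl ⟨rfl, rfl, hc', rfl⟩)⟩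
  · have h4 := D'.H_nonneg v
    have h5 : D'.H v ≤ D'.H u := by
      rcases h1.lt_or_eq with h5 | rfl
      · exact (h3 u le_rfl h5).le
      · exact le_rfl
    rcases h4.lt_or_eq with h6 | h6
    · obtain ⟨b, hb, -, hb'⟩ := P.exists_cr_q (h := D'.H v) h6 (by omega)
      exact ⟨⟨(b, u), hb⟩, _, Or.inr (Or.inr (Or.inr ⟨rfl, rfl, hb'.symm, rfl⟩))⟩
    · have h7 := D.letter_one P.letter_p
      have h8 := D.K_nonneg (p - 1)
      obtain ⟨c, hc, hc'⟩ := P.exists_cr_p (h := 1) (by omega) (by omega)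
      exact ⟨⟨(c, p), hc⟩, _, Or.inr (Or.inr (Or.inl ⟨rfl, hc', rfl, h6.symm, rfl⟩))⟩

/-- Sources keep the arc on which an undisturbed piece leaves. At `p` it leaves to the left, at `q`
to the right, so levels are shifted by one against the rule for sinks. -/
theorem exists_srcRel (a : D.Src) : ∃ a' σ, SrcRel D D' p q a a' σ := by
  obtain ⟨⟨u, v⟩, h, hlt⟩ := a
  simp only at h hlt
  rcases P.cr_cases h with hz | ⟨rfl, -, h1, -, -, -, -, -, h2, h3⟩ | ⟨rfl, -, -, -, -, -, -, -, h2, h3⟩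
  · exact ⟨⟨(u, v), (P.cr_zone hz).1 h, hlt⟩, _, Or.inl ⟨hz, rfl, rfl⟩⟩
  · have h4 := h3 (v - 1) (by omega) (by omega)
    have h5 := D.letter_one P.letter_p
    obtain ⟨t, ht, ht', ht''⟩ := P.exists_cr_p' (h := D.K u) h2 (by omega)
    exact ⟨⟨(v, t), ht, ht'⟩, _, Or.inr (Or.inl ⟨rfl, rfl, ht''.symm, rfl⟩)⟩
  · have h5 := h3 v h.1 le_rfl
    have e := P.heights_p_q.2.2.2.2
    obtain ⟨m, hm, hm'⟩ := P.exists_cr_q' (h := D.H u - 1) (by omega) (by omega)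
    have hne : v ≠ m := by rintro rfl; omega
    exact ⟨⟨(v, m), hm, lt_of_le_of_ne hm.1 hne⟩, _, Or.inr (Or.inr ⟨rfl, rfl, by simp only; omega, rfl⟩)⟩

theorem exists_srcRel' (a' : D'.Src) : ∃ a σ, SrcRel D D' p q a a' σ := by
  obtain ⟨⟨u, v⟩, h, hlt⟩ := a'
  simp only at h hlt
  have e := P.heights_p_q.2.2.2.2
  rcases P.cr_cases' h with hz | ⟨rfl, h1, -, -, -, -, -, h2, h3⟩ | ⟨rfl, h1, -, -, -, -, -, h3⟩
  · exact ⟨⟨(u, v), (P.cr_zone hz).2 h, hlt⟩, _, Or.inl ⟨hz, rfl, rfl⟩⟩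
  · have h4 := h3 u le_rfl h1
    obtain ⟨c, hc, hc'⟩ := P.exists_cr_p (h := D.K v) (by omega) (by omega)
    have hne : c ≠ u := by rintro rfl; omega
    exact ⟨⟨(c, u), hc, lt_of_le_of_ne hc.1 hne⟩, _, Or.inr (Or.inl ⟨rfl, rfl, hc', rfl⟩)⟩
  · have h4 := D'.H_nonneg v
    have h5 := h3 u le_rfl hlt
    obtain ⟨b, hb, hb', hb''⟩ := P.exists_cr_q (h := D'.H v + 1) (by omega) (by omega)
    exact ⟨⟨(b, u), hb, hb'⟩, _, Or.inr (Or.inr ⟨rfl, rfl, hb'', rfl⟩)⟩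

theorem not_zone_left {u : ℕ} (h : u ≤ p) : ¬ Zone p q u p := by
  have := P.lt
  unfold Zone
  omega

/-- Crossings at `p` and at `q` are determined by their levels. -/
theorem cr_p_unique {c c' : ℕ} (h : D.Cr c p) (h' : D.Cr c' p) (hK : D.K c = D.K c') : c = c' := by
  have hlt := P.lt
  rcases P.cr_cases h with hz | ⟨-, -, -, -, -, -, h1, h2, -⟩ | ⟨h1, -⟩
  · exact (P.not_zone_left h.1 hz).elim
  · rcases P.cr_cases h' with hz | ⟨-, -, -, -, -, -, h1', h2', -⟩ | ⟨h1', -⟩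
    · exact (P.not_zone_left h'.1 hz).elim
    · exact (h.eq_of_second h' (by omega) (by omega)).1
    · omega
  · omega

theorem cr_q_unique {c c' : ℕ} (h : D.Cr c q) (h' : D.Cr c' q) (hH : D.H c = D.H c') : c = c' := by
  have hlt := P.lt
  have nz {c : ℕ} (h : c ≤ q) : ¬ Zone p q c q := by unfold Zone; omega
  rcases P.cr_cases h with hz | ⟨h1, -⟩ | ⟨-, -, -, -, h1, h2, -⟩
  · exact (nz h.1 hz).elim
  · omega
  · rcases P.cr_cases h' with hz | ⟨h1', -⟩ | ⟨-, -, -, -, h1', h2', -⟩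
    · exact (nz h'.1 hz).elim
    · omega
    · exact (h.eq_of_first h' (by omega) (by omega)).1

theorem cr_p_unique' {t t' : ℕ} (h : D'.Cr p t) (h' : D'.Cr p t') (hK : D.K t = D.K t') : t = t' := by
  have hlt := P.lt
  have nz {c : ℕ} (h : p ≤ c) : ¬ Zone p q p c := by unfold Zone; omega
  rcases P.cr_cases' h with hz | ⟨-, -, -, -, -, h1, h2, -⟩ | ⟨h1, -⟩
  · exact (nz h.1 hz).elim
  · rcases P.cr_cases' h' with hz | ⟨-, -, -, -, -, h1', h2', -⟩ | ⟨h1', -⟩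
    · exact (nz h'.1 hz).elim
    · exact (h.eq_of_second h' (by omega) (by omega)).2
    · omega
  · omega

theorem cr_q_unique' {m m' : ℕ} (h : D'.Cr q m) (h' : D'.Cr q m') (hH : D'.H m = D'.H m') : m = m' := by
  have hlt := P.lt
  have nz {c : ℕ} (h : q ≤ c) : ¬ Zone p q q c := by unfold Zone; omega
  rcases P.cr_cases' h with hz | ⟨h1, -⟩ | ⟨-, -, -, h1, h2, -⟩
  · exact (nz h.1 hz).elim
  · omega
  · rcases P.cr_cases' h' with hz | ⟨h1', -⟩ | ⟨-, -, -, h1', h2', -⟩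
    · exact (nz h'.1 hz).elim
    · omega
    · exact (h.eq_of_first h' (by omega) (by omega)).2

theorem K_pos_of_cr' {t : ℕ} (h : D'.Cr p t) : 0 < D.K t := by
  have hlt := P.lt
  have nz {c : ℕ} (h : p ≤ c) : ¬ Zone p q p c := by unfold Zone; omega
  rcases P.cr_cases' h with hz | ⟨-, -, -, -, -, h1, h2, h3, -⟩ | ⟨h1, -⟩
  · exact (nz h.1 hz).elim
  · exact h3
  · omega

theorem H_pos_of_cr {b : ℕ} (h : D.Cr b q) : 0 < D.H b := by
  have hlt := P.lt
  have nz {c : ℕ} (h : c ≤ q) : ¬ Zone p q c q := by unfold Zone; omega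
  rcases P.cr_cases h with hz | ⟨h1, -⟩ | ⟨-, -, -, -, h1, h2, -, -, h3, -⟩
  · exact (nz h.1 hz).elim
  · omega
  · exact h3

theorem SnkRel.right_unique {a : D.Snk} {a' b' : D'.Snk} {σ τ : Equiv.Perm (Fin 3)}
    (h : SnkRel D D' p q a a' σ) (h' : SnkRel D D' p q a b' τ) : a' = b' ∧ σ = τ := by
  have hlt := P.lt
  obtain ⟨⟨u, v⟩, ha⟩ := a
  obtain ⟨⟨u', v'⟩, ha'⟩ := a'
  obtain ⟨⟨u'', v''⟩, ha''⟩ := b'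
  have hle := ha.1
  simp only [SnkRel, Prod.mk.injEq, Subtype.mk.injEq, and_assoc] at h h' ha ha' ha'' hle ⊢
  have nz : Zone p q u v → v ≠ p ∧ v ≠ q := by unfold Zone; omega
  have U1 : u' = p → u'' = p → D.K v' = D.K v'' → v' = v'' := fun e1 e2 e3 =>
    P.cr_p_unique' (by rwa [e1] at ha') (by rwa [e2] at ha'') e3
  have U2 : u' = q → u'' = q → D'.H v' = D'.H v'' → v' = v'' := fun e1 e2 e3 =>
    P.cr_q_unique' (by rwa [e1] at ha') (by rwa [e2] at ha'') e3
  have K1 : u' = p → 0 < D.K v' := fun e1 => P.K_pos_of_cr' (by rwa [e1] at ha')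
  have K2 : u'' = p → 0 < D.K v'' := fun e1 => P.K_pos_of_cr' (by rwa [e1] at ha'')
  rcases h with ⟨z, e1, e2, s⟩ | ⟨e1, e2, e3, s⟩ | ⟨e1, e2, e3, e4, s⟩ | ⟨e1, e2, e3, s⟩ <;>
    rcases h' with ⟨z', f1, f2, s'⟩ | ⟨f1, f2, f3, s'⟩ | ⟨f1, f2, f3, f4, s'⟩ | ⟨f1, f2, f3, s'⟩ <;>
    first
    | exact ⟨by omega, by omega, s.trans s'.symm⟩
    | exact absurd (nz z) (by omega)
    | exact absurd (nz z') (by omega)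
    | omega

theorem SnkRel.left_unique {a b : D.Snk} {a' : D'.Snk} {σ τ : Equiv.Perm (Fin 3)}
    (h : SnkRel D D' p q a a' σ) (h' : SnkRel D D' p q b a' τ) : a = b ∧ σ = τ := by
  have hlt := P.lt
  obtain ⟨⟨u', v'⟩, ha'⟩ := a
  obtain ⟨⟨u'', v''⟩, ha''⟩ := b
  obtain ⟨⟨u, v⟩, ha⟩ := a'
  have hle := ha.1
  simp only [SnkRel, Prod.mk.injEq, Subtype.mk.injEq, and_assoc] at h h' ha ha' ha'' hle ⊢
  have nz {u' v'} (z : Zone p q u' v') (e1 : u = u') (e2 : v = v') : u ≠ p ∧ u ≠ q := by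
    unfold Zone at z; omega
  have U1 : v' = p → v'' = p → D.K u' = D.K u'' → u' = u'' := fun e1 e2 e3 =>
    P.cr_p_unique (by rwa [e1] at ha') (by rwa [e2] at ha'') e3
  have U2 : v' = q → v'' = q → D.H u' = D.H u'' → u' = u'' := fun e1 e2 e3 =>
    P.cr_q_unique (by rwa [e1] at ha') (by rwa [e2] at ha'') e3
  have K1 : v' = q → 0 < D.H u' := fun e1 => P.H_pos_of_cr (by rwa [e1] at ha')
  have K2 : v'' = q → 0 < D.H u'' := fun e1 => P.H_pos_of_cr (by rwa [e1] at ha'')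
  rcases h with ⟨z, e1, e2, s⟩ | ⟨e1, e2, e3, s⟩ | ⟨e1, e2, e3, e4, s⟩ | ⟨e1, e2, e3, s⟩ <;>
    rcases h' with ⟨z', f1, f2, s'⟩ | ⟨f1, f2, f3, s'⟩ | ⟨f1, f2, f3, f4, s'⟩ | ⟨f1, f2, f3, s'⟩ <;>
    first
    | exact ⟨by omega, by omega, s.trans s'.symm⟩
    | exact absurd (nz z e1 e2) (by omega)
    | exact absurd (nz z' f1 f2) (by omega)
    | omega

theorem SrcRel.right_unique {a : D.Src} {a' b' : D'.Src} {σ τ : Equiv.Perm (Fin 3)}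
    (h : SrcRel D D' p q a a' σ) (h' : SrcRel D D' p q a b' τ) : a' = b' ∧ σ = τ := by
  have hlt := P.lt
  obtain ⟨⟨u, v⟩, ha, hl⟩ := a
  obtain ⟨⟨u', v'⟩, ha', hl'⟩ := a'
  obtain ⟨⟨u'', v''⟩, ha'', hl''⟩ := b'
  have hle := ha.1
  simp only [SrcRel, Prod.mk.injEq, Subtype.mk.injEq, and_assoc] at h h' ha ha' ha'' hle ⊢
  have nz : Zone p q u v → v ≠ p ∧ v ≠ q := by unfold Zone; omega
  have U1 : u' = p → u'' = p → D.K v' = D.K v'' → v' = v'' := fun e1 e2 e3 =>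
    P.cr_p_unique' (by rwa [e1] at ha') (by rwa [e2] at ha'') e3
  have U2 : u' = q → u'' = q → D'.H v' = D'.H v'' → v' = v'' := fun e1 e2 e3 =>
    P.cr_q_unique' (by rwa [e1] at ha') (by rwa [e2] at ha'') e3
  rcases h with ⟨z, e1, e2, s⟩ | ⟨e1, e2, e3, s⟩ | ⟨e1, e2, e3, s⟩ <;>
    rcases h' with ⟨z', f1, f2, s'⟩ | ⟨f1, f2, f3, s'⟩ | ⟨f1, f2, f3, s'⟩ <;>
    first
    | exact ⟨by omega, by omega, s.trans s'.symm⟩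
    | exact absurd (nz z) (by omega)
    | exact absurd (nz z') (by omega)
    | omega

theorem SrcRel.left_unique {a b : D.Src} {a' : D'.Src} {σ τ : Equiv.Perm (Fin 3)}
    (h : SrcRel D D' p q a a' σ) (h' : SrcRel D D' p q b a' τ) : a = b ∧ σ = τ := by
  have hlt := P.lt
  obtain ⟨⟨u', v'⟩, ha', hl'⟩ := a
  obtain ⟨⟨u'', v''⟩, ha'', hl''⟩ := b
  obtain ⟨⟨u, v⟩, ha, hl⟩ := a'
  have hle := ha.1
  simp only [SrcRel, Prod.mk.injEq, Subtype.mk.injEq, and_assoc] at h h' ha ha' ha'' hle ⊢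
  have nz {u' v'} (z : Zone p q u' v') (e1 : u = u') (e2 : v = v') : u ≠ p ∧ u ≠ q := by
    unfold Zone at z; omega
  have U1 : v' = p → v'' = p → D.K u' = D.K u'' → u' = u'' := fun e1 e2 e3 =>
    P.cr_p_unique (by rwa [e1] at ha') (by rwa [e2] at ha'') e3
  have U2 : v' = q → v'' = q → D.H u' = D.H u'' → u' = u'' := fun e1 e2 e3 =>
    P.cr_q_unique (by rwa [e1] at ha') (by rwa [e2] at ha'') e3
  rcases h with ⟨z, e1, e2, s⟩ | ⟨e1, e2, e3, s⟩ | ⟨e1, e2, e3, s⟩ <;>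
    rcases h' with ⟨z', f1, f2, s'⟩ | ⟨f1, f2, f3, s'⟩ | ⟨f1, f2, f3, s'⟩ <;>
    first
    | exact ⟨by omega, by omega, s.trans s'.symm⟩
    | exact absurd (nz z e1 e2) (by omega)
    | exact absurd (nz z' f1 f2) (by omega)
    | omega

theorem HERel.right_unique {d : D.HE} {d₁ d₂ : D'.HE} (h₁ : HERel D D' p q d d₁)
    (h₂ : HERel D D' p q d d₂) : d₁ = d₂ := by
  obtain ⟨i, rfl, rfl⟩ | ⟨a, a', σ, t, h, rfl, rfl⟩ | ⟨a, a', σ, t, h, rfl, rfl⟩ := h₁ <;>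
    obtain ⟨j, h1, rfl⟩ | ⟨b, b', τ, t', h', h1, rfl⟩ | ⟨b, b', τ, t', h', h1, rfl⟩ := h₂ <;>
    simp only [Sum.inl.injEq, Sum.inr.injEq, Prod.mk.injEq, reduceCtorEq, false_and] at h1
  · rw [(finRotate N).injective h1]
  · obtain ⟨rfl, rfl⟩ := h1
    obtain ⟨rfl, rfl⟩ := h.right_unique P h'
    rfl
  · obtain ⟨rfl, rfl⟩ := h1
    obtain ⟨rfl, rfl⟩ := h.right_unique P h'
    rfl

theorem exists_equiv : ∃ φ : D.HE ≃ D'.HE, ∀ d, HERel D D' p q d (φ d) := by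
  apply exists_equiv_of_rel
  · rintro (i | ⟨a | a, t⟩)
    · exact ⟨_, Or.inl ⟨(finRotate N).symm i, congrArg Sum.inl ((finRotate N).apply_symm_apply i).symm, rfl⟩⟩
    · obtain ⟨a', σ, h⟩ := P.exists_snkRel a
      exact ⟨_, Or.inr (Or.inl ⟨a, a', σ, t, h, rfl, rfl⟩)⟩
    · obtain ⟨a', σ, h⟩ := P.exists_srcRel a
      exact ⟨_, Or.inr (Or.inr ⟨a, a', σ, t, h, rfl, rfl⟩)⟩
  · rintro (i | ⟨a' | a', t⟩)
    · exact ⟨_, Or.inl ⟨i, rfl, rfl⟩⟩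
    · obtain ⟨a, σ, h⟩ := P.exists_snkRel' a'
      exact ⟨_, Or.inr (Or.inl ⟨a, a', σ, σ.symm t, h, rfl, by simp⟩)⟩
    · obtain ⟨a, σ, h⟩ := P.exists_srcRel' a'
      exact ⟨_, Or.inr (Or.inr ⟨a, a', σ, σ.symm t, h, rfl, by simp⟩)⟩
  · exact fun _ _ _ h h' => h.right_unique P h'
  · rintro d₁ d₂ d (⟨i, rfl, rfl⟩ | ⟨a, a', σ, t, h, rfl, rfl⟩ | ⟨a, a', σ, t, h, rfl, rfl⟩)
      (⟨j, rfl, h1⟩ | ⟨b, b', τ, t', h', rfl, h1⟩ | ⟨b, b', τ, t', h', rfl, h1⟩) <;>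
      simp only [Sum.inl.injEq, Sum.inr.injEq, Prod.mk.injEq, reduceCtorEq, false_and] at h1
    · rw [h1]
    · obtain ⟨rfl, h2⟩ := h1
      obtain ⟨rfl, rfl⟩ := h.left_unique P h'
      rw [σ.injective h2]
    · obtain ⟨rfl, h2⟩ := h1
      obtain ⟨rfl, rfl⟩ := h.left_unique P h'
      rw [σ.injective h2]

/-- The type of a crossing determines the orientation of its three colours. The type changes exactly
when the colours are permuted by a transposition, and the cyclic permutation keeps both. -/
theorem HERel.ccw {d : D.HE} {d' : D'.HE} (h : HERel D D' p q d d') :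
    HERel D D' p q (D.graph.ccw d) (D'.graph.ccw d') := by
  have key : ∀ (a : D.Snk ⊕ D.Src) (a' : D'.Snk ⊕ D'.Src) (σ : Equiv.Perm (Fin 3)) (t : Fin 3),
      (D'.letter (Sum.elim (fun p => p.1.1) (fun p => p.1.1) a') =
        D.letter (Sum.elim (fun p => p.1.1) (fun p => p.1.1) a) ∧ (σ = 1 ∨ σ = Equiv.addRight 1)) ∨
      ((D'.letter (Sum.elim (fun p => p.1.1) (fun p => p.1.1) a') = 1 ↔
        D.letter (Sum.elim (fun p => p.1.1) (fun p => p.1.1) a) ≠ 1) ∧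
        (σ = Equiv.swap 0 2 ∨ σ = Equiv.swap 1 2)) → D'.ccwAt a' (σ t) = σ (D.ccwAt a t) := by
    rintro a a' σ t (⟨h1, h2⟩ | ⟨h1, h2⟩)
    · unfold ccwAt
      rw [h1]
      rcases h2 with rfl | rfl <;> split_ifs <;> revert t <;> decide
    · by_cases hy : D.letter (Sum.elim (fun p => p.1.1) (fun p => p.1.1) a) = 1
      · rw [ccwAt, ccwAt, if_pos hy, if_neg (by rw [h1]; exact not_not_intro hy)]
        rcases h2 with rfl | rfl <;> revert t <;> decide
      · rw [ccwAt, ccwAt, if_neg hy, if_pos (h1.2 hy)]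
        rcases h2 with rfl | rfl <;> revert t <;> decide
  have hlt := P.lt
  have lp' := P.letter_p'
  have lq' := P.letter_q'
  rcases h with ⟨i, rfl, rfl⟩ | ⟨a, a', σ, t, h, rfl, rfl⟩ | ⟨a, a', σ, t, h, rfl, rfl⟩
  · exact Or.inl ⟨i, rfl, rfl⟩
  · refine Or.inr (Or.inl ⟨a, a', σ, D.ccwAt (Sum.inl a) t, h, rfl, ?_⟩)
    refine congrArg Sum.inr (Prod.ext rfl (key (Sum.inl a) (Sum.inl a') σ t ?_))
    obtain ⟨⟨u, v⟩, ha⟩ := a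
    obtain ⟨⟨u', v'⟩, ha'⟩ := a'
    simp only [SnkRel, Prod.mk.injEq, Sum.elim_inl] at h ⊢ ha
    rcases h with ⟨h1, ⟨rfl, rfl⟩, rfl⟩ | ⟨rfl, rfl, h3, rfl⟩ | ⟨rfl, h1, rfl, h4, rfl⟩ | ⟨rfl, rfl, h3, rfl⟩
    · exact Or.inl ⟨(P.letter_zone h1 ha.1 (le_of_cr ha)).1, Or.inl rfl⟩
    · rcases P.cr_cases ha with hz | ⟨-, -, -, h5, -⟩ | ⟨h5, -⟩
      · exact (P.not_zone_left ha.1 hz).elim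
      · exact Or.inr ⟨by omega, Or.inl rfl⟩
      · omega
    · rcases P.cr_cases ha with hz | ⟨-, -, -, h5, -⟩ | ⟨h5, -⟩
      · exact (P.not_zone_left ha.1 hz).elim
      · exact Or.inl ⟨by omega, Or.inr rfl⟩
      · omega
    · rcases P.cr_cases ha with hz | ⟨h5, -⟩ | ⟨-, -, -, h5, -⟩
      · have := ha.1
        unfold Zone at hz
        omega
      · omega
      · exact Or.inr ⟨by omega, Or.inr rfl⟩
  · refine Or.inr (Or.inr ⟨a, a', σ, D.ccwAt (Sum.inr a) t, h, rfl, ?_⟩)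
    refine congrArg Sum.inr (Prod.ext rfl (key (Sum.inr a) (Sum.inr a') σ t ?_))
    obtain ⟨⟨u, v⟩, ha, hl⟩ := a
    obtain ⟨⟨u', v'⟩, ha', hl'⟩ := a'
    simp only [SrcRel, Prod.mk.injEq, Sum.elim_inr] at h ⊢ ha
    rcases h with ⟨h1, ⟨rfl, rfl⟩, rfl⟩ | ⟨rfl, rfl, h3, rfl⟩ | ⟨rfl, rfl, h3, rfl⟩
    · exact Or.inl ⟨(P.letter_zone h1 ha.1 (le_of_cr ha)).1, Or.inl rfl⟩
    · rcases P.cr_cases ha with hz | ⟨-, -, -, h5, -⟩ | ⟨h5, -⟩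
      · exact (P.not_zone_left ha.1 hz).elim
      · exact Or.inr ⟨by omega, Or.inl rfl⟩
      · omega
    · rcases P.cr_cases ha with hz | ⟨h5, -⟩ | ⟨-, -, -, h5, -⟩
      · have := ha.1
        unfold Zone at hz
        omega
      · omega
      · exact Or.inr ⟨by omega, Or.inr rfl⟩

end Promotes

/-! ### Pieces of strands that survive promotion -/

namespace Promotes

open LatticeWord

variable {N : ℕ} {D : LatticeWord 0 N} {D' : LatticeWord 1 N} {p q : ℕ}

theorem HERel.snk_inv {a : D.Snk} {t : Fin 3} {e' : D'.HE}
    (h : HERel D D' p q (Sum.inr (Sum.inl a, t)) e') :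
    ∃ a' σ, SnkRel D D' p q a a' σ ∧ e' = Sum.inr (Sum.inl a', σ t) := by
  obtain ⟨i, h1, -⟩ | ⟨b, a', σ, t', h, h1, rfl⟩ | ⟨b, a', σ, t', h, h1, -⟩ := h <;> cases h1
  exact ⟨a', σ, h, rfl⟩

theorem HERel.src_inv {a : D.Src} {t : Fin 3} {e' : D'.HE}
    (h : HERel D D' p q (Sum.inr (Sum.inr a, t)) e') :
    ∃ a' σ, SrcRel D D' p q a a' σ ∧ e' = Sum.inr (Sum.inr a', σ t) := by
  obtain ⟨i, h1, -⟩ | ⟨b, a', σ, t', h, h1, -⟩ | ⟨b, a', σ, t', h, h1, rfl⟩ := h <;> cases h1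
  exact ⟨a', σ, h, rfl⟩

theorem HERel.bdry_inv {j : Fin N} {d' : D'.HE} (h : HERel D D' p q (Sum.inl j) d') :
    ∃ i : Fin N, d' = Sum.inl i ∧ ((j : ℕ) = 0 ∧ (i : ℕ) + 1 = N ∨ (j : ℕ) = i + 1) := by
  obtain ⟨i, h1, rfl⟩ | ⟨b, a', σ, t', h, h1, -⟩ | ⟨b, a', σ, t', h, h1, -⟩ := h
  · cases h1
    refine ⟨i, rfl, ?_⟩
    have h2 := finRotate_symm_val (finRotate N i)
    rw [Equiv.symm_apply_apply] at h2
    split_ifs at h2 <;> omega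
  · cases h1
  · cases h1

variable (P : Promotes D D' p q)
include P

theorem cr_p_data {c : ℕ} (h : D.Cr c p) : 1 < c ∧ c ≤ p ∧ D.lev1 (c, p) = 1 ∧ D.key1 (c, p) = c ∧
    D.lev2 (c, p) = D.K c ∧ D.key2 (c, p) = p ∧ 0 < D.K c ∧ (∀ j, c ≤ j → j ≤ p → D.K c ≤ D.K j) := by
  have := P.lt
  rcases P.cr_cases h with hz | ⟨-, h1, h2, -, h3⟩ | ⟨h1, -⟩
  · exact (P.not_zone_left h.1 hz).elim
  · exact ⟨h1, h2, h3⟩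
  · omega

theorem cr_q_data {b : ℕ} (h : D.Cr b q) : p < b ∧ b < q ∧ D.lev1 (b, q) = D.H b ∧ D.key1 (b, q) = q ∧
    D.lev2 (b, q) = 1 ∧ D.key2 (b, q) = b ∧ 0 < D.H b ∧ (∀ j, b ≤ j → j ≤ q → D.H b ≤ D.H j) := by
  have := P.lt
  rcases P.cr_cases h with hz | ⟨h1, -⟩ | ⟨-, h1, h2, -, h3⟩
  · have := h.1; unfold Zone at hz; omega
  · omega
  · exact ⟨h1, h2, h3⟩

theorem cr_p_data' {t : ℕ} (h : D'.Cr p t) : p < t ∧ t < q ∧ D'.lev1 (p, t) = 1 ∧ D'.key1 (p, t) = t ∧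
    D'.lev2 (p, t) = D.K t ∧ D'.key2 (p, t) = p ∧ 0 < D.K t ∧ (∀ j, p ≤ j → j < t → D.K t < D.K j) := by
  have := P.lt
  rcases P.cr_cases' h with hz | ⟨-, h1⟩ | ⟨h1, -⟩
  · have := h.1; unfold Zone at hz; omega
  · exact h1
  · omega

theorem cr_q_data' {m : ℕ} (h : D'.Cr q m) : q ≤ m ∧ m ≤ N ∧ D'.lev1 (q, m) = D'.H m + 1 ∧
    D'.key1 (q, m) = q ∧ D'.lev2 (q, m) = 1 ∧ D'.key2 (q, m) = m ∧
    (∀ j, q ≤ j → j < m → D'.H m < D'.H j) := by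
  have := P.lt
  rcases P.cr_cases' h with hz | ⟨h1, -⟩ | ⟨-, h1⟩
  · have := h.1; unfold Zone at hz; omega
  · omega
  · exact h1

/-- Away from the disappearing arc from `1` to `p`, positions are kept and levels follow the
heights. The piece arrives from the left, so the change of height is taken at `k - 1`. -/
theorem in1_map {e : D.HE} {e' : D'.HE} {h : ℤ} {k : ℕ} (he : In1 e h k) (hk : ¬ (h = 1 ∧ k ≤ p))
    (hr : HERel D D' p q e e') : In1 e' (h + D'.H (k - 1) - D.H (k - 1)) k := by
  obtain ⟨⟨⟨u, v⟩, ha⟩, rfl, rfl, rfl⟩ := in1_iff.1 he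
  obtain ⟨⟨⟨u', v'⟩, ha'⟩, σ, hs, rfl⟩ := hr.snk_inv
  simp only [SnkRel, Prod.mk.injEq] at hs ha ha' hk ⊢
  rcases hs with ⟨hz, ⟨rfl, rfl⟩, rfl⟩ | ⟨rfl, -⟩ | ⟨rfl, -⟩ | ⟨rfl, rfl, h1, rfl⟩
  · obtain ⟨-, h1, -, h2, -, h3⟩ := P.zone_key hz ha
    have := (h3 (D.key1 (u', v') - 1) (by omega) (by omega)).1
    exact in1_iff.2 ⟨_, rfl, by simp only; omega, h1.symm⟩
  · have := P.cr_p_data ha; omega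
  · have := P.cr_p_data ha; omega
  · have h2 := P.cr_q_data ha
    have h3 := P.cr_q_data' ha'
    have h4 := P.heights (u' - 1)
    have h5 : D.key1 (u, u') = u' := by omega
    rw [h5]
    exact in1_iff.2 ⟨_, rfl, by simp only; omega, by simp only; omega⟩

/-- Conversely, a new sink off the appearing strand from `p` to `q` comes from an old sink. This
shows that no new sink interrupts a surviving piece. -/
theorem in1_back {e' : D'.HE} {g : ℤ} {k : ℕ} (he : In1 e' g k) (hk : ¬ (g = 1 ∧ p < k ∧ k ≤ q)) :
    ∃ e : D.HE, In1 e (g + D.H (k - 1) - D'.H (k - 1)) k := by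
  obtain ⟨a', rfl, rfl, rfl⟩ := in1_iff.1 he
  obtain ⟨⟨⟨u, v⟩, ha⟩, σ, hs⟩ := P.exists_snkRel' a'
  obtain ⟨⟨u', v'⟩, ha'⟩ := a'
  simp only [SnkRel, Prod.mk.injEq] at hs ha ha' hk ⊢
  rcases hs with ⟨hz, ⟨rfl, rfl⟩, rfl⟩ | ⟨-, rfl, -⟩ | ⟨-, -, rfl, h1, -⟩ | ⟨rfl, rfl, h1, rfl⟩
  · obtain ⟨-, h1, -, h2, -, h3⟩ := P.zone_key hz ha
    have := (h3 (D.key1 (u', v') - 1) (by omega) (by omega)).1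
    rw [h1]
    exact ⟨_, in1_iff.2 ⟨⟨(u', v'), ha⟩, rfl, by simp only; omega, rfl⟩⟩
  · have := P.cr_p_data' ha'; omega
  · have := P.cr_q_data' ha'; have := P.lt; omega
  · have h2 := P.cr_q_data ha
    have h3 := P.cr_q_data' ha'
    have h4 := P.heights (u' - 1)
    have h5 : D'.key1 (u', v') = u' := by omega
    rw [h5]
    exact ⟨_, in1_iff.2 ⟨⟨(u, u'), ha⟩, rfl, by simp only; omega, by simp only; omega⟩⟩

/-- The outgoing piece runs to the right, so here the height change counts at `k` itself. -/
theorem out1_map {d : D.HE} {d' : D'.HE} {h : ℤ} {k : ℕ} (hd : Out1 d h k) (hk : ¬ (h = 1 ∧ k < p))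
    (hr : HERel D D' p q d d') : Out1 d' (h + D'.H k - D.H k) k := by
  obtain ⟨i, rfl, hl, rfl, rfl⟩ | ⟨⟨⟨u, v⟩, ha, hlt⟩, rfl, rfl, rfl⟩ := out1_iff.1 hd
  · obtain ⟨j, rfl, hj⟩ := hr.bdry_inv
    have hN := P.le
    have c1 := P.one_lt
    have c2 := P.lt
    -- The boundary vertex `1` starts the disappearing strand, so it is excluded by `hk`.
    have e0 : 0 + (i : ℕ) + 1 ≠ 1 := by
      intro hc
      rw [hc] at hk
      have := D.bot 0 P.letter_one
      have := D.eq_zero_of_le (k := 0) le_rfl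
      simp only [zero_add] at *
      omega
    have ep : 0 + (i : ℕ) + 1 ≠ p := by intro hc; rw [hc, P.letter_p] at hl; omega
    have eq : 0 + (i : ℕ) + 1 ≠ q := by intro hc; rw [hc, P.letter_q] at hl; omega
    have ej : 0 + (i : ℕ) + 1 = 1 + j + 1 := by omega
    have hl' := P.letter_eq (0 + i + 1) (by omega) (by omega) ep eq
    rw [ej] at hl hl' ⊢
    exact out1_iff.2 (Or.inl ⟨j, rfl, hl'.trans hl, by omega, rfl⟩)
  · obtain ⟨⟨⟨u', v'⟩, ha', hlt'⟩, σ, hs, rfl⟩ := hr.src_inv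
    simp only [SrcRel, Prod.mk.injEq] at hs ha ha' hk hlt ⊢
    rcases hs with ⟨hz, ⟨rfl, rfl⟩, rfl⟩ | ⟨rfl, -⟩ | ⟨rfl, rfl, h1, rfl⟩
    · obtain ⟨-, h1, -, h2, -, h3⟩ := P.zone_key hz ha
      have := (h3 (D.key1 (u', v')) (by omega) (by omega)).1
      exact out1_iff.2 (Or.inr ⟨_, rfl, by simp only; omega, h1.symm⟩)
    · have := P.cr_p_data ha; omega
    · have h2 := P.cr_q_data ha
      have h3 := P.cr_q_data' ha'
      have h4 := P.heights_p_q
      have h5 : D.key1 (u, u') = u' := by omega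
      rw [h5]
      exact out1_iff.2 (Or.inr ⟨_, rfl, by simp only; omega, by simp only; omega⟩)

/-- Second pieces arrive from the right, so the level changes with the height at `k`. Excluded is
the disappearing strand from `q` back to `p`. -/
theorem in2_map {e : D.HE} {e' : D'.HE} {h : ℤ} {k : ℕ} (he : In2 e h k)
    (hk : ¬ (h = 1 ∧ p ≤ k ∧ k < q)) (hr : HERel D D' p q e e') : In2 e' (h + D'.K k - D.K k) k := by
  obtain ⟨⟨⟨u, v⟩, ha⟩, rfl, rfl, rfl⟩ := in2_iff.1 he
  obtain ⟨⟨⟨u', v'⟩, ha'⟩, σ, hs, rfl⟩ := hr.snk_inv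
  have hlt := P.lt
  simp only [SnkRel, Prod.mk.injEq] at hs ha ha' hk ⊢
  rcases hs with ⟨hz, ⟨rfl, rfl⟩, rfl⟩ | ⟨rfl, rfl, h1, rfl⟩ | ⟨rfl, h1, -⟩ | ⟨rfl, -⟩
  · obtain ⟨-, -, h1, -, h2, h3⟩ := P.zone_key hz ha
    have := (h3 (D.key2 (u', v')) (by omega) (by omega)).2
    exact in2_iff.2 ⟨_, rfl, by simp only; omega, h1.symm⟩
  · have h2 := P.cr_p_data ha
    have h3 := P.cr_p_data' ha'
    have h4 := P.heights u'
    have h5 : D.key2 (u, u') = u' := by omega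
    rw [h5]
    exact in2_iff.2 ⟨_, rfl, by simp only; omega, by simp only; omega⟩
  · have := P.cr_p_data ha; omega
  · have := P.cr_q_data ha; omega

theorem in2_back {e' : D'.HE} {g : ℤ} {k : ℕ} (he : In2 e' g k) (hk : ¬ (g = 1 ∧ q ≤ k)) :
    ∃ e : D.HE, In2 e (g + D.K k - D'.K k) k := by
  obtain ⟨a', rfl, rfl, rfl⟩ := in2_iff.1 he
  obtain ⟨⟨⟨u, v⟩, ha⟩, σ, hs⟩ := P.exists_snkRel' a'
  obtain ⟨⟨u', v'⟩, ha'⟩ := a'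
  have hlt := P.lt
  simp only [SnkRel, Prod.mk.injEq] at hs ha ha' hk ⊢
  rcases hs with ⟨hz, ⟨rfl, rfl⟩, rfl⟩ | ⟨rfl, rfl, h1, rfl⟩ | ⟨-, -, rfl, -⟩ | ⟨-, rfl, -⟩
  · obtain ⟨-, -, h1, -, h2, h3⟩ := P.zone_key hz ha
    have := (h3 (D.key2 (u', v')) (by omega) (by omega)).2
    rw [h1]
    exact ⟨_, in2_iff.2 ⟨⟨(u', v'), ha⟩, rfl, by simp only; omega, rfl⟩⟩
  · have h2 := P.cr_p_data ha
    have h3 := P.cr_p_data' ha'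
    have h4 := P.heights u'
    have h5 : D'.key2 (u', v') = u' := by omega
    rw [h5]
    exact ⟨_, in2_iff.2 ⟨⟨(u, u'), ha⟩, rfl, by simp only; omega, by simp only; omega⟩⟩
  · have := P.cr_q_data' ha'; omega
  · have := P.cr_q_data' ha'; omega

theorem out2_map {d : D.HE} {d' : D'.HE} {h : ℤ} {k : ℕ} (hd : Out2 d h k)
    (hk : ¬ (h = 1 ∧ p < k ∧ k ≤ q)) (hr : HERel D D' p q d d') :
    Out2 d' (h + D'.K (k - 1) - D.K (k - 1)) k := by
  have c1 := P.one_lt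
  have c2 := P.lt
  obtain ⟨i, rfl, hl, rfl, rfl⟩ | ⟨⟨⟨u, v⟩, ha, hlt⟩, rfl, rfl, rfl⟩ := out2_iff.1 hd
  · obtain ⟨j, rfl, hj⟩ := hr.bdry_inv
    have hN := P.le
    have hKq := P.K_q
    have e0 : 0 + (i : ℕ) + 1 ≠ 1 := by intro hc; rw [hc, P.letter_one] at hl; omega
    have ep : 0 + (i : ℕ) + 1 ≠ p := by intro hc; rw [hc, P.letter_p] at hl; omega
    have eq : 0 + (i : ℕ) + 1 ≠ q := by intro hc; rw [hc] at hk; omega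
    have ej : 0 + (i : ℕ) + 1 = 1 + j + 1 := by omega
    have hl' := P.letter_eq (0 + i + 1) (by omega) (by omega) ep eq
    rw [ej] at hl hl' ep eq ⊢
    have h1 := D.letter_two hl
    have h2 := D'.letter_two (hl'.trans hl)
    refine out2_iff.2 (Or.inl ⟨j, rfl, hl'.trans hl, ?_, rfl⟩)
    omega
  · obtain ⟨⟨⟨u', v'⟩, ha', hlt'⟩, σ, hs, rfl⟩ := hr.src_inv
    simp only [SrcRel, Prod.mk.injEq] at hs ha ha' hk hlt ⊢
    rcases hs with ⟨hz, ⟨rfl, rfl⟩, rfl⟩ | ⟨rfl, rfl, h1, rfl⟩ | ⟨rfl, -⟩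
    · obtain ⟨-, -, h1, -, h2, h3⟩ := P.zone_key hz ha
      have := (h3 (D.key2 (u', v') - 1) (by omega) (by omega)).2
      exact out2_iff.2 (Or.inr ⟨_, rfl, by simp only; omega, h1.symm⟩)
    · have h2 := P.cr_p_data ha
      have h3 := P.cr_p_data' ha'
      have h4 := P.heights (u' - 1)
      have h5 : D.key2 (u, u') = u' := by omega
      rw [h5]
      exact out2_iff.2 (Or.inr ⟨_, rfl, by simp only; omega, by simp only; omega⟩)
    · have := P.cr_q_data ha; omega

/-- A piece of a strand of first arcs runs inside one block. -/
theorem first_block {d : D.HE} {h : ℤ} {k k' : ℕ} (hd : Out1 d h k) (hk : k < k')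
    (hc : ∀ (e' : D.HE) (j : ℕ), In1 e' h j → k < j → k' ≤ j) :
    1 ≤ k ∧ (k' ≤ p ∨ p ≤ k ∧ k' ≤ q ∨ q ≤ k) := by
  have S := D.strands1 hd.pos
  have h1 := (S.of_out k ⟨d, hd⟩).1
  have hpos := hd.pos
  have h0 := D.eq_zero_of_le (k := 0) le_rfl
  have hk1 : 1 ≤ k := by
    by_contra hk
    obtain rfl : k = 0 := by omega
    omega
  have hh (j : ℕ) (j1 : k ≤ j) (j2 : j < k') : h ≤ D.H j := by
    by_contra hj
    obtain ⟨i, ⟨e, hi⟩, h2, h3⟩ := S.in_of_drop h1 (by omega : D.H j < h) j1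
    have := hc e i hi h2
    omega
  refine ⟨hk1, ?_⟩
  have hHp := P.H_p
  -- No first strand runs over `p`, where `H` vanishes.
  have hp : ¬ (k ≤ p ∧ p < k') := fun hp => by
    have := hh p hp.1 hp.2
    omega
  have hlt := P.lt
  -- Every first strand over `q` crosses the old second arc ending there, so it has a sink at
  -- position `q`.
  by_cases hq : k < q ∧ q < k'
  · obtain ⟨b, hb, -, rfl⟩ := P.exists_cr_q hpos (hh q hq.1.le hq.2)
    have h2 := P.cr_q_data hb
    have := hc _ q (in1_iff.2 ⟨⟨(b, q), hb⟩, rfl, h2.2.2.1.symm, h2.2.2.2.1.symm⟩) hq.1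
    omega
  · omega

/-- A piece of a strand of second arcs runs inside one block. -/
theorem second_block {d : D.HE} {h : ℤ} {k k' : ℕ} (hd : Out2 d h k) (hk : k' < k)
    {e : D.HE} (he : In2 e h k') (hc : ∀ (e' : D.HE) (j : ℕ), In2 e' h j → j < k → j ≤ k') :
    1 ≤ k' ∧ k ≤ N ∧ (k ≤ p ∨ p ≤ k' ∧ k ≤ q ∨ q ≤ k') := by
  have S := D.strands2 hd.pos
  have hpos := hd.pos
  have h0 := D.eq_zero_of_le (k := 0) le_rfl
  have h1 := (S.of_out k' ⟨e, he⟩).1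
  have h2 := (S.of_in k ⟨d, hd⟩).2.1
  have hk1 : 1 ≤ k' := by
    by_contra hk
    obtain rfl : k' = 0 := by omega
    omega
  have hmin := (S.next_iff ⟨e, he⟩ ⟨d, hd⟩).2 (fun j ⟨e', hj⟩ => hc e' j hj)
  have hh (j : ℕ) (j1 : k' ≤ j) (j2 : j < k) : h ≤ D.K j := by
    by_contra hj
    obtain ⟨i, hi, h2, h3⟩ := S.in_of_drop h1 (by omega : D.K j < h) j1
    have := hmin i hi h2
    omega
  have hkN : k ≤ N := by
    by_contra hN
    have := D.eq_zero_of_ge (k := k - 1) (by omega)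
    omega
  refine ⟨hk1, hkN, ?_⟩
  have hKq := P.K_q
  have hq : ¬ (k' ≤ q ∧ q < k) := fun hq => by
    have := hh q hq.1 hq.2
    omega
  have hlt := P.lt
  by_cases hp : k' < p ∧ p < k
  · obtain ⟨c, hcr, rfl⟩ := P.exists_cr_p hpos (hh p hp.1.le hp.2)
    have h2 := P.cr_p_data hcr
    have := hc _ p (in2_iff.2 ⟨⟨(c, p), hcr⟩, rfl, h2.2.2.2.2.1.symm, h2.2.2.2.2.2.1.symm⟩) hp.2
    omega
  · omega

end Promotes

/-! ### Strands that promotion creates and destroys -/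

namespace Promotes

open LatticeWord

variable {N : ℕ} {D : LatticeWord 0 N} {D' : LatticeWord 1 N} {p q : ℕ} (P : Promotes D D' p q)
include P

/-- The sinks on the strand of first arcs of level one that starts at `p` in the new word. -/
theorem in1_created {e' : D'.HE} {j : ℕ} (he : In1 e' 1 j) (h1 : p < j) (h2 : j ≤ q) :
    j = q ∨ D'.Cr p j := by
  obtain ⟨⟨⟨u, v⟩, ha⟩, rfl, h3, rfl⟩ := in1_iff.1 he
  simp only at h1 h2 h3 ha ⊢
  rcases P.cr_cases' ha with hz | ⟨rfl, -, -, -, h4, -⟩ | ⟨rfl, -, -, -, h4, -⟩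
  · have := P.zone_lev1' hz ha h3.symm; omega
  · right; rwa [h4]
  · exact Or.inl h4

/-- The sinks on the strand of second arcs of level one that starts at `q` in the new word. -/
theorem in2_created {e' : D'.HE} {j : ℕ} (he : In2 e' 1 j) (h1 : q ≤ j) : D'.Cr q j := by
  obtain ⟨⟨⟨u, v⟩, ha⟩, rfl, h3, rfl⟩ := in2_iff.1 he
  simp only at h1 h3 ha ⊢
  rcases P.cr_cases' ha with hz | ⟨rfl, h4, h5, -, -, -, h6, -⟩ | ⟨rfl, -, -, -, -, -, h4, -⟩
  · have := P.zone_lev2' hz ha h3.symm; omega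
  · omega
  · rwa [h4]

/-- A piece of the new strand of first arcs of level one. -/
theorem edge_created1 {d' e' : D'.HE} {k k' : ℕ} (hd : Out1 d' 1 k) (he : In1 e' 1 k') (hpk : p ≤ k)
    (hkk : k < k') (hkq : k' ≤ q) (hc : ∀ t, D'.Cr p t → k < t → t < k' → False) : Edge d' e' := by
  refine .first _ _ 1 k k' hd he hkk fun e'' j hj hkj => ?_
  by_contra hlt
  rcases P.in1_created hj (by omega) (by omega) with h | h
  · omega
  · exact hc j h hkj (by omega)

/-- A piece of the new strand of second arcs of level one. -/
theorem edge_created2 {d' e' : D'.HE} {k k' : ℕ} (hd : Out2 d' 1 k) (he : In2 e' 1 k') (hqk : q ≤ k')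
    (hkk : k' < k) (hc : ∀ m, D'.Cr q m → k' < m → m < k → False) : Edge d' e' := by
  refine .second _ _ 1 k k' hd he hkk fun e'' j hj hkj => ?_
  by_contra hlt
  exact hc j (P.in2_created hj (by omega)) (by omega) hkj

theorem out1_p {i : Fin N} (hi : 1 + (i : ℕ) + 1 = p) : Out1 (D := D') (Sum.inl i) 1 p := by
  refine out1_iff.2 (Or.inl ⟨i, rfl, ?_, ?_, hi.symm⟩) <;> rw [hi]
  · exact P.letter_p'
  · exact P.heights_p_q.2.1.symm

theorem in1_p {t : ℕ} (h : D'.Cr p t) :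
    In1 (D := D') (Sum.inr (Sum.inl ⟨(p, t), h⟩, 0)) 1 t := by
  have := P.cr_p_data' h
  exact in1_iff.2 ⟨_, rfl, this.2.2.1.symm, this.2.2.2.1.symm⟩

theorem out1_p_src {t : ℕ} (h : D'.Cr p t ∧ p < t) :
    Out1 (D := D') (Sum.inr (Sum.inr ⟨(p, t), h⟩, 0)) 1 t := by
  have := P.cr_p_data' h.1
  exact out1_iff.2 (Or.inr ⟨_, rfl, this.2.2.1.symm, this.2.2.2.1.symm⟩)

theorem in1_q {m : ℕ} (h : D'.Cr q m) (h0 : D'.H m = 0) :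
    In1 (D := D') (Sum.inr (Sum.inl ⟨(q, m), h⟩, 0)) 1 q := by
  have := P.cr_q_data' h
  exact in1_iff.2 ⟨_, rfl, by simp only; omega, this.2.2.2.1.symm⟩

theorem in2_q {m : ℕ} (h : D'.Cr q m) :
    In2 (D := D') (Sum.inr (Sum.inl ⟨(q, m), h⟩, 1)) 1 m := by
  have := P.cr_q_data' h
  exact in2_iff.2 ⟨_, rfl, this.2.2.2.2.1.symm, this.2.2.2.2.2.1.symm⟩

theorem out2_q_src {m : ℕ} (h : D'.Cr q m ∧ q < m) :
    Out2 (D := D') (Sum.inr (Sum.inr ⟨(q, m), h⟩, 1)) 1 m := by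
  have := P.cr_q_data' h.1
  exact out2_iff.2 (Or.inr ⟨_, rfl, this.2.2.2.2.1.symm, this.2.2.2.2.2.1.symm⟩)

/-- Only the stem at `p` changes its kind: `p` now starts a first arc, and the old stem is its first
piece, up to the first crossing or, if `K p = 1`, up to `q`. -/
theorem edge_stem {i : Fin N} (hl : D.letter (0 + i + 1) = 1) {d' e' : D'.HE}
    (hd : HERel D D' p q (Sum.inl i) d')
    (he : HERel D D' p q (Sum.inr (Sum.inl ⟨(0 + i + 1, 0 + i + 1), D.cr_self hl⟩, 2)) e') :
    Edge d' e' := by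
  obtain ⟨j, rfl, hj⟩ := hd.bdry_inv
  obtain ⟨⟨⟨u', v'⟩, ha'⟩, σ, hs, rfl⟩ := he.snk_inv
  have c2 := P.lt
  have lq := P.letter_q
  have e0 : (i : ℕ) ≠ 0 := by
    intro hc
    rw [hc] at hl
    have := P.letter_one
    simp only [zero_add] at hl
    omega
  have ej : 0 + (i : ℕ) + 1 = 1 + j + 1 := by omega
  simp only [SnkRel, Prod.mk.injEq] at hs ha'
  rw [ej] at hl hs
  rcases hs with ⟨hz, ⟨rfl, rfl⟩, rfl⟩ | ⟨h1, rfl, h2, rfl⟩ | ⟨h1, h2, rfl, h3, rfl⟩ | ⟨h1, -⟩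
  · exact .stem j (((P.letter_zone hz le_rfl (by have := j.2; omega)).1).trans hl)
  · have h3 := P.cr_p_data' ha'
    rw [h1] at h2
    refine P.edge_created1 (P.out1_p h1) (P.in1_p ha') le_rfl h3.1 h3.2.1.le fun t ht h4 h5 => ?_
    have h6 := (P.cr_p_data' ht).2.2.2.2.2.2.2 _ le_rfl h4
    have h7 := h3.2.2.2.2.2.2.2 t h4.le h5
    omega
  · rw [h1] at h2
    refine P.edge_created1 (P.out1_p h1) (P.in1_q ha' h3) le_rfl c2 le_rfl fun t ht h4 h5 => ?_
    have h6 := (P.cr_p_data' ht).2.2.2.2.2.2.2 _ le_rfl h4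
    have h7 := (P.cr_p_data' ht).2.2.2.2.2.2.1
    omega
  · rw [h1] at hl
    omega

/-- Sink and source of an old crossing at `p` or `q` go to neighbouring new crossings, so the edge
between them becomes a piece of the appearing first or second strand. -/
theorem edge_new (a : D.Src) {d' e' : D'.HE} (hd : HERel D D' p q (Sum.inr (Sum.inr a, 2)) d')
    (he : HERel D D' p q (Sum.inr (Sum.inl ⟨a.1, a.2.1⟩, 2)) e') : Edge d' e' := by
  obtain ⟨⟨⟨u', v'⟩, ha'⟩, σ, hs, rfl⟩ := hd.src_inv
  obtain ⟨⟨⟨u'', v''⟩, ha''⟩, τ, hs', rfl⟩ := he.snk_inv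
  obtain ⟨⟨u, v⟩, ha, hlt⟩ := a
  have c2 := P.lt
  have nz : Zone p q u v → v ≠ p ∧ v ≠ q := by unfold Zone; simp only at hlt; omega
  simp only [SrcRel, SnkRel, Prod.mk.injEq] at hs hs' ha' ha'' ha hlt
  rcases hs with ⟨hz, ⟨rfl, rfl⟩, rfl⟩ | ⟨h1, rfl, h2, rfl⟩ | ⟨h1, rfl, h2, rfl⟩
  · obtain ⟨n1, n2⟩ := nz hz
    rcases hs' with ⟨-, ⟨rfl, rfl⟩, rfl⟩ | ⟨h1, -⟩ | ⟨h1, -⟩ | ⟨h1, -⟩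
    · exact .new ⟨(u'', v''), ha'⟩
    · exact (n1 h1).elim
    · exact (n1 h1).elim
    · exact (n2 h1).elim
  · have h3 := P.cr_p_data' ha'.1
    rcases hs' with ⟨hz, -⟩ | ⟨-, rfl, h4, rfl⟩ | ⟨-, h4, rfl, h5, rfl⟩ | ⟨h4, -⟩
    · exact ((nz hz).1 h1).elim
    · have h5 := P.cr_p_data' ha''
      -- The height `K` at `v''` is one less than at `v'`, and crossings along the strand from `p`
      -- come in order of decreasing height.
      have h6 : v' < v'' := by
        by_contra hc
        have hne : v' ≠ v'' := by rintro rfl; omega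
        have := h3.2.2.2.2.2.2.2 v'' h5.1.le (by omega)
        omega
      refine P.edge_created1 (P.out1_p_src ha') (P.in1_p ha'') h3.1.le h6 h5.2.1.le fun t ht h7 h8 => ?_
      have h9 := (P.cr_p_data' ht).2.2.2.2.2.2.2 _ h3.1.le h7
      have h10 := h5.2.2.2.2.2.2.2 t (by omega) h8
      omega
    · refine P.edge_created1 (P.out1_p_src ha') (P.in1_q ha'' h5) h3.1.le h3.2.1 le_rfl fun t ht h7 h8 => ?_
      have h9 := (P.cr_p_data' ht).2.2.2.2.2.2.2 _ h3.1.le h7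
      have h10 := (P.cr_p_data' ht).2.2.2.2.2.2.1
      omega
    · omega
  · have h3 := P.cr_q_data' ha'.1
    rcases hs' with ⟨hz, -⟩ | ⟨h4, -⟩ | ⟨h4, -⟩ | ⟨-, rfl, h4, rfl⟩
    · exact ((nz hz).2 h1).elim
    · omega
    · omega
    · have h5 := P.cr_q_data' ha''
      have h6 : v'' < v' := by
        by_contra hc
        have hne : v' ≠ v'' := by rintro rfl; omega
        have := h5.2.2.2.2.2.2 v' h3.1 (by omega)
        omega
      refine P.edge_created2 (P.out2_q_src ha') (P.in2_q ha'') h5.1 h6 fun t ht h7 h8 => ?_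
      have h9 := (P.cr_q_data' ht).2.2.2.2.2.2 _ h5.1 h7
      have h10 := h3.2.2.2.2.2.2 t (by omega) h8
      omega

/-- The sinks on the strand of first arcs of level one that starts at `1` in the old word. -/
theorem snk_destroyed1 {a : D.Snk} (h1 : D.lev1 a.1 = 1) (h2 : D.key1 a.1 ≤ p) :
    a.1.2 = p ∧ D.key1 a.1 = a.1.1 := by
  obtain ⟨⟨u, v⟩, ha⟩ := a
  simp only at h1 h2 ha ⊢
  have := P.lt
  rcases P.cr_cases ha with hz | ⟨rfl, -, -, -, -, h3, -⟩ | ⟨rfl, -, -, -, -, h3, -⟩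
  · have := P.zone_lev1 hz ha h1; omega
  · exact ⟨rfl, h3⟩
  · omega

/-- The sinks on the strand of second arcs of level one that ends at `q` in the old word. -/
theorem snk_destroyed2 {a : D.Snk} (h1 : D.lev2 a.1 = 1) (h2 : p ≤ D.key2 a.1) (h3 : D.key2 a.1 < q) :
    a.1.2 = p ∧ D.K a.1.1 = 1 ∧ D.key2 a.1 = p ∨ a.1.2 = q ∧ D.key2 a.1 = a.1.1 := by
  obtain ⟨⟨u, v⟩, ha⟩ := a
  simp only at h1 h2 h3 ha ⊢
  rcases P.cr_cases ha with hz | ⟨rfl, -, -, -, -, -, h4, h5, -⟩ | ⟨rfl, -, -, -, -, -, -, h4, -⟩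
  · have := P.zone_lev2 hz ha h1; omega
  · left; omega
  · right; omega

/-- Consecutive crossings on the arc from `1` to `p` have consecutive levels of `K`, so source and
next sink go to the same new crossing and the piece becomes its new edge. The initial piece from `1`
becomes the piece that starts at `N + 1`. -/
theorem edge_destroyed1 {d e : D.HE} {d' e' : D'.HE} (hd : HERel D D' p q d d')
    (he : HERel D D' p q e e') {k k' : ℕ} (h1 : Out1 d 1 k) (h2 : In1 e 1 k') (hkk : k < k')
    (hc : ∀ (e' : D.HE) (j : ℕ), In1 e' 1 j → k < j → k' ≤ j) (hkp : k' ≤ p) : Edge d' e' := by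
  have c2 := P.lt
  have hle := P.le
  obtain ⟨⟨⟨u, v⟩, ha⟩, rfl, g1, g2⟩ := in1_iff.1 h2
  obtain ⟨g3, g4⟩ := P.snk_destroyed1 (a := ⟨(u, v), ha⟩) g1.symm (g2 ▸ hkp)
  obtain ⟨⟨⟨u'', v''⟩, ha''⟩, τ, hs', rfl⟩ := he.snk_inv
  simp only [SnkRel, Prod.mk.injEq] at g1 g2 g3 g4 hs' ha ha''
  have hu : k' = u := g2.trans g4
  subst g3 hu
  have hK := P.cr_p_data ha
  have hin (g : ℤ) (g1 : 0 < g) (g2 : g ≤ D.K v) : ∃ c, D.Cr c v ∧ D.K c = g ∧ (k < c → k' ≤ c) := by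
    obtain ⟨c, hcr, hcK⟩ := P.exists_cr_p g1 g2
    have h := P.cr_p_data hcr
    exact ⟨c, hcr, hcK, hc _ c (in1_iff.2 ⟨⟨(c, v), hcr⟩, rfl, h.2.2.1.symm, h.2.2.2.1.symm⟩)⟩
  obtain ⟨i, rfl, hl, hH, rfl⟩ | ⟨⟨⟨w, x⟩, hb, hlt⟩, rfl, f1, f2⟩ := out1_iff.1 h1
  · obtain ⟨j, rfl, hj⟩ := hd.bdry_inv
    have hi : (i : ℕ) = 0 := by
      by_contra hc
      have h3 := D.letter_zero hl
      have h4 := P.H_pos (0 + i + 1 - 1) (by omega) (by omega)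
      omega
    -- Otherwise the crossing of level one would come earlier on the arc.
    have hK1 : D.K k' = 1 := by
      obtain ⟨c, k1, k2, k3⟩ := hin 1 (by omega) (by have := hK.2.2.2.2.2.2.2 v hK.2.1 le_rfl; omega)
      have h4 := P.cr_p_data k1
      have := hK.2.2.2.2.2.2.2 c (k3 (by omega)) h4.2.1
      omega
    rcases hs' with ⟨hz, -⟩ | ⟨-, rfl, h4, rfl⟩ | ⟨-, h4, rfl, h5, rfl⟩ | ⟨h4, -⟩
    · exact (P.not_zone_left ha.1 hz).elim
    · have := P.cr_p_data' ha''; omega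
    · have h6 := P.cr_q_data' ha''
      have h7 : 1 + (j : ℕ) + 1 = N + 1 := by omega
      have h8 := P.heights (N + 1)
      refine P.edge_created2 (k := N + 1) (out2_iff.2 (Or.inl ⟨j, rfl, ?_, ?_, h7.symm⟩)) (P.in2_q ha'') h6.1
        (by omega) fun m hm m1 m2 => ?_
      · rw [h7]; exact P.letter_last'
      · rw [h7]; omega
      · have := (P.cr_q_data' hm).2.2.2.2.2.2 v'' h6.1 m1
        have := D'.H_nonneg m
        omega
    · omega
  · obtain ⟨⟨⟨u', v'⟩, ha'⟩, σ, hs, rfl⟩ := hd.src_inv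
    obtain ⟨f3, f4⟩ := P.snk_destroyed1 (a := ⟨(w, x), hb⟩) f1.symm (f2 ▸ by omega)
    simp only [SrcRel, Prod.mk.injEq] at f1 f2 f3 f4 hs ha' hb hlt
    have hw : k = w := f2.trans f4
    subst f3 hw
    have hK' := P.cr_p_data hb
    have hKK : D.K k' = D.K k + 1 := by
      have l1 : D.letter k' = 1 := by
        rcases P.cr_cases ha with hz | ⟨-, -, -, h5, -⟩ | ⟨h5, -⟩
        · exact (P.not_zone_left ha.1 hz).elim
        · exact h5
        · omega
      have l2 := D.letter_one l1
      have l3 := hK'.2.2.2.2.2.2.2 (k' - 1) (by omega) (by omega)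
      have l4 := hK.2.2.2.2.2.2.2 x hK.2.1 le_rfl
      obtain ⟨c, k1, k2, k3⟩ := hin (D.K k + 1) (by omega) (by omega)
      have h4 := P.cr_p_data k1
      have h5 : k < c := by
        by_contra hc
        have := h4.2.2.2.2.2.2.2 k (by omega) hb.1
        omega
      have := hK.2.2.2.2.2.2.2 c (k3 h5) h4.2.1
      omega
    rcases hs with ⟨hz, -⟩ | ⟨-, rfl, f5, rfl⟩ | ⟨h4, -⟩
    · exact (P.not_zone_left hb.1 hz).elim
    · rcases hs' with ⟨hz, -⟩ | ⟨-, rfl, h4, rfl⟩ | ⟨-, h4, rfl, h5, rfl⟩ | ⟨h4, -⟩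
      · exact (P.not_zone_left ha.1 hz).elim
      · obtain rfl := P.cr_p_unique' ha'.1 ha'' (by omega)
        exact .new ⟨(_, _), ha'⟩
      · omega
      · omega
    · omega

/-- Between `p` and `q` the crossings on the old second arc have consecutive levels of `H`, and its
pieces become new edges of crossings at `q`. The piece from the boundary vertex `q` becomes the stem
of the new fork. -/
theorem edge_destroyed2 {d e : D.HE} {d' e' : D'.HE} (hd : HERel D D' p q d d')
    (he : HERel D D' p q e e') {k k' : ℕ} (h1 : Out2 d 1 k) (h2 : In2 e 1 k') (hkk : k' < k)
    (hc : ∀ (e' : D.HE) (j : ℕ), In2 e' 1 j → j < k → j ≤ k') (hpk : p ≤ k') (hkq : k ≤ q) :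
    Edge d' e' := by
  have c2 := P.lt
  have eH := P.heights_p_q.2.2.2.2
  have hin (g : ℤ) (g1 : 0 < g) (g2 : g ≤ D.H q) : ∃ b, D.Cr b q ∧ D.H b = g ∧ (b < k → b ≤ k') := by
    obtain ⟨b, hcr, -, hcH⟩ := P.exists_cr_q g1 g2
    have h := P.cr_q_data hcr
    exact ⟨b, hcr, hcH, hc _ b (in2_iff.2 ⟨⟨(b, q), hcr⟩, rfl, h.2.2.2.2.1.symm, h.2.2.2.2.2.1.symm⟩)⟩
  obtain ⟨⟨⟨u, v⟩, ha⟩, rfl, g1, g2⟩ := in2_iff.1 h2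
  have g3 := P.snk_destroyed2 (a := ⟨(u, v), ha⟩) g1.symm (g2 ▸ hpk) (g2 ▸ by omega)
  obtain ⟨⟨⟨u'', v''⟩, ha''⟩, τ, hs', rfl⟩ := he.snk_inv
  simp only [SnkRel, Prod.mk.injEq] at g1 g2 g3 hs' ha ha''
  have nz : ¬ (Zone p q u v ∧ (v = p ∨ v = q)) := by have := ha.1; unfold Zone; omega
  -- The number `r` is the level in `H` of the sink of this piece, with `0` for the sink at `p`. It
  -- treats both kinds of sinks alike.
  obtain ⟨r, hr, hr'⟩ : ∃ r : ℤ, (∀ g : ℤ, 0 < g → g ≤ D.H q → ∃ b, D.Cr b q ∧ D.H b = g ∧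
      (b < k → g ≤ r)) ∧ u'' = q ∧ τ 1 = 2 ∧ D'.H v'' = r ∧ r ≤ D.H q ∧ 0 ≤ r ∧
      (0 < r → D.Cr k' q ∧ D.H k' = r) := by
    rcases hs' with ⟨hz, -⟩ | ⟨f1, f2, f3, -⟩ | ⟨f1, f2, f3, f4, rfl⟩ | ⟨f1, f2, f3, rfl⟩
    · exact (nz ⟨hz, by omega⟩).elim
    · have := P.K_pos_of_cr' (t := v'') (by rwa [f2] at ha'')
      omega
    · refine ⟨0, fun g g1 g2 => ?_, f3, rfl, f4, by have := D'.H_nonneg q; omega, le_rfl, fun h => by omega⟩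
      obtain ⟨b, b1, b2, b3⟩ := hin g g1 g2
      have := P.cr_q_data b1
      exact ⟨b, b1, b2, fun h => by have := b3 h; omega⟩
    · subst f1
      have hu : k' = u := by omega
      subst hu
      have h4 := P.cr_q_data ha
      refine ⟨D.H k', fun g g1 g2 => ?_, f2, rfl, f3, h4.2.2.2.2.2.2.2 _ ha.1 le_rfl, h4.2.2.2.2.2.2.1.le,
        fun _ => ⟨ha, rfl⟩⟩
      obtain ⟨b, b1, b2, b3⟩ := hin g g1 g2
      have h5 := P.cr_q_data b1
      refine ⟨b, b1, b2, fun h => ?_⟩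
      have := h5.2.2.2.2.2.2.2 k' (b3 h) (by omega)
      omega
  obtain ⟨rfl, hτ, hv, hrq, hr0, hrk⟩ := hr'
  rw [hτ]
  obtain ⟨i, rfl, hl, hH, rfl⟩ | ⟨⟨⟨w, x⟩, hb, hlt⟩, rfl, f1, f2⟩ := out2_iff.1 h1
  · obtain ⟨j, rfl, hj⟩ := hd.bdry_inv
    have hi : 0 + (i : ℕ) + 1 = u'' := by
      by_contra hne
      have := P.K_pos (0 + i + 1) (by omega) (by omega)
      omega
    have hj' : 1 + (j : ℕ) + 1 = u'' := by have := P.one_lt; omega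
    have hrH : r = D.H u'' := by
      rcases (D.H_nonneg u'').lt_or_eq with h | h
      · obtain ⟨b, b1, b2, b3⟩ := hr _ h le_rfl
        have := P.cr_q_data b1
        have := b3 (by omega)
        omega
      · omega
    have hvH : D'.H u'' = D'.H v'' := by rw [eH, hv, hrH]
    obtain rfl := P.cr_q_unique' (D'.cr_self P.letter_q') ha'' hvH
    subst hj'
    exact .stem j P.letter_q'
  · obtain ⟨⟨⟨u', v'⟩, ha'⟩, σ, hs, rfl⟩ := hd.src_inv
    have hx : x = u'' ∧ k = w := by
      have h3 : D.lev2 (w, x) = 1 := f1.symm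
      have h4 : D.key2 (w, x) = k := f2.symm
      clear f1 f2
      simp only at hb hlt
      rcases P.cr_cases hb with hz | ⟨h5, h6, h7, -, -, -, h8, h9, -⟩ | ⟨h5, -, -, -, -, -, h8, h9, -⟩
      · have := P.zone_lev2 hz hb h3; omega
      · omega
      · omega
    simp only [SrcRel, Prod.mk.injEq] at hs ha' hb hlt
    obtain ⟨rfl, rfl⟩ := hx
    have h4 := P.cr_q_data hb
    have nz' : ¬ Zone p x k x := by unfold Zone; omega
    rcases hs with ⟨hz, -⟩ | ⟨h5, -⟩ | ⟨-, rfl, h5, rfl⟩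
    · exact (nz' hz).elim
    · omega
    · have h6 := h4.2.2.2.2.2.2.2 _ hb.1 le_rfl
      have h7 : r < D.H k := by
        by_contra h
        obtain ⟨h8, h9⟩ := hrk (by omega)
        have h10 := (P.cr_q_data h8).2.2.2.2.2.2.2 k hkk.le hb.1
        have h11 := P.cr_q_unique h8 hb (by omega)
        omega
      have h8 : r = D.H k - 1 := by
        by_contra hne
        obtain ⟨b, b1, b2, b3⟩ := hr (D.H k - 1) (by omega) (by omega)
        have h9 := P.cr_q_data b1
        have : b < k := by
          by_contra hbk
          have := h4.2.2.2.2.2.2.2 b (by omega) b1.1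
          omega
        have := b3 this
        omega
      obtain rfl := P.cr_q_unique' ha'.1 ha'' (by omega)
      exact .new ⟨(_, _), ha'⟩

theorem edge_map {d e : D.HE} {d' e' : D'.HE} (hE : Edge d e) (hd : HERel D D' p q d d')
    (he : HERel D D' p q e e') : Edge d' e' := by
  have c1 := P.one_lt
  have c2 := P.lt
  obtain ⟨i, hi, rfl, rfl⟩ | ⟨a, rfl, rfl⟩ | ⟨h, k, k', h1, h2, h3, h4⟩ | ⟨h, k, k', h1, h2, h3, h4⟩ :=
    edge_iff.1 hE
  · exact P.edge_stem hi hd he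
  · exact P.edge_new a hd he
  · have hpos := h1.pos
    obtain ⟨hk1, hb⟩ := P.first_block h1 h3 h4
    by_cases hk : h = 1 ∧ k < p
    · obtain ⟨rfl, hkp⟩ := hk
      exact P.edge_destroyed1 hd he h1 h2 h3 h4 (by omega)
    have e1 := P.heights k
    -- The piece stays inside one block, so the level changes by the same amount at all its points.
    have hdiff (j : ℕ) (j1 : k < j) (j2 : j ≤ k') : D'.H (j - 1) - D.H (j - 1) = D'.H k - D.H k := by
      have := P.heights (j - 1)
      omega
    have m1 := P.out1_map h1 hk hd
    have m2 := P.in1_map h2 (by omega) he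
    rw [show h + D'.H (k' - 1) - D.H (k' - 1) = h + D'.H k - D.H k by
      have := hdiff k' h3 le_rfl; omega] at m2
    refine .first _ _ _ k k' m1 m2 h3 fun e'' j hj hkj => ?_
    by_contra hlt
    -- A new sink inside the piece would pull back to an old sink before `k'`.
    obtain ⟨f, hf⟩ := P.in1_back hj (by omega)
    have := hdiff j hkj (by omega)
    rw [show h + D'.H k - D.H k + D.H (j - 1) - D'.H (j - 1) = h by omega] at hf
    exact hlt (h4 f j hf hkj)
  · have hpos := h1.pos
    obtain ⟨hk1, hkN, hb⟩ := P.second_block h1 h3 h2 h4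
    by_cases hk : h = 1 ∧ p < k ∧ k ≤ q
    · obtain ⟨rfl, hkp⟩ := hk
      exact P.edge_destroyed2 hd he h1 h2 h3 h4 (by omega) (by omega)
    have e1 := P.heights k'
    have hdiff (j : ℕ) (j1 : k' ≤ j) (j2 : j < k) : D'.K j - D.K j = D'.K k' - D.K k' := by
      have := P.heights j
      omega
    have m1 := P.out2_map h1 hk hd
    have m2 := P.in2_map h2 (by omega) he
    rw [show h + D'.K (k - 1) - D.K (k - 1) = h + D'.K k' - D.K k' by
      have := hdiff (k - 1) (by omega) (by omega); omega] at m1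
    refine .second _ _ _ k k' m1 m2 h3 fun e'' j hj hkj => ?_
    by_contra hlt
    obtain ⟨f, hf⟩ := P.in2_back hj (by omega)
    have := hdiff j (by omega) hkj
    rw [show h + D'.K k' - D.K k' + D.K j - D'.K j = h by omega] at hf
    exact hlt (h4 f j hf hkj)

omit P in
theorem HERel.isOutHE {d : D.HE} {d' : D'.HE} (h : HERel D D' p q d d') (h' : IsOutHE d') : IsOutHE d := by
  rcases h with ⟨i, rfl, rfl⟩ | ⟨a, a', σ, t, -, rfl, rfl⟩ | ⟨a, a', σ, t, -, rfl, rfl⟩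
  · trivial
  · exact h'
  · trivial

/-- The diagram of the promoted word is the rotation of the diagram of the word. -/
theorem graph_equivalent : D'.graph.Equivalent D.graph.rotate := by
  obtain ⟨φ, hφ⟩ := P.exists_equiv
  have hedge (d e : D.HE) : Edge d e ↔ Edge (φ d) (φ e) := by
    -- For the converse, `d` has some partner in the old diagram, and its image is the unique
    -- partner of the image of `d`.
    refine ⟨fun h => P.edge_map h (hφ d) (hφ e), fun h => ?_⟩
    obtain ⟨e₁, h1⟩ := exists_edge_out ((hφ d).isOutHE h.isOut_isIn.1)
    have h2 := P.edge_map h1 (hφ d) (hφ e₁)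
    rwa [φ.injective (h.right_unique h2)]
  have hsymm : D.graph.rotate.Equivalent D'.graph := by
    refine ⟨φ, fun d => ?_, hedge, fun i => ?_⟩
    · exact HERel.right_unique P (hφ _) (HERel.ccw P (hφ d))
    · exact HERel.right_unique P (hφ _) (Or.inl ⟨i, rfl, rfl⟩)
  exact hsymm.symm

end Promotes

theorem StdTableau.web_promotion_equivalent {n : ℕ} (T : StdTableau n) (hn : 0 < n) :
    T.promotion.web.Equivalent T.web.rotate := by
  obtain ⟨p, q, P⟩ := T.exists_promotes hn
  exact ((T.promotion.model_word 1).web_equivalent.trans P.graph_equivalent).trans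
    (T.model_word 0).web_equivalent.rotate.symm

theorem mainTheorem2 (n : ℕ) (T : StdTableau n) :
    T.web.IsWeb ∧ T.promotion.web.Equivalent T.web.rotate := by
  refine ⟨(T.word 0).graph_isWeb.congr (T.model_word 0).web_equivalent, ?_⟩
  -- For `n = 0` there is no box to slide; there is only one tableau, and rotation acts on no
  -- boundary vertices.
  rcases n.eq_zero_or_pos with rfl | hn
  · have h (T' : StdTableau 0) : T' = T := by
      obtain ⟨e, _, _, _⟩ := T
      obtain ⟨e', _, _, _⟩ := T'
      obtain rfl : e' = e := funext fun _ => funext fun c => c.elim0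
      rfl
    rw [h T.promotion]
    exact ⟨Equiv.refl _, fun _ => rfl, fun _ _ => Iff.rfl, fun i => i.elim0⟩
  · exact T.web_promotion_equivalent hn
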